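/- Let $G=\mathrm{PSL}_2(\mathbb R)$ act on the upper half plane $\mathbb H$ and on $\mathbb R\cup\{\infty\}$ by linear fractional transformations, and let $\Gamma\subset G$ be a torsion-free lattice (a discrete subgroup of finite covolume) which has cusps, a cusp being a point of $\mathbb R\cup\{\infty\}$ fixed by a parabolic element of $\Gamma$. For a cusp $\mathfrak a$ let $\Gamma_{\mathfrak a}$ be its stabilizer in $\Gamma$; a scaling element for $\mathfrak a$ is an element $\sigma_{\mathfrak a}\in G$ with $\sigma_{\mathfrak a}\infty=\mathfrak a$ and $\sigma_{\mathfrak a}^{-1}\Gamma_{\mathfrak a}\sigma_{\mathfrak a}=\pm\begin{pmatrix}1&\mathbb Z\\0&1\end{pmatrix}$. Let $V$ be a finite-dimensional complex inner product space and $\chi:\Gamma\to\mathrm{GL}(V)$ a representation which is unitary at the cusps, i.e. $\chi(\gamma)$ is unitary for every cusp $\mathfrak a$ and every $\gamma\in\Gamma_{\mathfrak a}$. Let $P_{\mathfrak a}$ be the orthogonal projection of $V$ onto the space $V^{\chi(\Gamma_{\mathfrak a})}$ of $\Gamma_{\mathfrak a}$-fixed vectors, and let $\|\cdot\|$ be the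 operator norm. For a scaling element $\sigma_{\mathfrak a}$, $z\in\mathbb H$ and $s\in\mathbb C$ put $$E_{\mathfrak a}(z,s,\chi)=\sum_{\gamma\in\Gamma_{\mathfrak a}\backslash\Gamma}\operatorname{Im}(\sigma_{\mathfrak a}^{-1}\gamma z)^s\,\chi(\gamma^{-1})P_{\mathfrak a}.$$ For $\gamma=\pm\begin{pmatrix}a&b\\c&d\end{pmatrix}$ put $\mu(\gamma)=a^2+b^2+c^2+d^2$, and for $z,w\in\mathbb H$ put $u(z,w)=|z-w|^2/(\operatorname{Im}z\operatorname{Im}w)$. Call $\sigma_0>1$ a growth exponent of $\chi$ if there are a constant $C>0$ and a continuous function $C':\mathbb H\times\mathbb H\to(0,\infty)$ such that for all $\gamma\in\Gamma$ and $z,w\in\mathbb H$ $$\|\chi(\gamma)\|\le C\mu(\gamma)^{\sigma_0-1},\qquad \|\chi(\gamma)\|\le C'(z,w)\,(u(z,\gamma w)+1)^{\sigma_0-1}.$$ Then the following hold. (1) There exists a growth exponent $\sigma_0>1$ of $\chi$, and every cusp of $\Gamma$ has a scaling element. (2) For every growth exponent $\sigma_0$ of $\chi$, every cusp $\mathfrak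 a$ and every scaling element $\sigma_{\mathfrak a}$ for $\mathfrak a$, the Eisenstein series $E_{\mathfrak a}(z,s,\chi)$ converges absolutely and locally uniformly in $(z,s)$, $z\in\mathbb H$, $\operatorname{Re}(s)>\sigma_0$ (that is, the series of operator norms converges locally uniformly, and the series converges locally uniformly to its sum). Moreover there is a constant $C>0$ such that for all $z=x+iy\in\mathbb H$ and $\gamma\in\Gamma$ $$\|\chi(\gamma)\|,\ \|\chi(\gamma^{-1})\|\le C\,\operatorname{Im}(\sigma_{\mathfrak a}^{-1}\gamma\sigma_{\mathfrak a}z)^{1-\sigma_0}\left(\frac{1+|z|^2}{y}\right)^{\sigma_0-1};$$ in particular, if $\infty$ is a cusp of width one (so that $\sigma_\infty=1$ is allowed), $\|\chi(\gamma)\|,\|\chi(\gamma^{-1})\|\le C\operatorname{Im}(\gamma z)^{1-\sigma_0}((1+|z|^2)/y)^{\sigma_0-1}$. (3) There exists $\alpha>0$ such that for every cusp $\mathfrak a$ and every scaling element $\sigma_{\mathfrak a}$ for $\mathfrak a$ there is a continuous function $C:\mathbb H\to(0,\infty)$ with $\|\chi(\gamma)\|\le C(z)\operatorname{Im}(\sigma_{\mathfrak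 a}^{-1}\gamma z)^{-\alpha}$ for all $\gamma\in\Gamma$ and $z\in\mathbb H$, and $E_{\mathfrak a}(z,s,\chi)$ converges absolutely and locally uniformly in $(z,s)$ for $\operatorname{Re}(s)>1+\alpha$. -/

import Mathlib

open MeasureTheory Matrix UpperHalfPlane
open scoped MatrixGroups OnePoint

namespace TwistedEisenstein

/-! ## The group `PSL(2, ℝ)` and its actions -/

/-- `PSL(2, ℝ)` acts on the upper half plane by linear fractional transformations. -/
noncomputable instance instMulActionUpperHalfPlane : MulAction PSL(2, ℝ) ℍ :=
  MulAction.compHom ℍ (ProjectiveSpecialLinearGroup.toPGL (n := Fin 2) (R := ℝ))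

theorem mk_smul_upperHalfPlane (g : SL(2, ℝ)) (z : ℍ) :
    (QuotientGroup.mk g : PSL(2, ℝ)) • z = g • z := rfl

/-- `PGL(2, ℝ)` acts on the boundary `ℝ ∪ {∞}` by linear fractional transformations. -/
noncomputable instance instMulActionBoundaryPGL : MulAction PGL(2, ℝ) (OnePoint ℝ) :=
  Matrix.ProjGenLinGroup.mulActionOfGL (by
    intro u x
    cases x with
    | infty => simp [OnePoint.smul_infty_eq_self_iff]
    | coe x => simp [OnePoint.smul_some_eq_ite])

/-- `PSL(2, ℝ)` acts on the boundary `ℝ ∪ {∞}` by linear fractional transformations. -/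
noncomputable instance instMulActionBoundary : MulAction PSL(2, ℝ) (OnePoint ℝ) :=
  MulAction.compHom (OnePoint ℝ) (ProjectiveSpecialLinearGroup.toPGL (n := Fin 2) (R := ℝ))

theorem mk_smul_boundary (g : SL(2, ℝ)) (x : OnePoint ℝ) :
    (QuotientGroup.mk g : PSL(2, ℝ)) • x = (SpecialLinearGroup.toGL g : GL (Fin 2) ℝ) • x := rfl

/-- The unipotent matrix `(1 t; 0 1)`. -/
def translationSL (t : ℝ) : SL(2, ℝ) :=
  ⟨!![1, t; 0, 1], by simp [Matrix.det_fin_two]⟩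

/-- The translation `z ↦ z + t`, as an element `± (1 t; 0 1)` of `PSL(2, ℝ)`. -/
def translation (t : ℝ) : PSL(2, ℝ) :=
  QuotientGroup.mk (translationSL t)

theorem im_translation_smul (t : ℝ) (z : ℍ) : (translation t • z).im = z.im := by
  rw [translation, mk_smul_upperHalfPlane, ← UpperHalfPlane.coe_im, ← UpperHalfPlane.coe_im,
    UpperHalfPlane.coe_specialLinearGroup_apply]
  simp [translationSL]

/-- `μ(g) = a² + b² + c² + d²` for `g = ± (a b; c d)` in `PSL(2, ℝ)`. -/
noncomputable def frobeniusSq (g : PSL(2, ℝ)) : ℝ :=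
  Quotient.liftOn g (fun A : SL(2, ℝ) ↦ A 0 0 ^ 2 + A 0 1 ^ 2 + A 1 0 ^ 2 + A 1 1 ^ 2) (by
    intro A B hAB
    have h := QuotientGroup.leftRel_apply.mp hAB
    obtain ⟨r, hr, hr'⟩ := Matrix.SpecialLinearGroup.mem_center_iff.mp h
    have hB : B = A * (A⁻¹ * B) := by group
    have hr2 : r ^ 2 = 1 := by simpa using hr
    have key : ∀ i j, B i j = r * A i j := by
      intro i j
      have h1 : (B : Matrix (Fin 2) (Fin 2) ℝ) = (A : Matrix (Fin 2) (Fin 2) ℝ) *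
          Matrix.scalar (Fin 2) r := by
        rw [hr', ← Matrix.SpecialLinearGroup.coe_mul, ← hB]
      have h2 := congrFun (congrFun h1 i) j
      rw [h2]
      simp [mul_comm]
    simp only [key, mul_pow, hr2, one_mul])

/-- The point-pair invariant `u(z, w) = |z - w|² / (Im z Im w)`. -/
noncomputable def pointPair (z w : ℍ) : ℝ :=
  ‖(z : ℂ) - (w : ℂ)‖ ^ 2 / (z.im * w.im)

/-! ## Lattices, cusps and scaling elements -/

/-- A lattice in `PSL(2, ℝ)`: a discrete subgroup which has a fundamental domain of finite
hyperbolic area in the upper half plane (`volume` on `ℍ` is `dx dy / y²`). -/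
def IsLattice (Γ : Subgroup PSL(2, ℝ)) : Prop :=
  DiscreteTopology Γ ∧
    ∃ F : Set ℍ, IsFundamentalDomain Γ F (volume : Measure ℍ) ∧ volume F < ⊤

/-- The preimage in `GL(2, ℝ)` (inside `SL(2, ℝ)`) of a subgroup of `PSL(2, ℝ)`. -/
noncomputable def preimageGL (Γ : Subgroup PSL(2, ℝ)) : Subgroup (GL (Fin 2) ℝ) :=
  (Γ.comap (QuotientGroup.mk' (Subgroup.center SL(2, ℝ)))).map
    (SpecialLinearGroup.toGL (n := Fin 2) (R := ℝ))

/-- `𝔞 ∈ ℝ ∪ {∞}` is a cusp of `Γ` if it is fixed by a parabolic element of `Γ`. -/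
def IsCuspOf (𝔞 : OnePoint ℝ) (Γ : Subgroup PSL(2, ℝ)) : Prop :=
  IsCusp 𝔞 (preimageGL Γ)

/-- The stabilizer `Γ_𝔞`, as a subgroup of `Γ`. -/
noncomputable abbrev cuspStabilizer (Γ : Subgroup PSL(2, ℝ)) (𝔞 : OnePoint ℝ) : Subgroup Γ :=
  MulAction.stabilizer Γ 𝔞

/-- `σ` is a scaling element for `𝔞`: `σ ∞ = 𝔞` and `σ⁻¹ Γ_𝔞 σ = ± (1 ℤ; 0 1)`. -/
def IsScaling (Γ : Subgroup PSL(2, ℝ)) (𝔞 : OnePoint ℝ) (σ : PSL(2, ℝ)) : Prop :=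
  σ • (∞ : OnePoint ℝ) = 𝔞 ∧
    ∀ g : PSL(2, ℝ), (g ∈ Γ ∧ g • 𝔞 = 𝔞) ↔ ∃ k : ℤ, σ⁻¹ * g * σ = translation k

/-! ## Representations -/

section Representation

variable {Γ : Subgroup PSL(2, ℝ)} {V : Type*} [NormedAddCommGroup V] [InnerProductSpace ℂ V]

/-- `χ` is unitary at the cusps: for every cusp `𝔞` all `χ γ`, `γ ∈ Γ_𝔞`, are unitary, i.e.
these (invertible) operators preserve the inner product. -/
def UnitaryAtCusps (χ : Γ →* (V →L[ℂ] V)ˣ) : Prop :=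
  ∀ 𝔞 : OnePoint ℝ, IsCuspOf 𝔞 Γ → ∀ γ ∈ cuspStabilizer Γ 𝔞, ∀ v w : V,
    inner ℂ ((χ γ : V →L[ℂ] V) v) ((χ γ : V →L[ℂ] V) w) = inner ℂ v w

/-- The space `V^{χ(H)}` of vectors fixed by `χ(H)`. -/
def fixedSpace (χ : Γ →* (V →L[ℂ] V)ˣ) (H : Subgroup Γ) : Submodule ℂ V where
  carrier := {v | ∀ h ∈ H, (χ h : V →L[ℂ] V) v = v}
  add_mem' := by
    intro a b ha hb h hh
    rw [map_add, ha h hh, hb h hh]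
  zero_mem' := by
    intro h _
    exact map_zero _
  smul_mem' := by
    intro c x hx h hh
    rw [map_smul, hx h hh]

/-- The orthogonal projection `P_𝔞 : V → V^{χ(Γ_𝔞)}`, as an endomorphism of `V`. -/
noncomputable def cuspProjection [FiniteDimensional ℂ V] (χ : Γ →* (V →L[ℂ] V)ˣ)
    (𝔞 : OnePoint ℝ) : V →L[ℂ] V :=
  (fixedSpace χ (cuspStabilizer Γ 𝔞)).starProjection

/-- The exponents `σ₀ > 1` for which `‖χ(γ)‖ = O(μ(γ)^(σ₀ - 1))`, and also, for all `z, w ∈ ℍ`,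
`‖χ(γ)‖ = O((u(z, γ w) + 1)^(σ₀ - 1))` with an implied constant that depends continuously on
`z` and `w`, but not on `γ`. -/
def IsGrowthExponent (χ : Γ →* (V →L[ℂ] V)ˣ) (σ₀ : ℝ) : Prop :=
  1 < σ₀ ∧
  (∃ C : ℝ, 0 < C ∧ ∀ γ : Γ,
    ‖(χ γ : V →L[ℂ] V)‖ ≤ C * frobeniusSq (γ : PSL(2, ℝ)) ^ (σ₀ - 1)) ∧
  ∃ C : ℍ × ℍ → ℝ, Continuous C ∧ (∀ p, 0 < C p) ∧ ∀ (z w : ℍ) (γ : Γ),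
    ‖(χ γ : V →L[ℂ] V)‖ ≤ C (z, w) * (pointPair z ((γ : PSL(2, ℝ)) • w) + 1) ^ (σ₀ - 1)

/-! ## The Eisenstein series -/

/-- The index set `Γ_𝔞 \ Γ` of right cosets `Γ_𝔞 γ`. -/
abbrev CuspCosets (Γ : Subgroup PSL(2, ℝ)) (𝔞 : OnePoint ℝ) : Type :=
  Quotient (QuotientGroup.rightRel (cuspStabilizer Γ 𝔞))

/-- The term `Im(σ_𝔞⁻¹ γ z)^s χ(γ⁻¹) P_𝔞` of the Eisenstein series, an endomorphism of `V`
which depends only on the coset `Γ_𝔞 γ`; here `p = (z, s)`. -/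
noncomputable def eisensteinTerm [FiniteDimensional ℂ V] (χ : Γ →* (V →L[ℂ] V)ˣ)
    {𝔞 : OnePoint ℝ} {σ : PSL(2, ℝ)} (hσ : IsScaling Γ 𝔞 σ) (q : CuspCosets Γ 𝔞) (p : ℍ × ℂ) :
    V →L[ℂ] V :=
  Quotient.liftOn q
    (fun γ : Γ ↦ (((σ⁻¹ • (γ : PSL(2, ℝ)) • p.1).im : ℝ) : ℂ) ^ p.2 •
      ((χ γ⁻¹ : V →L[ℂ] V) ∘L cuspProjection χ 𝔞)) (by
    intro γ γ' h
    have h' : γ' * γ⁻¹ ∈ cuspStabilizer Γ 𝔞 := QuotientGroup.rightRel_apply.mp h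
    obtain ⟨δ, hδ, rfl⟩ : ∃ δ ∈ cuspStabilizer Γ 𝔞, γ' = δ * γ :=
      ⟨γ' * γ⁻¹, h', by group⟩
    obtain ⟨k, hk⟩ := (hσ.2 (δ : PSL(2, ℝ))).mp ⟨δ.2, hδ⟩
    have him : (σ⁻¹ • ((δ * γ : Γ) : PSL(2, ℝ)) • p.1).im
        = (σ⁻¹ • (γ : PSL(2, ℝ)) • p.1).im := by
      rw [← im_translation_smul k (σ⁻¹ • (γ : PSL(2, ℝ)) • p.1), ← hk]
      simp only [← mul_smul, Subgroup.coe_mul]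
      congr 2
      group
    have hop : (χ (δ * γ)⁻¹ : V →L[ℂ] V) ∘L cuspProjection χ 𝔞
        = (χ γ⁻¹ : V →L[ℂ] V) ∘L cuspProjection χ 𝔞 := by
      ext v
      have hv : cuspProjection χ 𝔞 v ∈ fixedSpace χ (cuspStabilizer Γ 𝔞) :=
        Submodule.starProjection_apply_mem _ v
      have := hv δ⁻¹ (inv_mem hδ)
      rw [_root_.mul_inv_rev, map_mul, Units.val_mul]
      change (χ γ⁻¹ : V →L[ℂ] V) ((χ δ⁻¹ : V →L[ℂ] V) (cuspProjection χ 𝔞 v)) = _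
      rw [this]
      rfl
    simp only [him, hop])

/-- The twisted Eisenstein series
`E_𝔞(z, s, χ) = ∑_{γ ∈ Γ_𝔞 \ Γ} Im(σ_𝔞⁻¹ γ z)^s χ(γ⁻¹) P_𝔞`; here `p = (z, s)`. -/
noncomputable def eisensteinSeries [FiniteDimensional ℂ V] (χ : Γ →* (V →L[ℂ] V)ˣ)
    {𝔞 : OnePoint ℝ} {σ : PSL(2, ℝ)} (hσ : IsScaling Γ 𝔞 σ) (p : ℍ × ℂ) : V →L[ℂ] V :=
  ∑' q : CuspCosets Γ 𝔞, eisensteinTerm χ hσ q p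

/-- `E_𝔞(z, s, χ)` converges absolutely and locally uniformly in `(z, s)` for `Re s > x`: the
series of operator norms converges locally uniformly, and the series itself converges locally
uniformly to `E_𝔞(z, s, χ)`. -/
def EisensteinConverges [FiniteDimensional ℂ V] (χ : Γ →* (V →L[ℂ] V)ˣ)
    {𝔞 : OnePoint ℝ} {σ : PSL(2, ℝ)} (hσ : IsScaling Γ 𝔞 σ) (x : ℝ) : Prop :=
  SummableLocallyUniformlyOn (fun (q : CuspCosets Γ 𝔞) (p : ℍ × ℂ) ↦ ‖eisensteinTerm χ hσ q p‖)
      {p : ℍ × ℂ | x < p.2.re} ∧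
    HasSumLocallyUniformlyOn (eisensteinTerm χ hσ) (eisensteinSeries χ hσ)
      {p : ℍ × ℂ | x < p.2.re}

end Representation

end TwistedEisenstein

/-! ## Actions and hyperbolic distances -/

namespace TwistedEisenstein

open Filter Topology

/-! The heart is polynomial growth of `χ`. Both `μ(γ)` and `(1 + |z|²)/y` are twice the hyperbolic
cosine of a distance from `i`, so `γ i` can be reached from `i` in `N = O(1 + log μ(γ))` steps of
length at most `log 2`. Push every point of this chain that lies in a cuspidal zone down to the
horocycle of height two. The pushed points lie in a set that is compact modulo `Γ`, and consecutive
ones are at distance at most 2 up to an element fixing a cusp (`IsThickProjection.exists_dist_le`).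
Such an element acts unitarily and costs nothing, while the remaining step comes from a finite
subset of `Γ`. Hence `‖χ(γ)‖` is at most a constant times `M ^ N`, a power of `μ(γ)`. The triangle
inequality turns this into the bound by `u(z, γ w) + 1`.

Compactness of the complement of the cuspidal zones is proved by hand. Finite covolume and packing
of balls make the points of injectivity radius at least `r` compact modulo `Γ`. It remains to see
that very small injectivity radius occurs only in cusps, that is, that traces of hyperbolic elements
stay away from 2 (`ProperlyDiscontinuous.exists_two_lt_le_trace`). For a short hyperbolic element,
take a shortest one with the same axis and walk away from the axis until it looks a fixed amount
different from the identity. By the shrinking of commutators near the identity, no other nontrivial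
element looks smaller there, so this point is thick. A conjugate of the element then lies in a fixed
finite set, whose traces are bounded away from 2.

For the bound by `Im(σ⁻¹ γ σ z)`, write `σ⁻¹ γ σ = (a b; c d)` with `γ` not fixing the cusp.
Shimizu's lemma gives `|c| ≥ 1`. Multiplication by the unitary stabilizer makes `|a| ≤ |c|`, after
which all entries are controlled by `c² + d²`, hence by the height of the image point. Inserted in
the Eisenstein series, this leaves a sum of `Im ^ t` with `t > 1` over an orbit that is uniformly
discrete and has bounded height. With representatives in a strip of width one, a count of boxes
compares it with a geometric series times a zeta series. -/

theorem sl_ext {A B : SL(2, ℝ)} (h00 : A 0 0 = B 0 0) (h01 : A 0 1 = B 0 1)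
    (h10 : A 1 0 = B 1 0) (h11 : A 1 1 = B 1 1) : A = B := by
  refine Matrix.SpecialLinearGroup.ext A B fun i j ↦ ?_
  fin_cases i <;> fin_cases j <;> assumption

theorem sl_mul_apply (A B : SL(2, ℝ)) (i j : Fin 2) :
    (A * B) i j = A i 0 * B 0 j + A i 1 * B 1 j := by
  have h : (A * B) i j =
    ((A : Matrix (Fin 2) (Fin 2) ℝ) * (B : Matrix (Fin 2) (Fin 2) ℝ)) i j := rfl
  rw [h, Matrix.mul_apply, Fin.sum_univ_two]

theorem coe_inv_eq (A : SL(2, ℝ)) :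
    ((A⁻¹ : SL(2, ℝ)) : Matrix (Fin 2) (Fin 2) ℝ) = !![A 1 1, -A 0 1; -A 1 0, A 0 0] :=
  (Matrix.SpecialLinearGroup.coe_inv A).trans (Matrix.adjugate_fin_two _)

theorem sl_inv_apply_zero_zero (A : SL(2, ℝ)) : A⁻¹ 0 0 = A 1 1 :=
  congrFun (congrFun (coe_inv_eq A) 0) 0

theorem sl_inv_apply_zero_one (A : SL(2, ℝ)) : A⁻¹ 0 1 = -A 0 1 :=
  congrFun (congrFun (coe_inv_eq A) 0) 1

theorem sl_inv_apply_one_zero (A : SL(2, ℝ)) : A⁻¹ 1 0 = -A 1 0 :=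
  congrFun (congrFun (coe_inv_eq A) 1) 0

theorem sl_inv_apply_one_one (A : SL(2, ℝ)) : A⁻¹ 1 1 = A 0 0 :=
  congrFun (congrFun (coe_inv_eq A) 1) 1

theorem sl_det (A : SL(2, ℝ)) : A 0 0 * A 1 1 - A 0 1 * A 1 0 = 1 :=
  (Matrix.det_fin_two (A : Matrix (Fin 2) (Fin 2) ℝ)).symm.trans A.det_coe

theorem exists_lift (g : PSL(2, ℝ)) : ∃ A : SL(2, ℝ), (QuotientGroup.mk A : PSL(2, ℝ)) = g :=
  QuotientGroup.mk_surjective g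

theorem frobeniusSq_mk (A : SL(2, ℝ)) :
    frobeniusSq (QuotientGroup.mk A) = A 0 0 ^ 2 + A 0 1 ^ 2 + A 1 0 ^ 2 + A 1 1 ^ 2 := rfl

theorem mk_eq_mk_iff (A B : SL(2, ℝ)) :
    (QuotientGroup.mk A : PSL(2, ℝ)) = QuotientGroup.mk B ↔ A = B ∨ A = -B := by
  rw [QuotientGroup.eq, Matrix.SpecialLinearGroup.mem_center_iff]
  constructor
  · rintro ⟨r, hr, h⟩
    have h1 : (B : Matrix (Fin 2) (Fin 2) ℝ) = r • (A : Matrix (Fin 2) (Fin 2) ℝ) := by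
      have : B = A * (A⁻¹ * B) := by group
      rw [this, Matrix.SpecialLinearGroup.coe_mul, ← h]
      ext i j
      simp [mul_comm]
    have hr2 : r ^ 2 = 1 := by simpa using hr
    rcases eq_or_eq_neg_of_sq_eq_sq r 1 (by simpa using hr2) with h2 | h2
    · left
      apply Subtype.ext
      rw [h1, h2, one_smul]
    · right
      apply Subtype.ext
      rw [SpecialLinearGroup.coe_neg, h1, h2, neg_one_smul, neg_neg]
  · rintro (rfl | rfl)
    · exact ⟨1, by simp, by simp⟩
    · refine ⟨-1, by simp, ?_⟩
      ext i j
      fin_cases i <;> fin_cases j <;> simp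

instance instIsIsometricSMul : IsIsometricSMul PSL(2, ℝ) ℍ := ⟨fun g ↦ by
  obtain ⟨A, rfl⟩ := exists_lift g
  exact isometry_smul ℍ A⟩

theorem im_sl_smul (A : SL(2, ℝ)) (z : ℍ) :
    (A • z).im = z.im / ((A 1 0 * z.re + A 1 1) ^ 2 + (A 1 0 * z.im) ^ 2) := by
  have h : (A • z).im = ((SpecialLinearGroup.toGL A : GL (Fin 2) ℝ) • z).im := rfl
  rw [h, UpperHalfPlane.im_smul_eq_div_normSq]
  simp [Complex.normSq_apply, denom]
  ring_nf

theorem coe_translationSL (t : ℝ) :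
    (translationSL t : Matrix (Fin 2) (Fin 2) ℝ) = !![1, t; 0, 1] := rfl

@[simp] theorem translationSL_apply_zero_zero (t : ℝ) : translationSL t 0 0 = 1 := rfl

@[simp] theorem translationSL_apply_zero_one (t : ℝ) : translationSL t 0 1 = t := rfl

@[simp] theorem translationSL_apply_one_zero (t : ℝ) : translationSL t 1 0 = 0 := rfl

@[simp] theorem translationSL_apply_one_one (t : ℝ) : translationSL t 1 1 = 1 := rfl

theorem translationSL_smul (t : ℝ) (z : ℍ) : translationSL t • z = t +ᵥ z := by
  ext
  rw [UpperHalfPlane.coe_specialLinearGroup_apply]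
  simp [add_comm]

theorem translation_smul (t : ℝ) (z : ℍ) : translation t • z = t +ᵥ z := translationSL_smul t z

theorem translationSL_add (s t : ℝ) :
    translationSL (s + t) = translationSL s * translationSL t := by
  apply Subtype.ext
  simp [coe_translationSL, add_comm]

theorem translation_add (s t : ℝ) : translation (s + t) = translation s * translation t := by
  rw [translation, translationSL_add]; rfl

theorem translationSL_zero : translationSL 0 = 1 := by
  ext i j
  fin_cases i <;> fin_cases j <;> simp [translationSL]

theorem translation_zero : translation 0 = 1 := by
  rw [translation, translationSL_zero]; rfl

theorem translation_neg (t : ℝ) : translation (-t) = (translation t)⁻¹ := by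
  rw [eq_inv_iff_mul_eq_one, ← translation_add, neg_add_cancel, translation_zero]

theorem translation_injective : Function.Injective translation := by
  intro s t h
  have := congrArg (fun g : PSL(2, ℝ) ↦ (g • I).re) h
  simpa [translation_smul] using this

/-- This and the next two lemmas translate the weights `(1 + |z|²)/y` and `μ` of the theorem into
distances from `i`, so that the triangle inequality applies to them. -/
theorem two_mul_cosh_dist_I (z : ℍ) :
    2 * Real.cosh (dist I z) = (1 + ‖(z : ℂ)‖ ^ 2) / z.im := by
  have := z.im_pos
  rw [UpperHalfPlane.cosh_dist, Complex.dist_eq, ← Complex.normSq_eq_norm_sq,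
    ← Complex.normSq_eq_norm_sq]
  simp [Complex.normSq_apply]
  field_simp
  ring

theorem cosh_dist_I_smul (A : SL(2, ℝ)) :
    2 * Real.cosh (dist I (A • I)) = A 0 0 ^ 2 + A 0 1 ^ 2 + A 1 0 ^ 2 + A 1 1 ^ 2 := by
  have hdet := sl_det A
  have hn : ‖((A • I : ℍ) : ℂ)‖ ^ 2 = (A 0 0 ^ 2 + A 0 1 ^ 2) / (A 1 0 ^ 2 + A 1 1 ^ 2) := by
    rw [UpperHalfPlane.coe_specialLinearGroup_apply, ← Complex.normSq_eq_norm_sq,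
      Complex.normSq_div]
    simp only [Complex.normSq_apply]
    simp
    ring_nf
  have hpos : 0 < A 1 0 ^ 2 + A 1 1 ^ 2 := by
    by_contra! h
    have h1 : A 1 0 = 0 := by nlinarith [sq_nonneg (A 1 0), sq_nonneg (A 1 1)]
    have h2 : A 1 1 = 0 := by nlinarith [sq_nonneg (A 1 0), sq_nonneg (A 1 1)]
    simp [h1, h2] at hdet
  rw [two_mul_cosh_dist_I, hn, im_sl_smul]
  simp
  field_simp
  ring

theorem two_mul_cosh_dist (g : PSL(2, ℝ)) :
    2 * Real.cosh (dist I (g • I)) = frobeniusSq g := by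
  obtain ⟨A, rfl⟩ := exists_lift g
  exact cosh_dist_I_smul A

theorem cosh_dist_eq_pointPair (z w : ℍ) :
    Real.cosh (dist z w) = 1 + pointPair z w / 2 := by
  rw [UpperHalfPlane.cosh_dist, pointPair, Complex.dist_eq, div_div]
  ring_nf

end TwistedEisenstein

/-! ## Proper discontinuity of discrete groups -/

namespace TwistedEisenstein

open Filter Topology

/-- The subgroup `Γ` of `PSL(2, ℝ)` has only finitely many elements moving `i` by a bounded
hyperbolic distance. -/
def ProperlyDiscontinuous (Γ : Subgroup PSL(2, ℝ)) : Prop :=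
  ∀ R : ℝ, {A : SL(2, ℝ) | (QuotientGroup.mk A : PSL(2, ℝ)) ∈ Γ ∧ dist I (A • I) ≤ R}.Finite

/-- The kernel `±1` is finite, so the preimage in `SL(2, ℝ)` is again discrete, and discrete
subgroups there act properly discontinuously on `ℍ`. -/
theorem properlyDiscontinuous_of_discrete (Γ : Subgroup PSL(2, ℝ)) [DiscreteTopology Γ] :
    ProperlyDiscontinuous Γ := by
  set Γ' : Subgroup SL(2, ℝ) := Γ.comap (QuotientGroup.mk' (Subgroup.center SL(2, ℝ))) with hΓ'
  have hdisc : DiscreteTopology Γ' := by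
    obtain ⟨U, hU, hU1⟩ := isOpen_induced_iff.mp (isOpen_discrete ({1} : Set Γ))
    have hmem : ∀ g : PSL(2, ℝ), g ∈ U → g ∈ Γ → g = 1 := by
      intro g hg hgΓ
      have : (⟨g, hgΓ⟩ : Γ) ∈ ({1} : Set Γ) := by rw [← hU1]; exact hg
      exact congrArg Subtype.val (Set.mem_singleton_iff.mp this)
    have h1U : (1 : PSL(2, ℝ)) ∈ U := by
      have : (1 : Γ) ∈ Subtype.val ⁻¹' U := by rw [hU1]; rfl
      exact this
    -- The preimage of `U` meets the lifted group in `±1` only; removing `-1` isolates the identity.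
    have hV : IsOpen ((fun A : SL(2, ℝ) ↦ (QuotientGroup.mk A : PSL(2, ℝ))) ⁻¹' U \ {-1}) :=
      (hU.preimage QuotientGroup.continuous_mk).sdiff isClosed_singleton
    refine discreteTopology_of_isOpen_singleton_one ?_
    refine isOpen_induced_iff.mpr ⟨_, hV, ?_⟩
    ext ⟨A, hA⟩
    simp only [Set.mem_preimage, Set.mem_sdiff, Set.mem_singleton_iff]
    constructor
    · rintro ⟨h1, h2⟩
      have h3 := hmem _ h1 hA
      rcases (mk_eq_mk_iff A 1).mp h3 with h | h
      · exact Subtype.ext h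
      · exact absurd h h2
    · intro h
      have h' : A = 1 := congrArg Subtype.val h
      subst h'
      refine ⟨h1U, fun h ↦ ?_⟩
      have := congrArg (fun B : SL(2, ℝ) ↦ B 0 0) h
      norm_num at this
  intro R
  have := ProperlyDiscontinuousSMul.finite_disjoint_inter_image (Γ := Γ') (T := ℍ)
    (isCompact_singleton (x := I)) (isCompact_closedBall I R)
  refine (this.image Subtype.val).subset ?_
  rintro A ⟨hA, hR⟩
  refine ⟨⟨A, hA⟩, ?_, rfl⟩
  simp only [Set.mem_ofPred_eq, Set.image_singleton]
  exact ⟨A • I, rfl, by rw [Metric.mem_closedBall, dist_comm]; exact hR⟩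

namespace ProperlyDiscontinuous

variable {Γ : Subgroup PSL(2, ℝ)}

theorem finite (hΓ : ProperlyDiscontinuous Γ) (z w : ℍ) (R : ℝ) :
    {A : SL(2, ℝ) | (QuotientGroup.mk A : PSL(2, ℝ)) ∈ Γ ∧ dist z (A • w) ≤ R}.Finite := by
  refine (hΓ (dist I z + R + dist w I)).subset ?_
  rintro A ⟨hA, hR⟩
  refine ⟨hA, ?_⟩
  calc dist I (A • I) ≤ dist I z + dist z (A • w) + dist (A • w) (A • I) := dist_triangle4 _ _ _ _
    _ ≤ _ := by rw [dist_smul]; gcongr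

theorem finite_psl (hΓ : ProperlyDiscontinuous Γ) (z w : ℍ) (R : ℝ) :
    {γ : Γ | dist z ((γ : PSL(2, ℝ)) • w) ≤ R}.Finite := by
  have h := (hΓ.finite z w R).image (fun A : SL(2, ℝ) ↦ (QuotientGroup.mk A : PSL(2, ℝ)))
  refine Set.Finite.of_finite_image (f := Subtype.val) (h.subset ?_) Subtype.val_injective.injOn
  rintro _ ⟨⟨g, hg⟩, hR, rfl⟩
  obtain ⟨A, rfl⟩ := exists_lift g
  exact ⟨A, ⟨hg, hR⟩, rfl⟩

theorem countable (hΓ : ProperlyDiscontinuous Γ) : Countable Γ := by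
  have : (Set.univ : Set Γ) = ⋃ n : ℕ, {γ : Γ | dist I ((γ : PSL(2, ℝ)) • I) ≤ n} := by
    ext γ
    simp only [Set.mem_univ, Set.mem_iUnion, Set.mem_ofPred_eq, true_iff]
    exact exists_nat_ge _
  rw [← Set.countable_univ_iff, this]
  exact Set.countable_iUnion fun n ↦ (hΓ.finite_psl I I n).countable

theorem eventually_eq_one (hΓ : ProperlyDiscontinuous Γ) :
    ∀ᶠ A : SL(2, ℝ) in 𝓝 1, (QuotientGroup.mk A : PSL(2, ℝ)) ∈ Γ → A = 1 := by
  have h1 : ∀ᶠ A : SL(2, ℝ) in 𝓝 1, dist I (A • I) < 1 := by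
    have hc : Continuous fun A : SL(2, ℝ) ↦ dist I (A • I) := by fun_prop
    exact hc.continuousAt.eventually_lt continuousAt_const (by simp)
  have h2 := ((hΓ 1).subset (Set.sdiff_subset (t := {1}))).isClosed.isOpen_compl.mem_nhds
    (x := (1 : SL(2, ℝ))) (by simp)
  filter_upwards [h1, h2] with A hA1 hA2 hA
  by_contra hne
  exact hA2 ⟨⟨hA, hA1.le⟩, hne⟩

theorem eventually_eq_one_of_tendsto (hΓ : ProperlyDiscontinuous Γ) {u : ℕ → SL(2, ℝ)}
    (hu : ∀ n, (QuotientGroup.mk (u n) : PSL(2, ℝ)) ∈ Γ) (h : Tendsto u atTop (𝓝 1)) :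
    ∀ᶠ n in atTop, u n = 1 := by
  filter_upwards [h.eventually hΓ.eventually_eq_one] with n hn using hn (hu n)

/-- Otherwise the powers of `γ` would be infinitely many elements fixing `z`. -/
theorem isOfFinOrder_of_smul_eq (hΓ : ProperlyDiscontinuous Γ) {γ : PSL(2, ℝ)} (hγ : γ ∈ Γ)
    {z : ℍ} (hz : γ • z = z) : IsOfFinOrder γ := by
  by_contra h
  have hinj := injective_pow_iff_not_isOfFinOrder.mpr h
  have hpow : ∀ n : ℕ, γ ^ n • z = z := by
    intro n
    induction n with
    | zero => simp
    | succ n ih => rw [pow_succ, mul_smul, hz, ih]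
  have hfin := hΓ.finite_psl z z 0
  refine Set.infinite_univ (α := ℕ) (Set.Finite.of_finite_image (f := fun n : ℕ ↦
    (⟨γ ^ n, pow_mem hγ n⟩ : Γ)) (hfin.subset ?_) ?_)
  · rintro _ ⟨n, -, rfl⟩
    simp [hpow n]
  · intro m _ n _ hmn
    exact hinj (congrArg Subtype.val hmn)

/-- A smaller trace would mean an elliptic element, which has a fixed point in `ℍ` and hence finite
order. -/
theorem two_le_abs_trace (hΓ : ProperlyDiscontinuous Γ)
    (htf : ∀ γ ∈ Γ, IsOfFinOrder γ → γ = 1) {A : SL(2, ℝ)}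
    (hA : (QuotientGroup.mk A : PSL(2, ℝ)) ∈ Γ) :
    2 ≤ |(A : Matrix (Fin 2) (Fin 2) ℝ).trace| := by
  by_contra! h
  have hell : (SpecialLinearGroup.toGL A : GL (Fin 2) ℝ).IsElliptic := by
    have h2 : (A : Matrix (Fin 2) (Fin 2) ℝ).trace ^ 2 < 4 := by
      nlinarith [sq_abs (A : Matrix (Fin 2) (Fin 2) ℝ).trace,
        abs_nonneg (A : Matrix (Fin 2) (Fin 2) ℝ).trace]
    change Matrix.discr _ < 0
    simp [Matrix.discr_fin_two]
    linarith
  have hfix : A • fixedPt _ hell = fixedPt _ hell :=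
    (gl_smul_eq_self_iff_eq_fixedPt (by simp) hell).mpr rfl
  have h1 := htf _ hA (hΓ.isOfFinOrder_of_smul_eq hA hfix)
  rcases (mk_eq_mk_iff A 1).mp h1 with rfl | rfl
  · norm_num [Matrix.trace_fin_two] at h
  · norm_num [Matrix.trace_fin_two] at h

theorem smul_ne (hΓ : ProperlyDiscontinuous Γ)
    (htf : ∀ γ ∈ Γ, IsOfFinOrder γ → γ = 1) {γ : PSL(2, ℝ)} (hγ : γ ∈ Γ) (h1 : γ ≠ 1) (z : ℍ) :
    γ • z ≠ z :=
  fun h ↦ h1 (htf γ hγ (hΓ.isOfFinOrder_of_smul_eq hγ h))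

end ProperlyDiscontinuous

end TwistedEisenstein

/-! ## Shimizu's lemma and stabilizers of cusps -/

namespace TwistedEisenstein

open Filter Topology

theorem tendsto_sl_iff {ι : Type*} {l : Filter ι} {u : ι → SL(2, ℝ)} {A : SL(2, ℝ)} :
    Tendsto u l (𝓝 A) ↔ ∀ i j, Tendsto (fun n ↦ u n i j) l (𝓝 (A i j)) :=
  (Topology.IsInducing.subtypeVal.tendsto_nhds_iff).trans
    (tendsto_pi_nhds.trans (forall_congr' fun _ ↦ tendsto_pi_nhds))

theorem continuous_translationSL : Continuous translationSL := by
  rw [continuous_iff_continuousAt]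
  intro t
  refine tendsto_sl_iff.mpr fun i j ↦ ?_
  fin_cases i <;> fin_cases j
  · exact tendsto_const_nhds
  · exact tendsto_id
  · exact tendsto_const_nhds
  · exact tendsto_const_nhds

theorem ProperlyDiscontinuous.comap_conj {Γ : Subgroup PSL(2, ℝ)} (hΓ : ProperlyDiscontinuous Γ)
    (σ : PSL(2, ℝ)) : ProperlyDiscontinuous (Γ.comap (MulAut.conj σ).toMonoidHom) := by
  obtain ⟨S, rfl⟩ := exists_lift σ
  intro R
  refine Set.Finite.of_finite_image (f := MulAut.conj S) ((hΓ.finite (S • I) (S • I) R).subset ?_)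
    (MulAut.conj S).injective.injOn
  rintro _ ⟨A, ⟨hA, hR⟩, rfl⟩
  refine ⟨hA, ?_⟩
  rw [MulAut.conj_apply, ← mul_smul, inv_mul_cancel_right, mul_smul, dist_smul]
  exact hR

theorem mem_comap_conj {Γ : Subgroup PSL(2, ℝ)} {σ g : PSL(2, ℝ)} :
    g ∈ Γ.comap (MulAut.conj σ).toMonoidHom ↔ σ * g * σ⁻¹ ∈ Γ := Iff.rfl

theorem conj_translationSL_apply (A : SL(2, ℝ)) :
    (A * translationSL 1 * A⁻¹) 0 0 = 1 - A 0 0 * A 1 0 ∧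
    (A * translationSL 1 * A⁻¹) 0 1 = A 0 0 ^ 2 ∧
    (A * translationSL 1 * A⁻¹) 1 0 = - A 1 0 ^ 2 ∧
    (A * translationSL 1 * A⁻¹) 1 1 = 1 + A 0 0 * A 1 0 := by
  have hdet := sl_det A
  simp only [sl_mul_apply, sl_inv_apply_zero_zero, sl_inv_apply_zero_one, sl_inv_apply_one_zero,
    sl_inv_apply_one_one, translationSL_apply_zero_zero, translationSL_apply_zero_one,
    translationSL_apply_one_zero, translationSL_apply_one_one]
  refine ⟨?_, ?_, ?_, ?_⟩ <;> linarith

/-- **Shimizu's lemma**: if `Γ` contains `z ↦ z + 1`, then the lower left entry of an element of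
`Γ` either vanishes or is at least one in absolute value. -/
theorem ProperlyDiscontinuous.shimizu {Γ : Subgroup PSL(2, ℝ)} (hΓ : ProperlyDiscontinuous Γ)
    (hT : translation 1 ∈ Γ) {A : SL(2, ℝ)} (hA : (QuotientGroup.mk A : PSL(2, ℝ)) ∈ Γ)
    (h : |A 1 0| < 1) : A 1 0 = 0 := by
  -- Write `T` for the translation by one. Under `B ↦ B T B⁻¹` the lower left entry becomes `-c²`,
  -- so it tends to zero and the iterates tend to `T`. By discreteness some iterate equals `T`; its
  -- entry `c` vanishes, and then so do all earlier ones.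
  set u : ℕ → SL(2, ℝ) := fun n ↦ (fun B ↦ B * translationSL 1 * B⁻¹)^[n] A with hu
  have hsucc : ∀ n, u (n + 1) = u n * translationSL 1 * (u n)⁻¹ := fun n ↦ by
    simp only [hu, Function.iterate_succ_apply']
  have hmem : ∀ n, (QuotientGroup.mk (u n) : PSL(2, ℝ)) ∈ Γ := by
    intro n
    induction n with
    | zero => exact hA
    | succ n ih =>
      rw [hsucc]
      exact mul_mem (mul_mem ih hT) (inv_mem ih)
  have hc : ∀ n, u (n + 1) 1 0 = - u n 1 0 ^ 2 := fun n ↦ by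
    rw [hsucc]; exact (conj_translationSL_apply _).2.2.1
  have ha : ∀ n, u (n + 1) 0 0 = 1 - u n 0 0 * u n 1 0 := fun n ↦ by
    rw [hsucc]; exact (conj_translationSL_apply _).1
  have hb : ∀ n, u (n + 1) 0 1 = u n 0 0 ^ 2 := fun n ↦ by
    rw [hsucc]; exact (conj_translationSL_apply _).2.1
  have hd : ∀ n, u (n + 1) 1 1 = 1 + u n 0 0 * u n 1 0 := fun n ↦ by
    rw [hsucc]; exact (conj_translationSL_apply _).2.2.2
  set r := |A 1 0| with hr
  have hr0 : 0 ≤ r := abs_nonneg _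
  have hcr : ∀ n, |u n 1 0| ≤ r * r ^ n := by
    intro n
    induction n with
    | zero => simp [hu, hr]
    | succ n ih =>
      have h1 : r * r ^ n ≤ r := mul_le_of_le_one_right hr0 (pow_le_one₀ hr0 h.le)
      rw [hc, abs_neg, abs_pow, sq, pow_succ]
      calc |u n 1 0| * |u n 1 0| ≤ (r * r ^ n) * r :=
            mul_le_mul ih (ih.trans h1) (abs_nonneg _) (by positivity)
        _ = r * (r ^ n * r) := by ring
  have hcn : Tendsto (fun n ↦ u n 1 0) atTop (𝓝 0) := by
    refine squeeze_zero_norm hcr ?_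
    simpa using (tendsto_pow_atTop_nhds_zero_of_lt_one hr0 h).const_mul r
  -- Chosen so that `1 + K r ≤ K`, which makes `|a| ≤ K` invariant under `a ↦ 1 - a c` with `|c| ≤
  -- r`.
  set K := max |A 0 0| (1 / (1 - r)) with hK
  have hK1 : 1 + K * r ≤ K := by
    have h1 : 1 / (1 - r) ≤ K := le_max_right _ _
    rw [div_le_iff₀ (by linarith)] at h1
    linarith
  have hK0 : 0 ≤ K := le_max_of_le_left (abs_nonneg _)
  have haK : ∀ n, |u n 0 0| ≤ K := by
    intro n
    induction n with
    | zero => exact le_max_left _ _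
    | succ n ih =>
      have h1 : |u n 1 0| ≤ r :=
        (hcr n).trans (mul_le_of_le_one_right hr0 (pow_le_one₀ hr0 h.le))
      rw [ha]
      calc |1 - u n 0 0 * u n 1 0| ≤ |1| + |u n 0 0 * u n 1 0| := abs_sub _ _
        _ ≤ 1 + K * r := by
          rw [abs_one, abs_mul]
          gcongr
        _ ≤ K := hK1
  have hac : Tendsto (fun n ↦ u n 0 0 * u n 1 0) atTop (𝓝 0) := by
    refine squeeze_zero_norm (a := fun n ↦ K * |u n 1 0|) (fun n ↦ ?_) ?_
    · rw [Real.norm_eq_abs, abs_mul]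
      gcongr
      exact haK n
    · simpa using hcn.abs.const_mul K
  have han : Tendsto (fun n ↦ u n 0 0) atTop (𝓝 1) := by
    rw [← tendsto_add_atTop_iff_nat 1]
    simp_rw [ha]
    simpa using hac.const_sub 1
  have hlim : Tendsto u atTop (𝓝 (translationSL 1)) := by
    rw [tendsto_sl_iff]
    intro i j
    fin_cases i <;> fin_cases j
    · exact han
    · rw [← tendsto_add_atTop_iff_nat 1]
      change Tendsto (fun n ↦ u (n + 1) 0 1) atTop (𝓝 1)
      simp_rw [hb]
      simpa using han.pow 2
    · exact hcn
    · rw [← tendsto_add_atTop_iff_nat 1]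
      change Tendsto (fun n ↦ u (n + 1) 1 1) atTop (𝓝 1)
      simp_rw [hd]
      simpa using hac.const_add 1
  have hlim' : Tendsto (fun n ↦ (translationSL 1)⁻¹ * u n) atTop (𝓝 1) := by
    have := hlim.const_mul (translationSL 1)⁻¹
    rwa [inv_mul_cancel] at this
  obtain ⟨n, hn⟩ := (hΓ.eventually_eq_one_of_tendsto
    (fun n ↦ mul_mem (inv_mem hT) (hmem n)) hlim').exists
  have hn0 : u n 1 0 = 0 := by
    rw [inv_mul_eq_one] at hn
    rw [← hn]
    rfl
  clear hn
  induction n with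
  | zero => exact hn0
  | succ n ih =>
    rw [hc] at hn0
    exact ih (by simpa using hn0)

/-! ### Stabilizers of cusps -/

theorem exists_smul_infty_eq (𝔞 : OnePoint ℝ) : ∃ h : PSL(2, ℝ), h • (∞ : OnePoint ℝ) = 𝔞 := by
  obtain ⟨g, hg⟩ := OnePoint.exists_mem_SL2 ℝ 𝔞
  exact ⟨QuotientGroup.mk g, hg⟩

theorem mk_smul_infty_iff (A : SL(2, ℝ)) :
    (QuotientGroup.mk A : PSL(2, ℝ)) • (∞ : OnePoint ℝ) = ∞ ↔ A 1 0 = 0 := by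
  rw [mk_smul_boundary, OnePoint.smul_infty_eq_self_iff]
  rfl

theorem translation_smul_infty (t : ℝ) : translation t • (∞ : OnePoint ℝ) = ∞ :=
  (mk_smul_infty_iff _).mpr (by simp)

theorem mk_eq_translation {A : SL(2, ℝ)} (h : A 1 0 = 0) (h2 : A 0 0 ^ 2 = 1) :
    (QuotientGroup.mk A : PSL(2, ℝ)) = translation (A 0 0 * A 0 1) := by
  have hdet := sl_det A
  rw [translation, mk_eq_mk_iff]
  rw [h] at hdet
  have h11 : A 1 1 = A 0 0 := by
    linear_combination A 0 0 * hdet - A 1 1 * h2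
  rcases eq_or_eq_neg_of_sq_eq_sq (A 0 0) 1 (by simpa using h2) with h0 | h0
  · left
    apply Subtype.ext
    rw [coe_translationSL]
    ext i j
    fin_cases i <;> fin_cases j <;> simp [h, h11, h0]
  · right
    apply Subtype.ext
    rw [SpecialLinearGroup.coe_neg, coe_translationSL]
    ext i j
    fin_cases i <;> fin_cases j <;> simp [h, h11, h0]

/-- An element fixing `∞` is an affine map, and `a` is its multiplier. -/
theorem exists_mul_translation_of_smul_infty {g : PSL(2, ℝ)} (hg : g • (∞ : OnePoint ℝ) = ∞) :
    ∃ a : ℝ, 0 < a ∧ (∀ s, g * translation s = translation (a * s) * g) ∧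
      (a = 1 → ∃ t, g = translation t) := by
  obtain ⟨A, rfl⟩ := exists_lift g
  rw [mk_smul_infty_iff] at hg
  have hdet := sl_det A
  rw [hg] at hdet
  have h0 : A 0 0 ≠ 0 := by
    intro h
    simp [h] at hdet
  refine ⟨A 0 0 ^ 2, by positivity, fun s ↦ ?_, fun h ↦ ⟨_, mk_eq_translation hg h⟩⟩
  have : A * translationSL s = translationSL (A 0 0 ^ 2 * s) * A := by
    apply sl_ext <;> simp [sl_mul_apply, hg]
    linear_combination (-A 0 0 * s) * hdet
  exact congrArg (QuotientGroup.mk (s := Subgroup.center SL(2, ℝ))) this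

theorem exists_dilation {a : ℝ} (ha : 0 < a) : ∃ D : PSL(2, ℝ), D • (∞ : OnePoint ℝ) = ∞ ∧
    ∀ s, D * translation s = translation (a * s) * D := by
  have hs : √a ≠ 0 := (Real.sqrt_pos.mpr ha).ne'
  set A : SL(2, ℝ) := ⟨!![√a, 0; 0, (√a)⁻¹], by simp [Matrix.det_fin_two, hs]⟩ with hA
  have hcoe : (A : Matrix (Fin 2) (Fin 2) ℝ) = !![√a, 0; 0, (√a)⁻¹] := rfl
  refine ⟨QuotientGroup.mk A, (mk_smul_infty_iff A).mpr (by simp [hcoe]), fun s ↦ ?_⟩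
  have : A * translationSL s = translationSL (a * s) * A := by
    apply sl_ext <;> simp [sl_mul_apply, hcoe]
    field_simp
    rw [Real.sq_sqrt ha.le, mul_comm]
  exact congrArg (QuotientGroup.mk (s := Subgroup.center SL(2, ℝ))) this

end TwistedEisenstein

/-! ## Scaling elements -/

namespace TwistedEisenstein

open Filter Topology

variable {Γ : Subgroup PSL(2, ℝ)} {𝔞 𝔟 : OnePoint ℝ} {σ τ : PSL(2, ℝ)}

theorem mk_mem_preimageGL {A : SL(2, ℝ)} (hA : (QuotientGroup.mk A : PSL(2, ℝ)) ∈ Γ) :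
    Matrix.SpecialLinearGroup.toGL A ∈ preimageGL Γ :=
  ⟨A, hA, rfl⟩

theorem IsCuspOf.smul (h : IsCuspOf 𝔞 Γ) {γ : PSL(2, ℝ)} (hγ : γ ∈ Γ) :
    IsCuspOf (γ • 𝔞) Γ := by
  obtain ⟨A, rfl⟩ := exists_lift γ
  exact IsCusp.smul_of_mem h (mk_mem_preimageGL hγ)

/-- A cusp is fixed by a nontrivial element of `Γ` conjugate to a translation. -/
theorem IsCuspOf.exists_translation (h : IsCuspOf 𝔞 Γ) {g : PSL(2, ℝ)}
    (hg : g • (∞ : OnePoint ℝ) = 𝔞) : ∃ t : ℝ, t ≠ 0 ∧ g * translation t * g⁻¹ ∈ Γ := by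
  obtain ⟨_, ⟨A, hA, rfl⟩, hpar, hfix⟩ := h
  obtain ⟨G, rfl⟩ := exists_lift g
  have hA' : (QuotientGroup.mk A : PSL(2, ℝ)) ∈ Γ := hA
  set B := G⁻¹ * A * G with hB
  have hBinf : (QuotientGroup.mk B : PSL(2, ℝ)) • (∞ : OnePoint ℝ) = ∞ := by
    have h1 : (QuotientGroup.mk A : PSL(2, ℝ)) • 𝔞 = 𝔞 := hfix
    have h2 : (QuotientGroup.mk B : PSL(2, ℝ)) = (QuotientGroup.mk G : PSL(2, ℝ))⁻¹ *
      QuotientGroup.mk A * QuotientGroup.mk G := rfl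
    rw [h2, mul_smul, mul_smul, hg, h1, ← hg, inv_smul_smul]
  have hBpar : (Matrix.SpecialLinearGroup.toGL B : GL (Fin 2) ℝ).IsParabolic := by
    rw [hB, map_mul, map_mul, map_inv]
    exact (Matrix.GeneralLinearGroup.isParabolic_conj_iff' _ _).mpr hpar
  have h10 := (mk_smul_infty_iff B).mp hBinf
  have hdet := sl_det B
  rw [h10] at hdet
  have htr : (B 0 0 + B 1 1) ^ 2 = 4 := by
    have h3 : Matrix.discr (B : Matrix (Fin 2) (Fin 2) ℝ) = 0 := hBpar.2
    rw [Matrix.discr_fin_two, Matrix.trace_fin_two, Matrix.SpecialLinearGroup.det_coe] at h3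
    linarith
  have h00 : B 0 0 ^ 2 = 1 := by
    have h4 : (B 0 0 - B 1 1) ^ 2 = 0 := by linear_combination htr - 4 * hdet
    have h5 : B 0 0 = B 1 1 := by
      have := pow_eq_zero_iff (two_ne_zero) |>.mp h4
      linarith
    rw [sq]
    nth_rewrite 2 [h5]
    linarith
  have htrans := mk_eq_translation h10 h00
  refine ⟨B 0 0 * B 0 1, fun h0 ↦ ?_, ?_⟩
  · rw [h0, translation_zero] at htrans
    refine hBpar.1 ?_
    rcases (mk_eq_mk_iff B 1).mp htrans with h6 | h6
    · refine ⟨1, ?_⟩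
      rw [h6]
      simp
    · refine ⟨-1, ?_⟩
      rw [h6]
      ext i j
      fin_cases i <;> fin_cases j <;> simp
  · rw [← htrans]
    have : (QuotientGroup.mk G : PSL(2, ℝ)) * QuotientGroup.mk B * (QuotientGroup.mk G)⁻¹ =
        QuotientGroup.mk A := by
      rw [hB]
      change (QuotientGroup.mk (G * (G⁻¹ * A * G) * G⁻¹) : PSL(2, ℝ)) = _
      congr 1
      group
    rwa [this]

/-- In a properly discontinuous group containing a translation, all elements fixing `∞` are
translations. -/
theorem ProperlyDiscontinuous.eq_translation (hΓ : ProperlyDiscontinuous Γ) {t : ℝ} (ht : t ≠ 0)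
    (htΓ : translation t ∈ Γ) {g : PSL(2, ℝ)} (hg : g ∈ Γ) (hinf : g • (∞ : OnePoint ℝ) = ∞) :
    ∃ s, g = translation s := by
  -- If `a < 1`, conjugating by powers of `g` yields translations by `a ^ n * t` tending to the
  -- identity. Applied to `g` and to `g⁻¹`, this leaves `a = 1`.
  have key : ∀ g ∈ Γ, ∀ a : ℝ, 0 < a → (∀ s, g * translation s = translation (a * s) * g) →
      1 ≤ a := by
    intro g hg a ha hga
    by_contra! ha1
    have hmem : ∀ n : ℕ, translation (a ^ n * t) ∈ Γ := by
      intro n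
      induction n with
      | zero => simpa using htΓ
      | succ n ih =>
        have : translation (a ^ (n + 1) * t) = g * translation (a ^ n * t) * g⁻¹ := by
          rw [hga, mul_inv_cancel_right]
          ring_nf
        rw [this]
        exact mul_mem (mul_mem hg ih) (inv_mem hg)
    have hlim : Tendsto (fun n : ℕ ↦ translationSL (a ^ n * t)) atTop (𝓝 1) := by
      rw [← translationSL_zero]
      refine (continuous_translationSL.tendsto 0).comp ?_
      simpa using (tendsto_pow_atTop_nhds_zero_of_lt_one ha.le ha1).mul_const t
    obtain ⟨n, hn⟩ := (hΓ.eventually_eq_one_of_tendsto hmem hlim).exists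
    have h01 : translationSL (a ^ n * t) 0 1 = (1 : SL(2, ℝ)) 0 1 := by rw [hn]
    have h02 : a ^ n * t = 0 := by simpa using h01
    exact mul_ne_zero (pow_ne_zero n ha.ne') ht h02
  obtain ⟨a, ha, hga, h1⟩ := exists_mul_translation_of_smul_infty hinf
  refine h1 (le_antisymm ?_ (key g hg a ha hga))
  have := key g⁻¹ (inv_mem hg) a⁻¹ (inv_pos.mpr ha) (fun s ↦ by
    rw [inv_mul_eq_iff_eq_mul, ← mul_assoc, hga, mul_inv_cancel_left₀ ha.ne',
      mul_inv_cancel_right])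
  exact (one_le_inv₀ ha).mp this

/-- Every cusp of a discrete group has a scaling element. -/
theorem ProperlyDiscontinuous.exists_isScaling (hΓ : ProperlyDiscontinuous Γ)
    (h : IsCuspOf 𝔞 Γ) : ∃ σ, IsScaling Γ 𝔞 σ := by
  obtain ⟨g, hg⟩ := exists_smul_infty_eq 𝔞
  obtain ⟨t, ht, htΓ⟩ := h.exists_translation hg
  set Λ := Γ.comap (MulAut.conj g).toMonoidHom with hΛ
  have hΛd : ProperlyDiscontinuous Λ := hΓ.comap_conj g
  -- The translation lengths at the cusp form a discrete subgroup of `ℝ`, generated by some `|ω| >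
  -- 0`; composing with a dilation by `|ω|` normalizes the width to one.
  set H : AddSubgroup ℝ :=
    { carrier := {s | translation s ∈ Λ}
      zero_mem' := by
        change translation 0 ∈ Λ
        rw [translation_zero]
        exact one_mem _
      add_mem' := by
        intro a b ha hb
        change translation (a + b) ∈ Λ
        rw [translation_add]
        exact mul_mem ha hb
      neg_mem' := by
        intro a ha
        change translation (-a) ∈ Λ
        rw [translation_neg]
        exact inv_mem ha } with hH
  have hmemH : ∀ s, s ∈ H ↔ translation s ∈ Λ := fun s ↦ Iff.rfl
  have hev : ∀ᶠ s : ℝ in 𝓝 0, s ∈ H → s = 0 := by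
    have h1 : Tendsto translationSL (𝓝 0) (𝓝 1) := by
      have := continuous_translationSL.tendsto 0
      rwa [translationSL_zero] at this
    filter_upwards [h1.eventually hΛd.eventually_eq_one] with s hs hsH
    have h2 : translationSL s 0 1 = (1 : SL(2, ℝ)) 0 1 := by rw [hs hsH]
    simpa using h2
  obtain ⟨ε, hε, hεH⟩ := Metric.eventually_nhds_iff.mp hev
  obtain ⟨ω, hω⟩ := AddSubgroup.cyclic_of_isolated_zero (H := H) hε (by
    rw [Set.disjoint_left]
    intro s hs hs'
    have := hεH (by rw [Real.dist_0_eq_abs, abs_of_pos hs'.1]; exact hs'.2) hs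
    exact hs'.1.ne' this)
  have hω' : ∀ s, s ∈ H ↔ ∃ k : ℤ, s = k * |ω| := by
    intro s
    rw [hω, AddSubgroup.mem_closure_singleton]
    rcases abs_choice ω with h | h <;> rw [h]
    · simp [eq_comm]
    · constructor
      · rintro ⟨k, rfl⟩
        exact ⟨-k, by simp⟩
      · rintro ⟨k, rfl⟩
        exact ⟨-k, by simp⟩
  have hωpos : 0 < |ω| := by
    rw [abs_pos]
    rintro rfl
    obtain ⟨k, hk⟩ := (hω' t).mp htΓ
    simp at hk
    exact ht hk
  obtain ⟨D, hD, hDt⟩ := exists_dilation hωpos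
  refine ⟨g * D, by rw [mul_smul, hD, hg], fun γ ↦ ?_⟩
  have hiff : (γ ∈ Γ ∧ γ • 𝔞 = 𝔞) ↔ ∃ s ∈ H, g⁻¹ * γ * g = translation s := by
    have hγ : g * (g⁻¹ * γ * g) * g⁻¹ = γ := by group
    constructor
    · rintro ⟨h1, h2⟩
      have h3 : g⁻¹ * γ * g ∈ Λ := by
        rw [hΛ, mem_comap_conj, hγ]
        exact h1
      obtain ⟨s, hs⟩ := hΛd.eq_translation ht htΓ h3
        (by rw [mul_smul, mul_smul, hg, h2, ← hg, inv_smul_smul])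
      exact ⟨s, by rw [hmemH, ← hs]; exact h3, hs⟩
    · rintro ⟨s, hs, h⟩
      rw [h] at hγ
      refine ⟨hγ ▸ hs, ?_⟩
      rw [← hγ, mul_smul, mul_smul, ← hg, inv_smul_smul, translation_smul_infty]
  rw [hiff]
  constructor
  · rintro ⟨s, hs, h⟩
    obtain ⟨k, rfl⟩ := (hω' s).mp hs
    refine ⟨k, ?_⟩
    rw [_root_.mul_inv_rev, mul_assoc, mul_assoc, ← mul_assoc γ, ← mul_assoc g⁻¹, ← mul_assoc g⁻¹,
      h, inv_mul_eq_iff_eq_mul, hDt, mul_comm]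
  · rintro ⟨k, hk⟩
    refine ⟨k * |ω|, (hω' _).mpr ⟨k, rfl⟩, ?_⟩
    have : g⁻¹ * γ * g = D * ((g * D)⁻¹ * γ * (g * D)) * D⁻¹ := by group
    rw [this, hk, hDt, mul_inv_cancel_right, mul_comm]

namespace IsScaling

theorem conj_translation_mem (hσ : IsScaling Γ 𝔞 σ) (k : ℤ) :
    σ * translation k * σ⁻¹ ∈ Γ ∧ (σ * translation k * σ⁻¹) • 𝔞 = 𝔞 :=
  (hσ.2 _).mpr ⟨k, by group⟩

theorem smul (hσ : IsScaling Γ 𝔞 σ) {γ : PSL(2, ℝ)} (hγ : γ ∈ Γ) :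
    IsScaling Γ (γ • 𝔞) (γ * σ) := by
  refine ⟨by rw [mul_smul, hσ.1], fun g ↦ ?_⟩
  have h1 : (γ * σ)⁻¹ * g * (γ * σ) = σ⁻¹ * (γ⁻¹ * g * γ) * σ := by group
  rw [h1, ← hσ.2, mul_smul, mul_smul, inv_smul_eq_iff, Subgroup.mul_mem_cancel_right _ hγ,
    Subgroup.mul_mem_cancel_left _ (inv_mem hγ)]

/-- A scaling element is unique up to translations. -/
theorem eq_mul_translation (hσ : IsScaling Γ 𝔞 σ) (hτ : IsScaling Γ 𝔞 τ) :
    ∃ t, τ = σ * translation t := by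
  have hinf : (σ⁻¹ * τ) • (∞ : OnePoint ℝ) = ∞ := by
    rw [mul_smul, hτ.1, ← hσ.1, inv_smul_smul]
  obtain ⟨a, ha, hs, h1⟩ := exists_mul_translation_of_smul_infty hinf
  obtain ⟨k, hk⟩ := (hσ.2 _).mp (hτ.conj_translation_mem 1)
  obtain ⟨l, hl⟩ := (hτ.2 _).mp (hσ.conj_translation_mem 1)
  -- The multiplier of `σ⁻¹ τ` is an integer whose inverse is an integer, since conjugation maps the
  -- unit translation of either normalization to an integral translation of the other.
  have hak : a = k := by
    apply translation_injective
    have : σ⁻¹ * (τ * translation (1 : ℤ) * τ⁻¹) * σ =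
      (σ⁻¹ * τ) * translation (1 : ℤ) * (σ⁻¹ * τ)⁻¹ := by group
    rw [← hk, this, hs, mul_inv_cancel_right]
    simp
  have hal : 1 = a * l := by
    apply translation_injective
    have h3 := hs l
    rw [← hl] at h3
    have : σ⁻¹ * τ * (τ⁻¹ * (σ * translation (1 : ℤ) * σ⁻¹) * τ) =
      translation (1 : ℤ) * (σ⁻¹ * τ) := by group
    rw [this] at h3
    have h4 := mul_right_cancel h3
    simpa [hl] using h4
  have ha1 : a = 1 := by
    rw [hak] at hal ha
    have hal' : (1 : ℤ) = k * l := by exact_mod_cast hal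
    have ha' : 0 < k := by exact_mod_cast ha
    rw [hak, Int.eq_one_of_mul_eq_one_right ha'.le hal'.symm]
    simp
  obtain ⟨t, ht⟩ := h1 ha1
  exact ⟨t, by rw [← ht, mul_inv_cancel_left]⟩

theorem im_inv_smul_eq (hσ : IsScaling Γ 𝔞 σ) (hτ : IsScaling Γ 𝔞 τ) (z : ℍ) :
    (τ⁻¹ • z).im = (σ⁻¹ • z).im := by
  obtain ⟨t, rfl⟩ := hσ.eq_mul_translation hτ
  rw [_root_.mul_inv_rev, mul_smul, ← translation_neg, im_translation_smul]

theorem translation_one_mem (hσ : IsScaling Γ 𝔞 σ) :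
    translation 1 ∈ Γ.comap (MulAut.conj σ).toMonoidHom := by
  have := (hσ.conj_translation_mem 1).1
  rw [Int.cast_one] at this
  exact this

/-- The height of a point with respect to distinct cusps. -/
theorem im_mul_im_le_one (hΓ : ProperlyDiscontinuous Γ) (hσ : IsScaling Γ 𝔞 σ)
    (hτ : IsScaling Γ 𝔟 τ) (hne : 𝔞 ≠ 𝔟) (z : ℍ) :
    (σ⁻¹ • z).im * (τ⁻¹ • z).im ≤ 1 := by
  obtain ⟨B, hB⟩ := exists_lift (σ⁻¹ * τ)
  have hB0 : B 1 0 ≠ 0 := by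
    intro h
    rw [← mk_smul_infty_iff, hB, mul_smul, hτ.1, inv_smul_eq_iff, hσ.1] at h
    exact hne h.symm
  -- This parabolic element of the second cusp has lower left entry `-c²` in the coordinates of the
  -- first, where `c = B 1 0`. Shimizu's lemma gives `c² ≥ 1`, and `Im(B w) * Im w ≤ 1 / c²`.
  have hmem : (QuotientGroup.mk (B * translationSL 1 * B⁻¹) : PSL(2, ℝ)) ∈
      Γ.comap (MulAut.conj σ).toMonoidHom := by
    have h1 : (QuotientGroup.mk (B * translationSL 1 * B⁻¹) : PSL(2, ℝ)) =
      (σ⁻¹ * τ) * translation 1 * (σ⁻¹ * τ)⁻¹ := by rw [← hB]; rfl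
    rw [h1, mem_comap_conj]
    have h2 := hτ.translation_one_mem
    rw [mem_comap_conj] at h2
    convert h2 using 1
    group
  have hB1 : 1 ≤ B 1 0 ^ 2 := by
    by_contra! hlt
    have h3 := (hΓ.comap_conj σ).shimizu hσ.translation_one_mem hmem (by
      rw [(conj_translationSL_apply B).2.2.1, abs_neg, abs_of_nonneg (sq_nonneg _)]
      exact hlt)
    rw [(conj_translationSL_apply B).2.2.1] at h3
    exact hB0 (by simpa using h3)
  have hz : σ⁻¹ • z = B • (τ⁻¹ • z) := by
    rw [← mk_smul_upperHalfPlane, hB, ← mul_smul]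
    congr 1
    group
  set w := τ⁻¹ • z
  have hw := w.im_pos
  rw [hz, im_sl_smul, div_mul_eq_mul_div, div_le_one (by positivity)]
  nlinarith [sq_nonneg (B 1 0 * w.re + B 1 1), mul_le_mul_of_nonneg_right hB1 (sq_nonneg w.im)]

end IsScaling

end TwistedEisenstein

/-! ## Packing in the quotient -/

namespace TwistedEisenstein

open Filter Topology Pointwise

variable {Γ : Subgroup PSL(2, ℝ)}

instance instSMulInvariantMeasure : SMulInvariantMeasure PSL(2, ℝ) ℍ volume where
  measure_preimage_smul g s hs := by
    obtain ⟨A, rfl⟩ := exists_lift g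
    exact measure_preimage_smul_of_nullMeasurableSet
      (c := (Matrix.SpecialLinearGroup.toGL A : GL (Fin 2) ℝ)) hs.nullMeasurableSet

instance instSMulInvariantMeasureSubgroup : SMulInvariantMeasure Γ ℍ volume where
  measure_preimage_smul g _ hs := measure_preimage_smul_of_nullMeasurableSet
      (c := (g : PSL(2, ℝ))) hs.nullMeasurableSet

instance instIsIsometricSMulSubgroup : IsIsometricSMul Γ ℍ :=
  ⟨fun g ↦ isometry_smul ℍ (g : PSL(2, ℝ))⟩

theorem exists_smul_I_eq (z : ℍ) : ∃ g : PSL(2, ℝ), g • I = z :=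
  ⟨QuotientGroup.mk z.toSL2R, toSL2R_smul_I z⟩

theorem volume_ball_eq (z : ℍ) (r : ℝ) :
    volume (Metric.ball z r) = volume (Metric.ball I r) := by
  obtain ⟨g, rfl⟩ := exists_smul_I_eq z
  rw [← Metric.smul_ball, measure_smul]

theorem volume_ball_pos (z : ℍ) {r : ℝ} (hr : 0 < r) : 0 < volume (Metric.ball z r) := by
  rw [UpperHalfPlane.volume_eq_lintegral]
  have hopen : IsOpen (UpperHalfPlane.coe '' Metric.ball z r) :=
    isOpenEmbedding_coe.isOpenMap _ Metric.isOpen_ball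
  rw [setLIntegral_pos_iff (by fun_prop)]
  have hsub : UpperHalfPlane.coe '' Metric.ball z r ⊆
      (Function.support fun z : ℂ ↦ (↑((1 / ‖z.im‖₊) ^ 2 : NNReal) : ENNReal)) ∩
        UpperHalfPlane.coe '' Metric.ball z r := by
    rintro _ ⟨w, hw, rfl⟩
    refine ⟨?_, w, hw, rfl⟩
    simp [w.im_ne_zero]
  exact (hopen.measure_pos _ ⟨_, z, Metric.mem_ball_self hr, rfl⟩).trans_le (measure_mono hsub)

/-- Disjoint balls in the quotient `Γ \ ℍ` have total area at most that of a fundamental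
domain. -/
theorem card_mul_volume_ball_le [Countable Γ] {F : Set ℍ}
    (hF : IsFundamentalDomain Γ F (volume : Measure ℍ)) {r : ℝ} (T : Finset ℍ)
    (hT : ∀ z ∈ T, ∀ w ∈ T, ∀ γ : Γ, dist z (γ • w) < 2 * r → z = w ∧ γ = 1) :
    T.card * volume (Metric.ball I r) ≤ volume F := by
  set S : Set ℍ := ⋃ z ∈ T, Metric.ball z r with hS
  have hopen : IsOpen S := isOpen_biUnion fun _ _ ↦ Metric.isOpen_ball
  have hdist : ∀ z ∈ T, ∀ w ∈ T, ∀ γ : Γ, ∀ x : ℍ, dist x z < r → dist x (γ • w) < r →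
      z = w ∧ γ = 1 := by
    intro z hz w hw γ x h1 h2
    refine hT z hz w hw γ ?_
    calc dist z (γ • w) ≤ dist z x + dist x (γ • w) := dist_triangle _ _ _
      _ < 2 * r := by rw [dist_comm z x]; linarith
  have hvol : volume S = T.card * volume (Metric.ball I r) := by
    rw [hS, measure_biUnion_finset]
    · simp [volume_ball_eq]
    · intro z hz w hw hne
      refine Set.disjoint_left.mpr fun x hx hx' ↦ hne ?_
      exact (hdist z hz w hw 1 x hx (by rw [one_smul]; exact hx')).1
    · exact fun _ _ ↦ measurableSet_ball
  have hdisj : Pairwise (Function.onFun Disjoint fun γ : Γ ↦ γ • S) := by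
    intro γ δ hne
    refine Set.disjoint_left.mpr fun x hx hx' ↦ hne ?_
    rw [Set.mem_smul_set_iff_inv_smul_mem, hS, Set.mem_iUnion₂] at hx hx'
    obtain ⟨z, hz, hxz⟩ := hx
    obtain ⟨w, hw, hxw⟩ := hx'
    rw [Metric.mem_ball] at hxz hxw
    have h1 : dist (γ⁻¹ • x) ((γ⁻¹ * δ) • w) < r := by
      rw [mul_smul, dist_smul, ← dist_smul δ⁻¹, inv_smul_smul]
      exact hxw
    have h2 := (hdist z hz w hw (γ⁻¹ * δ) _ hxz h1).2
    exact inv_mul_eq_one.mp h2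
  rw [← hvol, hF.measure_eq_tsum]
  have hmeas : ∀ γ : Γ, MeasurableSet (γ • S) := fun γ ↦ (hopen.smul γ).measurableSet
  calc ∑' γ : Γ, volume (γ • S ∩ F) = ∑' γ : Γ, volume.restrict F (γ • S) := by
        congr 1
        ext γ
        rw [Measure.restrict_apply (hmeas γ)]
    _ = volume.restrict F (⋃ γ : Γ, γ • S) := (measure_iUnion hdisj hmeas).symm
    _ ≤ volume.restrict F Set.univ := measure_mono (Set.subset_univ _)
    _ = volume F := Measure.restrict_apply_univ _

/-- The points of injectivity radius at least `r` form a compact set modulo a lattice. -/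
theorem exists_dist_le_of_injectivityRadius [Countable Γ] {F : Set ℍ}
    (hF : IsFundamentalDomain Γ F (volume : Measure ℍ)) (hFfin : volume F < ⊤) {r : ℝ}
    (hr : 0 < r) : ∃ R : ℝ, ∀ z : ℍ, (∀ γ : Γ, γ ≠ 1 → 2 * r ≤ dist z (γ • z)) →
      ∃ γ : Γ, dist I (γ • z) ≤ R := by
  -- The `r`-balls around `T` embed disjointly into the quotient, so the area bounds the
  -- cardinality. A thick point whose orbit stays at distance over `2 * r` from a maximal `T` could
  -- be added to it.
  set P : Finset ℍ → Prop := fun T ↦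
    ∀ z ∈ T, ∀ w ∈ T, ∀ γ : Γ, dist z (γ • w) < 2 * r → z = w ∧ γ = 1 with hP
  have hv := volume_ball_pos I hr
  have hbdd : BddAbove (Finset.card '' {T | P T}) := by
    obtain ⟨n, hn⟩ := ENNReal.exists_nat_gt (ENNReal.div_lt_top hFfin.ne hv.ne').ne
    refine ⟨n, ?_⟩
    rintro _ ⟨T, hT, rfl⟩
    have h1 := card_mul_volume_ball_le hF T hT
    have h2 : (T.card : ENNReal) < n := by
      refine lt_of_le_of_lt ?_ hn
      rw [ENNReal.le_div_iff_mul_le (Or.inl hv.ne')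
        (Or.inl Metric.isBounded_ball.measure_lt_top.ne)]
      exact h1
    exact_mod_cast h2.le
  obtain ⟨T, hT, hTmax⟩ := Nat.sSup_mem (s := Finset.card '' {T | P T})
    ⟨0, ∅, by simp [hP], rfl⟩ hbdd
  have hmax : ∀ T', P T' → T'.card ≤ T.card := fun T' hT' ↦ by
    rw [hTmax]
    exact le_csSup hbdd ⟨T', hT', rfl⟩
  refine ⟨(∑ z ∈ T, dist I z) + 2 * r, fun z hz ↦ ?_⟩
  by_contra! hfar
  have hfar' : ∀ w ∈ T, ∀ γ : Γ, 2 * r < dist w (γ • z) := by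
    intro w hw γ
    have h1 := hfar γ
    have h2 : dist I w ≤ ∑ z ∈ T, dist I z :=
      Finset.single_le_sum (f := fun z ↦ dist I z) (fun _ _ ↦ dist_nonneg) hw
    have h3 := dist_triangle I w (γ • z)
    linarith
  have hzT : z ∉ T := fun h ↦ by
    have := hfar' z h 1
    rw [one_smul, dist_self] at this
    linarith
  classical
  have := hmax (insert z T) (by
    intro a ha b hb γ hab
    rw [Finset.mem_insert] at ha hb
    rcases ha with rfl | ha <;> rcases hb with rfl | hb
    · refine ⟨rfl, ?_⟩
      by_contra hne
      exact absurd hab (not_lt.mpr (hz γ hne))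
    · rw [← dist_smul γ⁻¹, inv_smul_smul, dist_comm] at hab
      exact absurd hab (not_lt.mpr (hfar' b hb _).le)
    · exact absurd hab (not_lt.mpr (hfar' a ha _).le)
    · exact hT a ha b hb γ hab)
  rw [Finset.card_insert_of_notMem hzT] at this
  omega

end TwistedEisenstein

/-! ## Elements close to the identity -/

namespace TwistedEisenstein

open Filter Topology

variable {Γ : Subgroup PSL(2, ℝ)}

/-! ### Commutators of elements close to the identity -/

/-- The sum of the absolute values of the entries of a matrix. -/
def entrySum (X : Matrix (Fin 2) (Fin 2) ℝ) : ℝ := |X 0 0| + |X 0 1| + |X 1 0| + |X 1 1|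

theorem entrySum_nonneg (X : Matrix (Fin 2) (Fin 2) ℝ) : 0 ≤ entrySum X := by
  unfold entrySum; positivity

theorem entrySum_add_le (X Y : Matrix (Fin 2) (Fin 2) ℝ) :
    entrySum (X + Y) ≤ entrySum X + entrySum Y := by
  simp only [entrySum, Matrix.add_apply]
  linarith [abs_add_le (X 0 0) (Y 0 0), abs_add_le (X 0 1) (Y 0 1), abs_add_le (X 1 0) (Y 1 0),
    abs_add_le (X 1 1) (Y 1 1)]

theorem entrySum_neg (X : Matrix (Fin 2) (Fin 2) ℝ) : entrySum (-X) = entrySum X := by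
  simp [entrySum]

theorem entrySum_mul_le (X Y : Matrix (Fin 2) (Fin 2) ℝ) :
    entrySum (X * Y) ≤ entrySum X * entrySum Y := by
  have h : ∀ i j, |(X * Y) i j| ≤ |X i 0| * |Y 0 j| + |X i 1| * |Y 1 j| := fun i j ↦ by
    rw [Matrix.mul_apply, Fin.sum_univ_two, ← abs_mul, ← abs_mul]
    exact abs_add_le _ _
  have h00 := h 0 0
  have h01 := h 0 1
  have h10 := h 1 0
  have h11 := h 1 1
  have hx : ∀ i j k l, 0 ≤ |X i j| * |Y k l| := fun i j k l ↦ by positivity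
  unfold entrySum
  linarith [hx 0 0 1 0, hx 0 0 1 1, hx 0 1 0 0, hx 0 1 0 1, hx 1 0 1 0, hx 1 0 1 1, hx 1 1 0 0,
    hx 1 1 0 1]

theorem entrySum_one : entrySum 1 = 2 := by
  simp [entrySum]; norm_num

/-- The distance of an element of `SL(2, ℝ)` from the identity, in the `ℓ¹`-norm. -/
def deviation (A : SL(2, ℝ)) : ℝ := entrySum ((A : Matrix (Fin 2) (Fin 2) ℝ) - 1)

theorem deviation_eq (A : SL(2, ℝ)) :
    deviation A = |A 0 0 - 1| + |A 0 1| + |A 1 0| + |A 1 1 - 1| := by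
  simp [deviation, entrySum]

theorem deviation_inv (A : SL(2, ℝ)) : deviation A⁻¹ = deviation A := by
  rw [deviation_eq, deviation_eq, sl_inv_apply_zero_zero, sl_inv_apply_zero_one,
    sl_inv_apply_one_zero, sl_inv_apply_one_one, abs_neg, abs_neg]
  ring

theorem entrySum_le_two_add (A : SL(2, ℝ)) :
    entrySum (A : Matrix (Fin 2) (Fin 2) ℝ) ≤ 2 + deviation A := by
  have h := entrySum_add_le 1 ((A : Matrix (Fin 2) (Fin 2) ℝ) - 1)
  rw [entrySum_one, add_sub_cancel] at h
  exact h

/-- With `X = A - 1` and `Y = B - 1` one has `A B A⁻¹ B⁻¹ - 1 = (X Y - Y X) A⁻¹ B⁻¹`, which is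
bilinear in the deviations. The constant works because `2 * (1/20) * (41/20)² < 1/2`. -/
theorem deviation_commutator_le {A B : SL(2, ℝ)} (hA : deviation A ≤ 1 / 20)
    (hB : deviation B ≤ 1 / 20) : deviation (A * B * A⁻¹ * B⁻¹) ≤ 1 / 2 * deviation B := by
  set X : Matrix (Fin 2) (Fin 2) ℝ := (A : Matrix (Fin 2) (Fin 2) ℝ) - 1 with hX
  set Y : Matrix (Fin 2) (Fin 2) ℝ := (B : Matrix (Fin 2) (Fin 2) ℝ) - 1 with hY
  set A' : Matrix (Fin 2) (Fin 2) ℝ := ((A⁻¹ : SL(2, ℝ)) : Matrix (Fin 2) (Fin 2) ℝ) with hA'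
  set B' : Matrix (Fin 2) (Fin 2) ℝ := ((B⁻¹ : SL(2, ℝ)) : Matrix (Fin 2) (Fin 2) ℝ) with hB'
  have hAA : (A : Matrix (Fin 2) (Fin 2) ℝ) * A' = 1 := by
    rw [hA', ← Matrix.SpecialLinearGroup.coe_mul, mul_inv_cancel, Matrix.SpecialLinearGroup.coe_one]
  have hBB : (B : Matrix (Fin 2) (Fin 2) ℝ) * B' = 1 := by
    rw [hB', ← Matrix.SpecialLinearGroup.coe_mul, mul_inv_cancel, Matrix.SpecialLinearGroup.coe_one]
  have hcoe : ((A * B * A⁻¹ * B⁻¹ : SL(2, ℝ)) : Matrix (Fin 2) (Fin 2) ℝ) - 1 =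
      (X * Y + -(Y * X)) * A' * B' := by
    have h1 : (X * Y + -(Y * X)) = (A : Matrix (Fin 2) (Fin 2) ℝ) * B - B * A := by
      rw [hX, hY]
      noncomm_ring
    have h2 : (B : Matrix (Fin 2) (Fin 2) ℝ) * A * A' * B' = 1 := by
      rw [mul_assoc (B : Matrix (Fin 2) (Fin 2) ℝ), hAA, mul_one, hBB]
    rw [h1, sub_mul, sub_mul, h2]
    rfl
  have hA2 : entrySum A' ≤ 2 + 1 / 20 :=
    (entrySum_le_two_add A⁻¹).trans (by rw [deviation_inv]; linarith)
  have hB2 : entrySum B' ≤ 2 + 1 / 20 :=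
    (entrySum_le_two_add B⁻¹).trans (by rw [deviation_inv]; linarith)
  have hX0 := entrySum_nonneg X
  have hY0 := entrySum_nonneg Y
  have hA0 := entrySum_nonneg A'
  have hB0 := entrySum_nonneg B'
  have hXle : entrySum X ≤ 1 / 20 := hA
  have h1 : entrySum (X * Y + -(Y * X)) ≤ 1 / 10 * entrySum Y := by
    refine (entrySum_add_le _ _).trans ?_
    rw [entrySum_neg]
    have h2 := entrySum_mul_le X Y
    have h3 := entrySum_mul_le Y X
    nlinarith
  change entrySum _ ≤ 1 / 2 * entrySum Y
  rw [hcoe]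
  calc entrySum ((X * Y + -(Y * X)) * A' * B')
      ≤ entrySum (X * Y + -(Y * X)) * entrySum A' * entrySum B' :=
        (entrySum_mul_le _ _).trans (by gcongr; exact entrySum_mul_le _ _)
    _ ≤ (1 / 10 * entrySum Y) * (2 + 1 / 20) * (2 + 1 / 20) := by gcongr
    _ ≤ 1 / 2 * entrySum Y := by linarith

theorem abs_sub_le_deviation (A : SL(2, ℝ)) (i j : Fin 2) :
    |A i j - (1 : SL(2, ℝ)) i j| ≤ deviation A := by
  rw [deviation_eq]
  have h00 := abs_nonneg (A 0 0 - 1)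
  have h01 := abs_nonneg (A 0 1)
  have h10 := abs_nonneg (A 1 0)
  have h11 := abs_nonneg (A 1 1 - 1)
  fin_cases i <;> fin_cases j <;> simp <;> linarith

theorem continuous_deviation : Continuous deviation := by
  rw [continuous_iff_continuousAt]
  intro A
  have h := (tendsto_sl_iff (u := id) (l := 𝓝 A) (A := A)).mp tendsto_id
  have h00 := (h 0 0).sub_const 1
  have h11 := (h 1 1).sub_const 1
  have := ((h00.abs.add (h 0 1).abs).add (h 1 0).abs).add h11.abs
  rw [ContinuousAt, deviation_eq]
  refine this.congr fun B ↦ ?_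
  rw [deviation_eq]
  rfl

theorem tendsto_one_of_deviation {u : ℕ → SL(2, ℝ)}
    (h : Tendsto (fun n ↦ deviation (u n)) atTop (𝓝 0)) : Tendsto u atTop (𝓝 1) := by
  rw [tendsto_sl_iff]
  intro i j
  rw [tendsto_iff_norm_sub_tendsto_zero]
  exact squeeze_zero (fun _ ↦ norm_nonneg _) (fun n ↦ abs_sub_le_deviation (u n) i j) h

theorem one_lt_trace_of_deviation {A : SL(2, ℝ)} (h : deviation A ≤ 1 / 20) :
    1 < A 0 0 + A 1 1 := by
  rw [deviation_eq] at h
  have h01 := abs_nonneg (A 0 1)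
  have h10 := abs_nonneg (A 1 0)
  have h00 := neg_abs_le (A 0 0 - 1)
  have h11 := neg_abs_le (A 1 1 - 1)
  linarith

theorem trace_conj (A B : SL(2, ℝ)) :
    (B⁻¹ * A * B) 0 0 + (B⁻¹ * A * B) 1 1 = A 0 0 + A 1 1 := by
  have hdet := sl_det B
  simp only [sl_mul_apply, sl_inv_apply_zero_zero, sl_inv_apply_zero_one, sl_inv_apply_one_zero,
    sl_inv_apply_one_one]
  linear_combination (A 0 0 + A 1 1) * hdet

/-- An element `B` whose commutator with a diagonal matrix is diagonal is itself diagonal,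
or else has trace zero. -/
theorem diagonal_of_commutator_diagonal {D B : SL(2, ℝ)} (h01 : D 0 1 = 0) (h10 : D 1 0 = 0)
    (h00 : D 0 0 ^ 2 ≠ 1) (hB : B 0 0 + B 1 1 ≠ 0) (hc01 : (D * B * D⁻¹ * B⁻¹) 0 1 = 0)
    (hc10 : (D * B * D⁻¹ * B⁻¹) 1 0 = 0) : B 0 1 = 0 ∧ B 1 0 = 0 := by
  have hD := sl_det D
  have hdet := sl_det B
  simp only [sl_mul_apply, sl_inv_apply_zero_zero, sl_inv_apply_zero_one, sl_inv_apply_one_zero,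
    sl_inv_apply_one_one, h01, h10] at hc01 hc10 hD
  ring_nf at hc01 hc10 hD
  have hD00 : D 0 0 ≠ 0 := fun h ↦ by simp [h] at hD
  have hD11 : D 1 1 ≠ 0 := fun h ↦ by simp [h] at hD
  have h1 : B 0 0 * B 0 1 = 0 := by
    have : (D 0 0 ^ 2 - 1) * (B 0 0 * B 0 1) = 0 := by
      linear_combination hc01 + B 0 0 * B 0 1 * hD
    exact (mul_eq_zero.mp this).resolve_left (sub_ne_zero.mpr h00)
  have h2 : B 1 0 * B 1 1 = 0 := by
    have : (D 1 1 ^ 2 - 1) * (B 1 0 * B 1 1) = 0 := by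
      linear_combination hc10 + B 1 0 * B 1 1 * hD
    refine (mul_eq_zero.mp this).resolve_left (sub_ne_zero.mpr fun h ↦ h00 ?_)
    have : (D 0 0 * D 1 1) ^ 2 = 1 := by rw [hD, one_pow]
    rw [mul_pow, h, mul_one] at this
    exact this
  rcases mul_eq_zero.mp h1 with h3 | h3
  · rcases mul_eq_zero.mp h2 with h4 | h4
    · rw [h3, h4] at hdet
      simp at hdet
    · exact absurd (by rw [h3, h4, add_zero]) hB
  · rcases mul_eq_zero.mp h2 with h4 | h4
    · exact ⟨h3, h4⟩
    · rw [h3, h4] at hdet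
      simp at hdet

/-- If a discrete group contains a hyperbolic element `D` close to the identity, then all its
elements close to the identity have the same axis as `D`. -/
theorem ProperlyDiscontinuous.diagonal_of_deviation_le (hΓ : ProperlyDiscontinuous Γ)
    {D B k : SL(2, ℝ)} (hD : (QuotientGroup.mk D : PSL(2, ℝ)) ∈ Γ)
    (hB : (QuotientGroup.mk B : PSL(2, ℝ)) ∈ Γ) (hDdev : deviation D ≤ 1 / 20)
    (hBdev : deviation B ≤ 1 / 20) (h01 : (k⁻¹ * D * k) 0 1 = 0) (h10 : (k⁻¹ * D * k) 1 0 = 0)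
    (h00 : (k⁻¹ * D * k) 0 0 ^ 2 ≠ 1) : (k⁻¹ * B * k) 0 1 = 0 ∧ (k⁻¹ * B * k) 1 0 = 0 := by
  -- The iterated commutators with `D` at least halve their deviation, so one of them is trivial, in
  -- particular diagonal in the basis `k`. Diagonality then descends through the iteration back to
  -- `B`; the exceptional trace zero is excluded by closeness to the identity.
  set u : ℕ → SL(2, ℝ) := fun n ↦ (fun X ↦ D * X * D⁻¹ * X⁻¹)^[n] B with hu
  have hsucc : ∀ n, u (n + 1) = D * u n * D⁻¹ * (u n)⁻¹ := fun n ↦ by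
    simp only [hu, Function.iterate_succ_apply']
  have hmem : ∀ n, (QuotientGroup.mk (u n) : PSL(2, ℝ)) ∈ Γ := by
    intro n
    induction n with
    | zero => exact hB
    | succ n ih =>
      rw [hsucc]
      exact mul_mem (mul_mem (mul_mem hD ih) (inv_mem hD)) (inv_mem ih)
  have hdev : ∀ n, deviation (u n) ≤ 1 / 20 * (1 / 2) ^ n := by
    intro n
    induction n with
    | zero => simpa [hu] using hBdev
    | succ n ih =>
      have h1 : (1 / 20 : ℝ) * (1 / 2) ^ n ≤ 1 / 20 :=
        mul_le_of_le_one_right (by norm_num) (pow_le_one₀ (by norm_num) (by norm_num))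
      rw [hsucc, pow_succ]
      linarith [deviation_commutator_le hDdev (ih.trans h1)]
  have hlim : Tendsto u atTop (𝓝 1) := by
    refine tendsto_one_of_deviation (squeeze_zero (fun n ↦ entrySum_nonneg _) hdev ?_)
    have h1 := (tendsto_pow_atTop_nhds_zero_of_lt_one (r := (1 / 2 : ℝ)) (by norm_num)
      (by norm_num)).const_mul (1 / 20)
    rwa [mul_zero] at h1
  obtain ⟨n, hn⟩ := (hΓ.eventually_eq_one_of_tendsto hmem hlim).exists
  have hn' : (k⁻¹ * u n * k) 0 1 = 0 ∧ (k⁻¹ * u n * k) 1 0 = 0 := by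
    rw [hn, mul_one, inv_mul_cancel]
    simp
  clear hn
  induction n with
  | zero => exact hn'
  | succ n ih =>
    refine ih ?_
    have hconj : k⁻¹ * u (n + 1) * k = (k⁻¹ * D * k) * (k⁻¹ * u n * k) * (k⁻¹ * D * k)⁻¹ *
        (k⁻¹ * u n * k)⁻¹ := by
      rw [hsucc]
      group
    rw [hconj] at hn'
    refine diagonal_of_commutator_diagonal h01 h10 h00 ?_ hn'.1 hn'.2
    rw [trace_conj]
    have h1 : (1 / 20 : ℝ) * (1 / 2) ^ n ≤ 1 / 20 :=
      mul_le_of_le_one_right (by norm_num) (pow_le_one₀ (by norm_num) (by norm_num))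
    linarith [one_lt_trace_of_deviation ((hdev n).trans h1)]

end TwistedEisenstein

/-! ## Recurrence and hyperbolic elements -/

namespace TwistedEisenstein

open Filter Topology

variable {Γ : Subgroup PSL(2, ℝ)}

/-- An isometry moving `i` very little has a bounded power close to the identity. -/
theorem exists_pow_mem_nhds_one {W : Set SL(2, ℝ)} (hW : W ∈ 𝓝 1) :
    ∃ (δ : ℝ) (M : ℕ), 0 < δ ∧ ∀ B : SL(2, ℝ), dist I (B • I) < δ →
      ∃ m, 1 ≤ m ∧ m ≤ M ∧ B ^ m ∈ W := by
  have hC : IsCompact {B : SL(2, ℝ) | dist I (B • I) ≤ 1} := by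
    have := isProperMap_smul_I.isCompact_preimage (isCompact_closedBall I 1)
    convert this using 1
    ext B
    simp [dist_comm]
  have hU : ∀ g : SL(2, ℝ), ∃ U ∈ 𝓝 g, ∀ a ∈ U, ∀ b ∈ U, a⁻¹ * b ∈ W := by
    intro g
    have hc : Continuous fun p : SL(2, ℝ) × SL(2, ℝ) ↦ p.1⁻¹ * p.2 := by fun_prop
    have h0 := hc.tendsto (g, g)
    rw [inv_mul_cancel, nhds_prod_eq] at h0
    have h1 : ∀ᶠ p : SL(2, ℝ) × SL(2, ℝ) in 𝓝 g ×ˢ 𝓝 g, p.1⁻¹ * p.2 ∈ W := h0.eventually_mem hW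
    exact Filter.eventually_prod_self_iff.mp h1
  choose U hU hUW using hU
  obtain ⟨t, -, ht⟩ := hC.elim_nhds_subcover U fun g _ ↦ hU g
  -- With this `δ` the `t.card + 1` powers of `B` with exponents `0, …, t.card` stay in the compact
  -- set. Two of them share a neighbourhood `U g`, and their quotient is the desired power.
  refine ⟨1 / (t.card + 1), t.card, by positivity, fun B hB ↦ ?_⟩
  have hpow : ∀ n : ℕ, dist I (B ^ n • I) ≤ n * dist I (B • I) := by
    intro n
    induction n with
    | zero => simp
    | succ n ih =>
      rw [pow_succ, mul_smul]
      calc dist I (B ^ n • B • I) ≤ dist I (B ^ n • I) + dist (B ^ n • I) (B ^ n • B • I) :=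
            dist_triangle _ _ _
        _ ≤ n * dist I (B • I) + dist I (B • I) := by rw [dist_smul]; gcongr
        _ = _ := by push_cast; ring
  have hcov : ∀ n ∈ Finset.range (t.card + 1), ∃ g ∈ t, B ^ n ∈ U g := by
    intro n hn
    have h1 : B ^ n ∈ {B : SL(2, ℝ) | dist I (B • I) ≤ 1} := by
      refine (hpow n).trans ?_
      have h2 : (n : ℝ) ≤ t.card + 1 := by
        exact_mod_cast (Finset.mem_range.mp hn).le
      calc (n : ℝ) * dist I (B • I) ≤ (t.card + 1) * (1 / (t.card + 1)) := by gcongr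
        _ = 1 := by field_simp
    have := ht h1
    simpa using this
  choose! f hft hfU using hcov
  obtain ⟨i, hi, j, hj, hij, hfij⟩ := Finset.exists_ne_map_eq_of_card_lt_of_maps_to
    (s := Finset.range (t.card + 1)) (t := t) (f := f) (by simp) hft
  wlog hlt : i < j generalizing i j
  · exact this j hj i hi hij.symm hfij.symm (lt_of_le_of_ne (not_lt.mp hlt) hij.symm)
  refine ⟨j - i, by omega, ?_, ?_⟩
  · have := Finset.mem_range.mp hj
    omega
  · have h1 := hUW (f i) _ (hfU i hi) _ (by rw [hfij]; exact hfU j hj)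
    rwa [← pow_sub_mul_pow B hlt.le, ← pow_add, add_comm, pow_add, inv_mul_cancel_left] at h1

/-- Hyperbolic elements of `SL(2, ℝ)` of positive trace are diagonalizable. -/
theorem exists_diagonal_conj {A : SL(2, ℝ)} (hA : 2 < A 0 0 + A 1 1) :
    ∃ h : SL(2, ℝ), (h⁻¹ * A * h) 0 1 = 0 ∧ (h⁻¹ * A * h) 1 0 = 0 ∧ 1 < (h⁻¹ * A * h) 0 0 := by
  have hdet := sl_det A
  set t := A 0 0 + A 1 1 with ht
  -- The larger root of the characteristic polynomial; the other one is `l⁻¹`.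
  set l := (t + √(t ^ 2 - 4)) / 2 with hl
  have hsq : √(t ^ 2 - 4) ^ 2 = t ^ 2 - 4 := Real.sq_sqrt (by nlinarith)
  have hl1 : 1 < l := by
    have := Real.sqrt_nonneg (t ^ 2 - 4)
    rw [hl]; linarith
  have hchar : l ^ 2 - t * l + 1 = 0 := by rw [hl]; linear_combination hsq / 4
  have hl0 : l ≠ 0 := by positivity
  have hchar' : (l⁻¹) ^ 2 - t * l⁻¹ + 1 = 0 := by
    field_simp
    linear_combination hchar
  have hne : l - l⁻¹ ≠ 0 := by
    have : l⁻¹ < 1 := inv_lt_one_of_one_lt₀ hl1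
    linarith
  have hev : ∀ m : ℝ, m ^ 2 - t * m + 1 = 0 → ∃ v : Fin 2 → ℝ, v ≠ 0 ∧
      A 0 0 * v 0 + A 0 1 * v 1 = m * v 0 ∧ A 1 0 * v 0 + A 1 1 * v 1 = m * v 1 := by
    intro m hm
    obtain ⟨v, hv, hv0⟩ := Matrix.exists_mulVec_eq_zero_iff
      (M := !![A 0 0 - m, A 0 1; A 1 0, A 1 1 - m]).mpr (by
        rw [Matrix.det_fin_two_of]; linear_combination hm + hdet - m * ht)
    refine ⟨v, hv, ?_, ?_⟩
    · have := congrFun hv0 0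
      simp [Matrix.mulVec, dotProduct, Fin.sum_univ_two] at this
      linarith
    · have := congrFun hv0 1
      simp [Matrix.mulVec, dotProduct, Fin.sum_univ_two] at this
      linarith
  obtain ⟨v, hv, hv1, hv2⟩ := hev l hchar
  obtain ⟨w, hw, hw1, hw2⟩ := hev l⁻¹ hchar'
  set d := v 0 * w 1 - w 0 * v 1 with hd
  have hd0 : d ≠ 0 := by
    intro h0
    have h1 : v 0 * w 1 = w 0 * v 1 := by linarith
    have h2 : v 0 * w 0 = 0 := by
      have : (l - l⁻¹) * (v 0 * w 0) = 0 := by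
        linear_combination -w 0 * hv1 + v 0 * hw1 - A 0 1 * h1
      exact (mul_eq_zero.mp this).resolve_left hne
    have h3 : v 1 * w 1 = 0 := by
      have : (l - l⁻¹) * (v 1 * w 1) = 0 := by
        linear_combination -w 1 * hv2 + v 1 * hw2 + A 1 0 * h1
      exact (mul_eq_zero.mp this).resolve_left hne
    rcases mul_eq_zero.mp h2 with h4 | h4
    · have hv1' : v 1 ≠ 0 := fun h ↦ hv (by ext i; fin_cases i <;> simp [h4, h])
      have hw1' := (mul_eq_zero.mp h3).resolve_left hv1'
      rw [h4, zero_mul, eq_comm] at h1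
      have hw0' := (mul_eq_zero.mp h1).resolve_right hv1'
      exact hw (by ext i; fin_cases i <;> simp [hw1', hw0'])
    · have hw1' : w 1 ≠ 0 := fun h ↦ hw (by ext i; fin_cases i <;> simp [h4, h])
      have hv1' := (mul_eq_zero.mp h3).resolve_right hw1'
      rw [h4, zero_mul] at h1
      have hv0' := (mul_eq_zero.mp h1).resolve_right hw1'
      exact hv (by ext i; fin_cases i <;> simp [hv1', hv0'])
  -- The columns are eigenvectors, the second one scaled to make the determinant one.
  set h : SL(2, ℝ) := ⟨!![v 0, w 0 / d; v 1, w 1 / d], by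
    rw [Matrix.det_fin_two_of]
    field_simp
    linear_combination -hd⟩
  have h00 : h 0 0 = v 0 := rfl
  have h01 : h 0 1 = w 0 / d := rfl
  have h10 : h 1 0 = v 1 := rfl
  have h11 : h 1 1 = w 1 / d := rfl
  refine ⟨h, ?_, ?_, ?_⟩
  · simp only [sl_mul_apply, sl_inv_apply_zero_zero, sl_inv_apply_zero_one, h01, h11]
    field_simp
    linear_combination w 1 * hw1 - w 0 * hw2
  · simp only [sl_mul_apply, sl_inv_apply_one_zero, sl_inv_apply_one_one, h00, h10]
    linear_combination -v 1 * hv1 + v 0 * hv2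
  · have : (h⁻¹ * A * h) 0 0 = l := by
      simp only [sl_mul_apply, sl_inv_apply_zero_zero, sl_inv_apply_zero_one, h00, h01, h10, h11]
      field_simp
      linear_combination w 1 * hv1 - w 0 * hv2 - l * hd
    rwa [this]

theorem dist_I_smul_le (A : SL(2, ℝ)) :
    dist I (A • I) ≤ A 0 0 ^ 2 + A 0 1 ^ 2 + A 1 0 ^ 2 + A 1 1 ^ 2 := by
  rw [← cosh_dist_I_smul, Real.cosh_eq]
  have h1 := Real.add_one_le_exp (dist I (A • I))
  have h2 := Real.exp_pos (-dist I (A • I))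
  linarith

/-- The deviation of a diagonal element, seen from a point off its axis. -/
theorem deviation_conj_translationSL {D : SL(2, ℝ)} (h01 : D 0 1 = 0) (h10 : D 1 0 = 0)
    (h00 : 1 < D 0 0) {x : ℝ} (hx : 0 ≤ x) :
    deviation ((translationSL x)⁻¹ * D * translationSL x) = (D 0 0 - (D 0 0)⁻¹) * (1 + x) := by
  have hD := sl_det D
  rw [h01, zero_mul, sub_zero] at hD
  have h11 : D 1 1 = (D 0 0)⁻¹ := eq_inv_of_mul_eq_one_right hD
  have hlt : (D 0 0)⁻¹ < 1 := inv_lt_one_of_one_lt₀ h00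
  rw [deviation_eq]
  simp only [sl_mul_apply, sl_inv_apply_zero_zero, sl_inv_apply_zero_one, sl_inv_apply_one_zero,
    sl_inv_apply_one_one, translationSL_apply_zero_zero, translationSL_apply_zero_one,
    translationSL_apply_one_zero, translationSL_apply_one_one, h01, h10, h11]
  have e1 : (1 * D 0 0 + -x * 0) * x + (1 * 0 + -x * (D 0 0)⁻¹) * 1 = (D 0 0 - (D 0 0)⁻¹) * x := by
    ring
  rw [e1, abs_of_nonneg (a := (D 0 0 - (D 0 0)⁻¹) * x) (mul_nonneg (by linarith) hx)]
  ring_nf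
  rw [abs_of_pos (a := -1 + D 0 0) (by linarith), abs_of_neg (a := -1 + (D 0 0)⁻¹) (by linarith),
    abs_zero]
  ring

end TwistedEisenstein

/-! ## The thick part of a torsion-free lattice -/

namespace TwistedEisenstein

open Filter Topology

variable {Γ : Subgroup PSL(2, ℝ)}

/-- The points of injectivity radius at least `r` form a compact set modulo `Γ`. -/
def ThickPartCompact (Γ : Subgroup PSL(2, ℝ)) : Prop :=
  ∀ r : ℝ, 0 < r → ∃ R : ℝ, ∀ z : ℍ, (∀ γ : Γ, γ ≠ 1 → 2 * r ≤ dist z (γ • z)) →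
    ∃ γ : Γ, dist I (γ • z) ≤ R

theorem IsLattice.thickPartCompact (hΓ : IsLattice Γ) : ThickPartCompact Γ := by
  obtain ⟨hd, F, hF, hFfin⟩ := hΓ
  have := (properlyDiscontinuous_of_discrete Γ).countable
  exact fun r hr ↦ exists_dist_le_of_injectivityRadius hF hFfin hr

theorem mk_pow_ne_one (htf : ∀ γ ∈ Γ, IsOfFinOrder γ → γ = 1) {A : SL(2, ℝ)}
    (hA : (QuotientGroup.mk A : PSL(2, ℝ)) ∈ Γ) (h1 : (QuotientGroup.mk A : PSL(2, ℝ)) ≠ 1)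
    {m : ℕ} (hm : 1 ≤ m) : A ^ m ≠ 1 := by
  intro h
  refine h1 (htf _ hA (isOfFinOrder_iff_pow_eq_one.mpr ⟨m, hm, ?_⟩))
  exact congrArg (QuotientGroup.mk (s := Subgroup.center SL(2, ℝ))) h

theorem conj_pow' (A B : SL(2, ℝ)) (n : ℕ) : (B⁻¹ * A * B) ^ n = B⁻¹ * A ^ n * B := by
  have := conj_pow (i := n) (a := B⁻¹) (b := A)
  rwa [inv_inv] at this

theorem dist_conj_smul_I (A g : SL(2, ℝ)) : dist I ((g⁻¹ * A * g) • I) = dist (g • I) (A • g • I) := by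
  rw [mul_smul, mul_smul, ← dist_smul g, smul_inv_smul]

/-- If the lifts to `SL(2, ℝ)` of all nontrivial elements of a torsion-free group are far from the
identity, as seen from a point, then the injectivity radius at that point is bounded below. -/
theorem exists_le_dist_of_deviation (htf : ∀ γ ∈ Γ, IsOfFinOrder γ → γ = 1) {ε : ℝ} (hε : 0 < ε) :
    ∃ δ : ℝ, 0 < δ ∧ ∀ g : SL(2, ℝ), (∀ A : SL(2, ℝ), (QuotientGroup.mk A : PSL(2, ℝ)) ∈ Γ →
      A ≠ 1 → ε ≤ deviation (g⁻¹ * A * g)) → ∀ γ : Γ, γ ≠ 1 → δ ≤ dist (g • I) (γ • g • I) := by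
  have hW : {B | deviation B < ε} ∈ 𝓝 (1 : SL(2, ℝ)) := by
    refine continuous_deviation.continuousAt.eventually_lt continuousAt_const ?_
    simpa [deviation_eq] using hε
  obtain ⟨δ, M, hδ, h⟩ := exists_pow_mem_nhds_one hW
  refine ⟨δ, hδ, fun g hg γ hγ ↦ ?_⟩
  by_contra! hlt
  obtain ⟨γ, hγΓ⟩ := γ
  obtain ⟨A, rfl⟩ := exists_lift γ
  have hA1 : (QuotientGroup.mk A : PSL(2, ℝ)) ≠ 1 := fun h ↦ hγ (Subtype.ext h)
  have hlt' : dist I ((g⁻¹ * A * g) • I) < δ := by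
    rw [dist_conj_smul_I]
    exact hlt
  -- A small displacement alone allows near-rotations; a power is close to the identity, and it is
  -- nontrivial because the group is torsion-free.
  obtain ⟨m, hm1, -, hm⟩ := h _ hlt'
  rw [conj_pow'] at hm
  exact absurd hm (not_lt.mpr (hg _ (pow_mem hγΓ m) (mk_pow_ne_one htf hγΓ hA1 hm1)))

theorem trace_conj' (A B : SL(2, ℝ)) :
    (B * A * B⁻¹) 0 0 + (B * A * B⁻¹) 1 1 = A 0 0 + A 1 1 := by
  have := trace_conj A B⁻¹
  rwa [inv_inv] at this

/-! ### Inequalities between eigenvalue and trace of a hyperbolic element -/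

theorem sub_inv_le_sub_inv {a b : ℝ} (ha : 0 < a) (hab : a ≤ b) : a - a⁻¹ ≤ b - b⁻¹ := by
  have := inv_anti₀ ha hab
  linarith

/-- From `(a + a⁻¹)² = (a - a⁻¹)² + 4`; the value `1 / 10000` is merely small enough. -/
theorem two_add_le_add_inv {a : ℝ} (ha : 1 < a) (h : 1 / 20 ≤ a - a⁻¹) :
    2 + 1 / 10000 ≤ a + a⁻¹ := by
  have h1 : a * a⁻¹ = 1 := mul_inv_cancel₀ (by linarith)
  have h2 : 0 < a⁻¹ := inv_pos.mpr (by linarith)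
  have h3 : (a + a⁻¹) ^ 2 = (a - a⁻¹) ^ 2 + 4 := by linear_combination 4 * h1
  have h4 : (1 / 20) ^ 2 ≤ (a - a⁻¹) ^ 2 := by gcongr
  by_contra! h5
  have h6 : (a + a⁻¹) ^ 2 < (2 + 1 / 10000) ^ 2 := by gcongr
  norm_num at h4 h6
  linarith

theorem two_lt_add_inv {a : ℝ} (ha : 1 < a) : 2 < a + a⁻¹ := by
  have h1 : a * a⁻¹ = 1 := mul_inv_cancel₀ (by linarith)
  have h2 : 0 < a⁻¹ := inv_pos.mpr (by linarith)
  have h3 : 0 < (a - 1) ^ 2 * a⁻¹ := mul_pos (pow_pos (by linarith) 2) h2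
  have h4 : (a - 1) ^ 2 * a⁻¹ = a + a⁻¹ - 2 := by linear_combination (a - 2) * h1
  linarith

theorem add_inv_le_add_inv {a b : ℝ} (ha : 1 < a) (hab : a ≤ b) : a + a⁻¹ ≤ b + b⁻¹ := by
  have h1 : a * a⁻¹ = 1 := mul_inv_cancel₀ (by linarith)
  have h2 : b * b⁻¹ = 1 := mul_inv_cancel₀ (by linarith)
  have h3 : 0 < b⁻¹ := inv_pos.mpr (by linarith)
  have h4 : a⁻¹ < 1 := inv_lt_one_of_one_lt₀ ha
  have h5 : b⁻¹ ≤ 1 := (inv_lt_one_of_one_lt₀ (ha.trans_le hab)).le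
  have h6 : 0 ≤ (b - a) * (1 - a⁻¹ * b⁻¹) :=
    mul_nonneg (by linarith) (by nlinarith [inv_pos.mpr (zero_lt_one.trans ha)])
  have h7 : (b - a) * (1 - a⁻¹ * b⁻¹) = b + b⁻¹ - (a + a⁻¹) := by
    linear_combination (-a⁻¹) * h2 + b⁻¹ * h1
  linarith

theorem apply_one_one_of_diagonal {D : SL(2, ℝ)} (h01 : D 0 1 = 0) : D 1 1 = (D 0 0)⁻¹ := by
  have hD := sl_det D
  rw [h01, zero_mul, sub_zero] at hD
  exact eq_inv_of_mul_eq_one_right hD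

/-- Among the elements of a discrete group with the same axis as a given hyperbolic element, there
is one of minimal translation length. -/
theorem ProperlyDiscontinuous.exists_minimal_diagonal (hΓ : ProperlyDiscontinuous Γ)
    {A h : SL(2, ℝ)} (hA : (QuotientGroup.mk A : PSL(2, ℝ)) ∈ Γ) (h01 : (h⁻¹ * A * h) 0 1 = 0)
    (h10 : (h⁻¹ * A * h) 1 0 = 0) (h00 : 1 < (h⁻¹ * A * h) 0 0) :
    ∃ X : SL(2, ℝ), (QuotientGroup.mk X : PSL(2, ℝ)) ∈ Γ ∧ (h⁻¹ * X * h) 0 1 = 0 ∧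
      (h⁻¹ * X * h) 1 0 = 0 ∧ 1 < (h⁻¹ * X * h) 0 0 ∧
      (h⁻¹ * X * h) 0 0 ≤ (h⁻¹ * A * h) 0 0 ∧
      ∀ Y : SL(2, ℝ), (QuotientGroup.mk Y : PSL(2, ℝ)) ∈ Γ → (h⁻¹ * Y * h) 0 1 = 0 →
        (h⁻¹ * Y * h) 1 0 = 0 → 1 < (h⁻¹ * Y * h) 0 0 →
        (h⁻¹ * X * h) 0 0 ≤ (h⁻¹ * Y * h) 0 0 := by
  set S := {X : SL(2, ℝ) | (QuotientGroup.mk X : PSL(2, ℝ)) ∈ Γ ∧ (h⁻¹ * X * h) 0 1 = 0 ∧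
    (h⁻¹ * X * h) 1 0 = 0 ∧ 1 < (h⁻¹ * X * h) 0 0 ∧
    (h⁻¹ * X * h) 0 0 ≤ (h⁻¹ * A * h) 0 0} with hS
  -- Bounded eigenvalues on a common axis bound the displacement of the point `h i` of the axis.
  have hSfin : S.Finite := by
    refine (hΓ.finite (h • I) (h • I) ((h⁻¹ * A * h) 0 0 ^ 2 + 1)).subset ?_
    rintro X ⟨h1, h2, h3, h4, h5⟩
    refine ⟨h1, ?_⟩
    rw [← dist_conj_smul_I]
    refine (dist_I_smul_le _).trans ?_
    have h8 : ((h⁻¹ * X * h) 0 0)⁻¹ < 1 := inv_lt_one_of_one_lt₀ h4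
    have h9 : 0 < ((h⁻¹ * X * h) 0 0)⁻¹ := inv_pos.mpr (by linarith)
    rw [h2, h3, apply_one_one_of_diagonal h2]
    have h10 : ((h⁻¹ * X * h) 0 0)⁻¹ ^ 2 ≤ 1 := pow_le_one₀ h9.le h8.le
    have h11 : (h⁻¹ * X * h) 0 0 ^ 2 ≤ (h⁻¹ * A * h) 0 0 ^ 2 :=
      pow_le_pow_left₀ (by linarith) h5 2
    linarith
  obtain ⟨X, ⟨hX, hX01, hX10, hX00, hXlA⟩, hXmin⟩ := Set.exists_min_image S
    (fun X ↦ (h⁻¹ * X * h) 0 0) hSfin ⟨A, hA, h01, h10, h00, le_rfl⟩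
  refine ⟨X, hX, hX01, hX10, hX00, hXlA, fun Y h1 h2 h3 h4 ↦ ?_⟩
  rcases le_total ((h⁻¹ * Y * h) 0 0) ((h⁻¹ * A * h) 0 0) with h5 | h5
  · exact hXmin Y ⟨h1, h2, h3, h4, h5⟩
  · exact hXlA.trans h5

theorem mk_conj_mem_comap_conj {Y : SL(2, ℝ)} (hY : (QuotientGroup.mk Y : PSL(2, ℝ)) ∈ Γ)
    (g : SL(2, ℝ)) : (QuotientGroup.mk (g⁻¹ * Y * g) : PSL(2, ℝ)) ∈
      Γ.comap (MulAut.conj (QuotientGroup.mk g : PSL(2, ℝ))).toMonoidHom := by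
  rw [mem_comap_conj]
  have : (QuotientGroup.mk g : PSL(2, ℝ)) * QuotientGroup.mk (g⁻¹ * Y * g) *
      (QuotientGroup.mk g)⁻¹ = QuotientGroup.mk (g * (g⁻¹ * Y * g) * g⁻¹) := rfl
  rw [this]
  have h2 : g * (g⁻¹ * Y * g) * g⁻¹ = Y := by group
  rwa [h2]

/-- At a suitable distance from the axis of a short hyperbolic element of minimal translation
length, no element of the group is closer to the identity than this one. -/
theorem ProperlyDiscontinuous.exists_deviation_eq (hΓ : ProperlyDiscontinuous Γ)
    {X h : SL(2, ℝ)} (hX : (QuotientGroup.mk X : PSL(2, ℝ)) ∈ Γ) (hX01 : (h⁻¹ * X * h) 0 1 = 0)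
    (hX10 : (h⁻¹ * X * h) 1 0 = 0) (hX00 : 1 < (h⁻¹ * X * h) 0 0)
    (hsmall : (h⁻¹ * X * h) 0 0 - ((h⁻¹ * X * h) 0 0)⁻¹ ≤ 1 / 20)
    (hmin : ∀ Y : SL(2, ℝ), (QuotientGroup.mk Y : PSL(2, ℝ)) ∈ Γ → (h⁻¹ * Y * h) 0 1 = 0 →
        (h⁻¹ * Y * h) 1 0 = 0 → 1 < (h⁻¹ * Y * h) 0 0 →
        (h⁻¹ * X * h) 0 0 ≤ (h⁻¹ * Y * h) 0 0) :
    ∃ g : SL(2, ℝ), deviation (g⁻¹ * X * g) = 1 / 20 ∧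
      ∀ Y : SL(2, ℝ), (QuotientGroup.mk Y : PSL(2, ℝ)) ∈ Γ → Y ≠ 1 →
        1 / 20 ≤ deviation (g⁻¹ * Y * g) := by
  obtain ⟨l, hl⟩ : ∃ l, l = (h⁻¹ * X * h) 0 0 := ⟨_, rfl⟩
  rw [← hl] at hX00 hsmall
  have hl0 : 0 < l := by linarith
  have hl1 : l⁻¹ < 1 := inv_lt_one_of_one_lt₀ hX00
  have hlpos : 0 < l - l⁻¹ := by linarith
  -- The parameter `x` moves the base point off the axis and scales all deviations of elements with
  -- this axis and eigenvalue above one by `1 + x`; it is chosen to make that of `X` exactly `1 /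
  -- 20`.
  obtain ⟨x, hx0, hx1⟩ : ∃ x : ℝ, 0 ≤ x ∧ (l - l⁻¹) * (1 + x) = 1 / 20 := by
    refine ⟨1 / 20 / (l - l⁻¹) - 1, ?_, ?_⟩
    · rw [sub_nonneg, le_div_iff₀ hlpos]
      linarith
    · rw [add_sub_cancel, mul_div_cancel₀ _ hlpos.ne']
  refine ⟨h * translationSL x, ?_, ?_⟩
  all_goals
    have hgconj : ∀ Y : SL(2, ℝ), (h * translationSL x)⁻¹ * Y * (h * translationSL x) =
        (translationSL x)⁻¹ * (h⁻¹ * Y * h) * translationSL x := fun Y ↦ by group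
    have hXdev : deviation ((h * translationSL x)⁻¹ * X * (h * translationSL x)) = 1 / 20 := by
      rw [hgconj, deviation_conj_translationSL hX01 hX10 (hl ▸ hX00) hx0, ← hl, hx1]
  · exact hXdev
  intro Y hY hY1
  by_contra! hlt
  -- An element `Y` closer to the identity would share the axis of `X`; minimality of `X` then makes
  -- its deviation at least that of `X`.
  have hdiag : (h⁻¹ * Y * h) 0 1 = 0 ∧ (h⁻¹ * Y * h) 1 0 = 0 := by
    have hconj : ∀ Y : SL(2, ℝ), ((translationSL x)⁻¹)⁻¹ * ((h * translationSL x)⁻¹ * Y *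
      (h * translationSL x)) * (translationSL x)⁻¹ = h⁻¹ * Y * h := fun Y ↦ by group
    have := (hΓ.comap_conj (QuotientGroup.mk (h * translationSL x))).diagonal_of_deviation_le
      (k := (translationSL x)⁻¹) (mk_conj_mem_comap_conj hX _) (mk_conj_mem_comap_conj hY _)
      hXdev.le hlt.le
      (by rw [hconj]; exact hX01) (by rw [hconj]; exact hX10)
      (by rw [hconj, ← hl]; exact (one_lt_pow₀ hX00 two_ne_zero).ne')
    rwa [hconj] at this
  have htrY : 1 < (h⁻¹ * Y * h) 0 0 + (h⁻¹ * Y * h) 1 1 := by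
    rw [trace_conj, ← trace_conj Y (h * translationSL x)]
    exact one_lt_trace_of_deviation hlt.le
  -- The diagonal entries are positive, having product one and positive sum, so `Y` or `Y⁻¹` has
  -- first entry at least one.
  wlog hY00 : 1 ≤ (h⁻¹ * Y * h) 0 0 generalizing Y
  · have hinv : ∀ k : SL(2, ℝ), k⁻¹ * Y⁻¹ * k = (k⁻¹ * Y * k)⁻¹ := fun k ↦ by group
    have hdetY := sl_det (h⁻¹ * Y * h)
    rw [hdiag.1, zero_mul, sub_zero] at hdetY
    push Not at hY00
    refine this Y⁻¹ (inv_mem hY) (by simpa using hY1) ?_ ?_ ?_ ?_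
    · rwa [hinv, deviation_inv]
    · rw [hinv, sl_inv_apply_zero_one, sl_inv_apply_one_zero, hdiag.1, hdiag.2]
      simp
    · rw [hinv, sl_inv_apply_zero_zero, sl_inv_apply_one_one]
      linarith
    · rw [hinv, sl_inv_apply_zero_zero]
      nlinarith
  rcases hY00.eq_or_lt with h1 | h1
  · refine hY1 ?_
    have h2 : h⁻¹ * Y * h = 1 := by
      have hdetY := sl_det (h⁻¹ * Y * h)
      rw [hdiag.1, zero_mul, sub_zero, ← h1, one_mul] at hdetY
      exact sl_ext h1.symm hdiag.1 hdiag.2 hdetY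
    have h3 : Y = h * (h⁻¹ * Y * h) * h⁻¹ := by group
    rw [h3, h2]
    group
  · rw [hgconj, deviation_conj_translationSL hdiag.1 hdiag.2 h1 hx0] at hlt
    have hle := hmin Y hY hdiag.1 hdiag.2 h1
    rw [← hl] at hle
    have h3 := mul_le_mul_of_nonneg_right (sub_inv_le_sub_inv hl0 hle)
      (show 0 ≤ 1 + x by linarith)
    linarith

theorem dist_le_of_deviation_le {A g : SL(2, ℝ)} (h : deviation (g⁻¹ * A * g) ≤ 1 / 20) :
    dist (g • I) (A • g • I) ≤ 10 := by
  rw [← dist_conj_smul_I]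
  refine (dist_I_smul_le _).trans ?_
  generalize g⁻¹ * A * g = B at h
  have hb2 : ∀ i j, B i j ^ 2 ≤ 2 := by
    intro i j
    have h1 := abs_sub_le_deviation B i j
    have h2 : |(1 : SL(2, ℝ)) i j| ≤ 1 := by
      fin_cases i <;> fin_cases j <;> simp
    have h3 := abs_sub_abs_le_abs_sub (B i j) ((1 : SL(2, ℝ)) i j)
    rw [← sq_abs]
    nlinarith [abs_nonneg (B i j)]
  linarith [hb2 0 0, hb2 0 1, hb2 1 0, hb2 1 1]

/-- The closed geodesics of a torsion-free lattice have length bounded below. -/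
theorem ProperlyDiscontinuous.exists_two_lt_le_trace (hΓ : ProperlyDiscontinuous Γ)
    (htf : ∀ γ ∈ Γ, IsOfFinOrder γ → γ = 1) (hthick : ThickPartCompact Γ) :
    ∃ t₀ : ℝ, 2 < t₀ ∧ ∀ A : SL(2, ℝ), (QuotientGroup.mk A : PSL(2, ℝ)) ∈ Γ →
      2 < A 0 0 + A 1 1 → t₀ ≤ A 0 0 + A 1 1 := by
  obtain ⟨δ, hδ, hδthick⟩ := exists_le_dist_of_deviation htf (ε := 1 / 20) (by norm_num)
  obtain ⟨R, hR⟩ := hthick (δ / 2) (by positivity)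
  have hE := hΓ (2 * R + 10)
  obtain ⟨t₁, ht₁, hEt⟩ : ∃ t₁ : ℝ, 2 < t₁ ∧ ∀ A : SL(2, ℝ),
      (QuotientGroup.mk A : PSL(2, ℝ)) ∈ Γ → dist I (A • I) ≤ 2 * R + 10 → 2 < A 0 0 + A 1 1 →
      t₁ ≤ A 0 0 + A 1 1 := by
    set E' := {A : SL(2, ℝ) | ((QuotientGroup.mk A : PSL(2, ℝ)) ∈ Γ ∧
      dist I (A • I) ≤ 2 * R + 10) ∧ 2 < A 0 0 + A 1 1} with hE'
    have hE'fin : E'.Finite := hE.subset fun A hA ↦ hA.1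
    rcases E'.eq_empty_or_nonempty with h0 | h0
    · refine ⟨3, by norm_num, fun A h1 h2 h3 ↦ ?_⟩
      have : A ∈ E' := ⟨⟨h1, h2⟩, h3⟩
      rw [h0] at this
      exact this.elim
    · obtain ⟨A₀, hA₀, hmin⟩ := Set.exists_min_image E' (fun A ↦ A 0 0 + A 1 1) hE'fin h0
      exact ⟨_, hA₀.2, fun A h1 h2 h3 ↦ hmin A ⟨⟨h1, h2⟩, h3⟩⟩
  refine ⟨min t₁ (2 + 1 / 10000), lt_min ht₁ (by norm_num), fun A hA htr ↦ ?_⟩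
  obtain ⟨h, hh01, hh10, hh00⟩ := exists_diagonal_conj htr
  have htrA : A 0 0 + A 1 1 = (h⁻¹ * A * h) 0 0 + ((h⁻¹ * A * h) 0 0)⁻¹ := by
    rw [← trace_conj A h, apply_one_one_of_diagonal hh01]
  by_cases hsmall : 1 / 20 ≤ (h⁻¹ * A * h) 0 0 - ((h⁻¹ * A * h) 0 0)⁻¹
  · rw [htrA]
    exact (min_le_right _ _).trans (two_add_le_add_inv hh00 hsmall)
  push Not at hsmall
  refine (min_le_left _ _).trans ?_
  obtain ⟨X, hX, hX01, hX10, hX00, hXA, hmin⟩ := hΓ.exists_minimal_diagonal hA hh01 hh10 hh00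
  have htrX : X 0 0 + X 1 1 = (h⁻¹ * X * h) 0 0 + ((h⁻¹ * X * h) 0 0)⁻¹ := by
    rw [← trace_conj X h, apply_one_one_of_diagonal hX01]
  obtain ⟨g, hXdev, hkey⟩ := hΓ.exists_deviation_eq hX hX01 hX10 hX00
    ((sub_inv_le_sub_inv (by linarith) hXA).trans hsmall.le) hmin
  -- The point `g i` is thick, so some `κ` in `Γ` brings it within `R` of `i`. As `X` moves `g i` by
  -- at most 10, `κ X κ⁻¹` moves `i` by at most `2 * R + 10` and is one of finitely many elements.
  obtain ⟨⟨κ, hκ⟩, hκR⟩ := hR (g • I) (fun γ hγ ↦ by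
    rw [mul_div_cancel₀ _ (two_ne_zero)]
    exact hδthick g hkey γ hγ)
  obtain ⟨K, rfl⟩ := exists_lift κ
  have hκR' : dist I (K • g • I) ≤ R := hκR
  have hXdist := dist_le_of_deviation_le hXdev.le
  have hfinal := hEt (K * X * K⁻¹) (mul_mem (mul_mem hκ hX) (inv_mem hκ)) (by
    have h1 : dist I (K • X • g • I) ≤ R + 10 :=
      calc dist I (K • X • g • I) ≤ dist I (K • g • I) + dist (K • g • I) (K • X • g • I) :=
            dist_triangle _ _ _
        _ ≤ R + 10 := by rw [dist_smul]; gcongr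
    have h2 : dist (K • X • g • I) ((K * X * K⁻¹) • I) ≤ R := by
      rw [mul_smul, mul_smul, dist_smul, dist_smul, ← dist_smul K, smul_inv_smul, dist_comm]
      exact hκR'
    linarith [dist_triangle I (K • X • g • I) ((K * X * K⁻¹) • I)]) (by
    rw [trace_conj', htrX]
    exact two_lt_add_inv hX00)
  rw [trace_conj', htrX] at hfinal
  rw [htrA]
  exact hfinal.trans (add_inv_le_add_inv hX00 hXA)

end TwistedEisenstein

/-! ## Thick-thin decomposition -/

namespace TwistedEisenstein

open Filter Topology

variable {Γ : Subgroup PSL(2, ℝ)}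

theorem exists_isCuspOf_of_trace_eq_two {C : SL(2, ℝ)}
    (hC : (QuotientGroup.mk C : PSL(2, ℝ)) ∈ Γ) (h1 : C ≠ 1) (htr : C 0 0 + C 1 1 = 2) :
    ∃ 𝔞 : OnePoint ℝ, IsCuspOf 𝔞 Γ ∧ (QuotientGroup.mk C : PSL(2, ℝ)) • 𝔞 = 𝔞 := by
  have hdet := sl_det C
  have hpar : (Matrix.SpecialLinearGroup.toGL C : GL (Fin 2) ℝ).IsParabolic := by
    constructor
    · rintro ⟨r, hr⟩
      have h00 : r = C 0 0 := by simpa using congrFun (congrFun hr 0) 0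
      have h01 : 0 = C 0 1 := by simpa using congrFun (congrFun hr 0) 1
      have h10 : 0 = C 1 0 := by simpa using congrFun (congrFun hr 1) 0
      have h11 : r = C 1 1 := by simpa using congrFun (congrFun hr 1) 1
      have hr1 : r = 1 := by linarith
      refine h1 (sl_ext ?_ ?_ ?_ ?_) <;> simp <;> linarith
    · change Matrix.discr (C : Matrix (Fin 2) (Fin 2) ℝ) = 0
      rw [Matrix.discr_fin_two, Matrix.trace_fin_two, Matrix.SpecialLinearGroup.det_coe, htr]
      norm_num
  have hfix := hpar.smul_eq_self_iff.mpr rfl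
  exact ⟨_, ⟨_, mk_mem_preimageGL hC, hpar, hfix⟩, hfix⟩

theorem dist_pow_smul_le {A : SL(2, ℝ)} (z : ℍ) (n : ℕ) :
    dist z (A ^ n • z) ≤ n * dist z (A • z) := by
  induction n with
  | zero => simp
  | succ n ih =>
    rw [pow_succ, mul_smul]
    calc dist z (A ^ n • A • z) ≤ dist z (A ^ n • z) + dist (A ^ n • z) (A ^ n • A • z) :=
          dist_triangle _ _ _
      _ ≤ n * dist z (A • z) + dist z (A • z) := by rw [dist_smul]; gcongr
      _ = _ := by push_cast; ring

/-- The distance `d` satisfies `cosh d = 1 + k² / (2 y²)`, which is at least `9/8` when `y ≤ 2`,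
whereas `cosh (1/4) < 9/8`. -/
theorem two_lt_im_of_dist_vadd_lt {k : ℤ} (hk : k ≠ 0) {w : ℍ}
    (h : dist w ((k : ℝ) +ᵥ w) < 1 / 4) : 2 < w.im := by
  have hw := w.im_pos
  have h1 : Real.cosh (dist w ((k : ℝ) +ᵥ w)) < 9 / 8 := by
    have h2 : Real.cosh (dist w ((k : ℝ) +ᵥ w)) ≤ Real.cosh (1 / 4) :=
      Real.cosh_le_cosh.mpr (by
        rw [abs_of_nonneg dist_nonneg, abs_of_nonneg (by norm_num)]; exact h.le)
    have h3 := Real.cosh_le_exp_half_sq (1 / 4)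
    have h4 := Real.exp_bound_div_one_sub_of_interval (x := (1 / 4) ^ 2 / 2) (by norm_num)
      (by norm_num)
    norm_num at h4 h3
    linarith
  rw [UpperHalfPlane.cosh_dist, Complex.dist_eq] at h1
  have h5 : ((w : ℂ) - (((k : ℝ) +ᵥ w : ℍ) : ℂ)) = ((-k : ℝ) : ℂ) := by
    simp
  rw [h5, Complex.norm_real, Real.norm_eq_abs, sq_abs, UpperHalfPlane.vadd_im] at h1
  have hk1 : (1 : ℝ) ≤ (-k : ℝ) ^ 2 := by
    have : 1 ≤ k ^ 2 := Int.one_le_ceil_iff.mp (by simpa using (sq_pos_of_ne_zero hk))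
    rw [neg_sq]
    exact_mod_cast this
  by_contra! hle
  have h6 : (1 : ℝ) / 8 ≤ (-k : ℝ) ^ 2 / (2 * w.im * w.im) := by
    rw [div_le_div_iff₀ (by norm_num) (by positivity)]
    nlinarith
  linarith

/-- **Thick-thin decomposition**: a point lies in a cuspidal zone, or else in a compact set modulo
`Γ`. -/
theorem ProperlyDiscontinuous.exists_thick_thin (hΓ : ProperlyDiscontinuous Γ)
    (htf : ∀ γ ∈ Γ, IsOfFinOrder γ → γ = 1) (hthick : ThickPartCompact Γ) :
    ∃ R : ℝ, ∀ z : ℍ, (∃ (𝔞 : OnePoint ℝ) (σ : PSL(2, ℝ)), IsCuspOf 𝔞 Γ ∧ IsScaling Γ 𝔞 σ ∧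
      2 < (σ⁻¹ • z).im) ∨ ∃ γ : Γ, dist I (γ • z) ≤ R := by
  obtain ⟨t₀, ht₀, hgap⟩ := hΓ.exists_two_lt_le_trace htf hthick
  have hW : {B : SL(2, ℝ) | 0 < B 0 0 + B 1 1 ∧ B 0 0 + B 1 1 < t₀} ∈ 𝓝 (1 : SL(2, ℝ)) := by
    have h := (tendsto_sl_iff (u := id) (l := 𝓝 (1 : SL(2, ℝ))) (A := 1)).mp tendsto_id
    have htr : Tendsto (fun B : SL(2, ℝ) ↦ B 0 0 + B 1 1) (𝓝 1) (𝓝 2) := by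
      have := (h 0 0).add (h 1 1)
      convert this using 2
      simp
      norm_num
    filter_upwards [htr.eventually_lt_const ht₀, htr.eventually_const_lt two_pos] with B h1 h2
    exact ⟨h2, h1⟩
  obtain ⟨δ, M, hδ, hpow⟩ := exists_pow_mem_nhds_one hW
  -- The second term keeps the displacement of all powers up to the `M`-th below `1 / 4`.
  set δ' := min δ (1 / (4 * (M + 1))) with hδ'
  have hδ'0 : 0 < δ' := lt_min hδ (by positivity)
  obtain ⟨R, hR⟩ := hthick (δ' / 2) (by positivity)
  refine ⟨R, fun z ↦ ?_⟩
  by_cases hz : ∀ γ : Γ, γ ≠ 1 → 2 * (δ' / 2) ≤ dist z (γ • z)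
  · exact Or.inr (hR z hz)
  left
  push Not at hz
  obtain ⟨⟨γ, hγ⟩, hγ1, hlt⟩ := hz
  rw [mul_div_cancel₀ _ (two_ne_zero)] at hlt
  obtain ⟨A, rfl⟩ := exists_lift γ
  have hA1 : (QuotientGroup.mk A : PSL(2, ℝ)) ≠ 1 := fun h ↦ hγ1 (Subtype.ext h)
  have hltA : dist z (A • z) < δ' := hlt
  obtain ⟨m, hm1, hmM, hm⟩ := hpow (z.toSL2R⁻¹ * A * z.toSL2R) (by
    rw [dist_conj_smul_I, toSL2R_smul_I]
    exact hltA.trans_le (min_le_left _ _))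
  rw [conj_pow'] at hm
  obtain ⟨hm0, hmt⟩ := hm
  rw [trace_conj] at hm0 hmt
  have hC : (QuotientGroup.mk (A ^ m) : PSL(2, ℝ)) ∈ Γ := pow_mem hγ m
  have hC1 : A ^ m ≠ 1 := mk_pow_ne_one htf hγ hA1 hm1
  -- The trace is positive, at least 2 in absolute value, and below the gap for hyperbolic elements.
  have htrC : (A ^ m) 0 0 + (A ^ m) 1 1 = 2 := by
    have h2 := hΓ.two_le_abs_trace htf hC
    rw [Matrix.trace_fin_two, abs_of_pos hm0] at h2
    by_contra hne
    exact absurd hmt (not_lt.mpr (hgap _ hC (lt_of_le_of_ne h2 (Ne.symm hne))))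
  obtain ⟨𝔞, h𝔞, hfix⟩ := exists_isCuspOf_of_trace_eq_two hC hC1 htrC
  obtain ⟨σ, hσ⟩ := hΓ.exists_isScaling h𝔞
  refine ⟨𝔞, σ, h𝔞, hσ, ?_⟩
  obtain ⟨k, hk⟩ := (hσ.2 _).mp ⟨hC, hfix⟩
  have hk0 : k ≠ 0 := by
    rintro rfl
    rw [Int.cast_zero, translation_zero, mul_assoc, inv_mul_eq_one] at hk
    have h3 : (QuotientGroup.mk (A ^ m) : PSL(2, ℝ)) = 1 := by
      have := hk.symm
      rwa [mul_eq_right] at this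
    rcases (mk_eq_mk_iff _ 1).mp h3 with h4 | h4
    · exact hC1 h4
    · rw [h4] at htrC
      norm_num at htrC
  refine two_lt_im_of_dist_vadd_lt hk0 ?_
  rw [← translation_smul, ← hk, ← mul_smul, mul_assoc, mul_inv_cancel, mul_one, mul_smul, dist_smul]
  calc dist z (A ^ m • z) ≤ m * dist z (A • z) := dist_pow_smul_le z m
    _ ≤ M * (1 / (4 * (M + 1))) := by
      gcongr
      exact (hltA.trans_le (min_le_right _ _)).le
    _ < 1 / 4 := by
      rw [mul_one_div, div_lt_div_iff₀ (by positivity) (by norm_num)]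
      linarith

end TwistedEisenstein

/-! ## Horocyclic projections -/

namespace TwistedEisenstein

open Filter Topology

/-! ### Chains of points in the upper half plane -/

/-- The point `x + i y`. -/
noncomputable def point (x y : ℝ) (hy : 0 < y) : ℍ := ⟨⟨x, y⟩, hy⟩

theorem dist_point_two_mul (x y : ℝ) (hy : 0 < y) {y' : ℝ} (h1 : y ≤ y') (h2 : y' ≤ 2 * y) :
    dist (point x y hy) (point x y' (hy.trans_le h1)) ≤ Real.log 2 := by
  have hre : (point x y hy).re = (point x y' (hy.trans_le h1)).re := rfl
  rw [UpperHalfPlane.dist_of_re_eq hre, Real.dist_eq, abs_sub_comm]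
  change |Real.log y' - Real.log y| ≤ _
  rw [abs_of_nonneg (sub_nonneg.mpr (Real.log_le_log hy h1)), sub_le_iff_le_add,
    ← Real.log_mul two_ne_zero hy.ne']
  exact Real.log_le_log (hy.trans_le h1) h2

theorem half_le_log_two : (1 : ℝ) / 2 ≤ Real.log 2 := by
  linarith [Real.log_two_gt_d9]

/-- Every point can be reached from `i` in few steps of length at most `log 2`. -/
theorem exists_chain_from_I (Q : ℕ → ℍ → ℍ → Prop)
    (hstep : ∀ z w, dist z w ≤ Real.log 2 → Q 1 z w)
    (htrans : ∀ m n z w v, Q m z w → Q n w v → Q (m + n) z v) (z : ℍ) :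
    ∃ N : ℕ, Q N I z ∧ (2 : ℝ) ^ N ≤ 256 * ((1 + ‖(z : ℂ)‖ ^ 2) / z.im) ^ 5 := by
  -- Vertical travel by doublings. The count is `n + 1` because the induction starts from a step of
  -- length zero.
  have hvert : ∀ (n : ℕ) (x y : ℝ) (hy : 0 < y),
      Q (n + 1) (point x y hy) (point x (2 ^ n * y) (by positivity)) ∧
      Q (n + 1) (point x (2 ^ n * y) (by positivity)) (point x y hy) := by
    intro n x y hy
    induction n with
    | zero => simp only [zero_add, pow_zero, one_mul]; constructor <;>
        exact hstep _ _ (by rw [dist_self]; exact Real.log_nonneg one_le_two)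
    | succ n ih =>
      have h := dist_point_two_mul x (2 ^ n * y) (by positivity) (y' := 2 ^ (n + 1) * y)
        (by rw [pow_succ]; nlinarith [pow_pos two_pos n (M₀ := ℝ), mul_pos (pow_pos two_pos n) hy])
        (by rw [pow_succ]; linarith)
      refine ⟨htrans _ _ _ _ _ ih.1 (hstep _ _ h), ?_⟩
      rw [add_comm]
      exact htrans _ _ _ _ _ (hstep _ _ (by rw [dist_comm]; exact h)) ih.2
  obtain ⟨x, y, hy, rfl⟩ : ∃ x y hy, z = point x y hy := ⟨z.re, z.im, z.im_pos, rfl⟩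
  set μ := (1 + ‖((point x y hy : ℍ) : ℂ)‖ ^ 2) / (point x y hy).im with hμ
  have hμ' : μ = (1 + x ^ 2 + y ^ 2) / y := by
    rw [hμ, ← Complex.normSq_eq_norm_sq, Complex.normSq_apply]
    change (1 + (x * x + y * y)) / y = _
    ring
  clear_value μ
  have hμy : μ * y = 1 + x ^ 2 + y ^ 2 := by rw [hμ']; field_simp
  have hyμ : y ≤ μ := by
    rw [hμ', le_div_iff₀ hy]; nlinarith [sq_nonneg x]
  have hμ0 : 0 < μ := hy.trans_le hyμ
  have hμy1 : 1 ≤ μ * y := by rw [hμy]; nlinarith [sq_nonneg x, sq_nonneg y]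
  have hμ2 : 1 ≤ μ ^ 2 := by
    rw [sq]
    exact hμy1.trans (by gcongr)
  have hμ1 : 1 ≤ μ := (one_le_sq_iff₀ hμ0.le).mp hμ2
  have hxμ : |x| ≤ μ := by
    refine abs_le_of_sq_le_sq ?_ hμ0.le
    calc x ^ 2 ≤ μ * y := by rw [hμy]; nlinarith [sq_nonneg y]
      _ ≤ μ ^ 2 := by rw [sq]; gcongr
  -- The path climbs from `i` to the height `Y`, crosses to the abscissa `x` in one step, and
  -- descends to `z`. The exponent `k` ensures `Y ≥ 2 * μ ≥ 2 * |x|`, so that the crossing has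
  -- length at most `1 / 2`.
  obtain ⟨k, hk1, hk2⟩ := exists_nat_pow_near (x := 2 * μ ^ 2) (y := (2 : ℝ)) (by linarith)
    one_lt_two
  set Y := 2 ^ (k + 1) * y with hY
  have hY0 : 0 < Y := by positivity
  have hY1 : 2 * μ ≤ Y := by
    calc 2 * μ ≤ 2 * μ * (μ * y) := le_mul_of_one_le_right (by positivity) hμy1
      _ = 2 * μ ^ 2 * y := by ring
      _ ≤ Y := by rw [hY]; gcongr
  have hY2 : Y ≤ 4 * μ ^ 3 := by
    calc Y = 2 * 2 ^ k * y := by rw [hY, pow_succ]; ring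
      _ ≤ 2 * (2 * μ ^ 2) * μ := by gcongr
      _ = 4 * μ ^ 3 := by ring
  obtain ⟨m, hm1, hm2⟩ := exists_nat_pow_near (x := Y) (y := (2 : ℝ)) (by linarith) one_lt_two
  have hI : I = point 0 1 one_pos := by
    ext
    simp [point, Complex.ext_iff]
  have q1 := (hvert m 0 1 one_pos).1
  rw [← hI] at q1
  have q2 := hstep _ _ (dist_point_two_mul 0 (2 ^ m * 1) (by positivity) (y' := Y)
    (by linarith) (by rw [pow_succ] at hm2; linarith))
  have q3 := hstep (point 0 Y hY0) (point x Y hY0) (by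
    refine (UpperHalfPlane.dist_le_dist_coe_div_sqrt _ _).trans ?_
    have h1 : dist ((point 0 Y hY0 : ℍ) : ℂ) (point x Y hY0) = |x| := by
      have him : ((point 0 Y hY0 : ℍ) : ℂ).im = ((point x Y hY0 : ℍ) : ℂ).im := rfl
      rw [Complex.dist_of_im_eq him, Real.dist_eq]
      change |0 - x| = _
      rw [zero_sub, abs_neg]
    have h2 : √((point 0 Y hY0).im * (point x Y hY0).im) = Y := Real.sqrt_mul_self hY0.le
    rw [h1, h2]
    refine le_trans ?_ half_le_log_two
    rw [div_le_div_iff₀ hY0 two_pos]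
    linarith)
  have q4 := (hvert (k + 1) x y hy).2
  refine ⟨_, htrans _ _ _ _ _ (htrans _ _ _ _ _ (htrans _ _ _ _ _ q1 q2) q3) q4, ?_⟩
  calc (2 : ℝ) ^ (m + 1 + 1 + 1 + (k + 1 + 1)) = 32 * 2 ^ m * 2 ^ k := by ring
    _ ≤ 32 * (4 * μ ^ 3) * (2 * μ ^ 2) := by gcongr; exact hm1.trans hY2
    _ = 256 * μ ^ 5 := by ring

/-! ### Projection to the complement of the cuspidal zones -/

variable {Γ : Subgroup PSL(2, ℝ)}

/-- The projection of a point of the upper half plane to the horocycle of height two. -/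
noncomputable def lower (w : ℍ) : ℍ := point w.re 2 two_pos

theorem lower_vadd (t : ℝ) (w : ℍ) : lower (t +ᵥ w) = t +ᵥ lower w := by
  ext
  rw [UpperHalfPlane.coe_vadd]
  simp [lower, point, Complex.ext_iff]

/-- `p` is a projection of `z` to the complement of the cuspidal zones of height two. -/
def IsThickProjection (Γ : Subgroup PSL(2, ℝ)) (z p : ℍ) : Prop :=
  (p = z ∧ ∀ 𝔞 σ, IsCuspOf 𝔞 Γ → IsScaling Γ 𝔞 σ → (σ⁻¹ • z).im ≤ 2) ∨
    ∃ 𝔞 σ, IsCuspOf 𝔞 Γ ∧ IsScaling Γ 𝔞 σ ∧ 2 < (σ⁻¹ • z).im ∧ p = σ • lower (σ⁻¹ • z)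

/-- A lowered point has height two at its own cusp, hence height at most `1 / 2` at every other one.
-/
theorem exists_isThickProjection (hΓ : ProperlyDiscontinuous Γ) (z : ℍ) :
    ∃ p, IsThickProjection Γ z p ∧
      ∀ 𝔞 σ, IsCuspOf 𝔞 Γ → IsScaling Γ 𝔞 σ → (σ⁻¹ • p).im ≤ 2 := by
  by_cases h : ∀ 𝔞 σ, IsCuspOf 𝔞 Γ → IsScaling Γ 𝔞 σ → (σ⁻¹ • z).im ≤ 2
  · exact ⟨z, Or.inl ⟨rfl, h⟩, h⟩
  push Not at h
  obtain ⟨𝔞, σ, h𝔞, hσ, hz⟩ := h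
  refine ⟨_, Or.inr ⟨𝔞, σ, h𝔞, hσ, hz, rfl⟩, fun 𝔟 τ h𝔟 hτ ↦ ?_⟩
  have him : (σ⁻¹ • σ • lower (σ⁻¹ • z)).im = 2 := by
    rw [inv_smul_smul]
    rfl
  by_cases hab : 𝔞 = 𝔟
  · subst hab
    rw [hσ.im_inv_smul_eq hτ, him]
  · have := hσ.im_mul_im_le_one hΓ hτ hab (σ • lower (σ⁻¹ • z))
    rw [him] at this
    linarith

/-- Since `IsThickProjection` is a relation, with no choice of cusp or scaling element, it is
equivariant under `Γ`. -/
theorem IsThickProjection.smul {z p : ℍ} (h : IsThickProjection Γ z p) {γ : PSL(2, ℝ)}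
    (hγ : γ ∈ Γ) : IsThickProjection Γ (γ • z) (γ • p) := by
  rcases h with ⟨rfl, h⟩ | ⟨𝔞, σ, h𝔞, hσ, hz, rfl⟩
  · refine Or.inl ⟨rfl, fun 𝔞 σ h𝔞 hσ ↦ ?_⟩
    have := h _ _ (h𝔞.smul (inv_mem hγ)) (hσ.smul (inv_mem hγ))
    rwa [_root_.mul_inv_rev, inv_inv, mul_smul] at this
  · have heq : (γ * σ)⁻¹ • γ • z = σ⁻¹ • z := by
      rw [← mul_smul]
      congr 1
      group
    exact Or.inr ⟨_, _, h𝔞.smul hγ, hσ.smul hγ, by rwa [heq], by rw [heq, mul_smul]⟩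

theorem im_le_of_dist_le_log_two {z w : ℍ} (h : dist z w ≤ Real.log 2) : z.im ≤ 2 * w.im := by
  have h1 := UpperHalfPlane.im_le_im_mul_exp_dist z w
  have h2 : Real.exp (dist z w) ≤ 2 := by
    rw [← Real.le_log_iff_exp_le two_pos]
    exact h
  nlinarith [w.im_pos]

theorem dist_lower_le {w : ℍ} (h1 : 2 ≤ w.im) (h2 : w.im ≤ 4) : dist w (lower w) ≤ Real.log 2 := by
  rw [dist_comm]
  exact dist_point_two_mul w.re 2 two_pos h1 (by linarith)

/-- Projections of close points are close, up to elements fixing a cusp. -/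
theorem IsThickProjection.exists_dist_le (hΓ : ProperlyDiscontinuous Γ)
    (hcusp : ∃ 𝔞 : OnePoint ℝ, IsCuspOf 𝔞 Γ) {z z' p p' : ℍ}
    (hp : IsThickProjection Γ z p) (hp' : IsThickProjection Γ z' p')
    (h : dist z z' ≤ Real.log 2) :
    ∃ τ : Γ, (∃ 𝔞, IsCuspOf 𝔞 Γ ∧ τ ∈ cuspStabilizer Γ 𝔞) ∧ dist p (τ • p') ≤ 2 := by
  have hlog : 2 * Real.log 2 ≤ 2 := by linarith [Real.log_two_lt_d9]
  obtain ⟨𝔠, h𝔠⟩ := hcusp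
  have hsm : ∀ (σ : PSL(2, ℝ)) (a b : ℍ), dist a b ≤ Real.log 2 →
      dist (σ⁻¹ • a) (σ⁻¹ • b) ≤ Real.log 2 := fun σ a b h ↦ by rwa [dist_smul]
  have hlow : ∀ (σ : PSL(2, ℝ)) (a : ℍ), 2 < (σ⁻¹ • a).im → (σ⁻¹ • a).im ≤ 4 →
      dist a (σ • lower (σ⁻¹ • a)) ≤ Real.log 2 := fun σ a h1 h2 ↦ by
    rw [← dist_smul σ⁻¹, inv_smul_smul]
    exact dist_lower_le h1.le h2
  rcases hp with ⟨rfl, hz⟩ | ⟨𝔞, σ, h𝔞, hσ, hz, rfl⟩ <;>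
    rcases hp' with ⟨rfl, hz'⟩ | ⟨𝔟, τ, h𝔟, hτ, hz', rfl⟩
  · refine ⟨1, ⟨𝔠, h𝔠, one_mem _⟩, ?_⟩
    rw [one_smul]
    linarith [Real.log_nonneg one_le_two]
  · refine ⟨1, ⟨𝔠, h𝔠, one_mem _⟩, ?_⟩
    rw [one_smul]
    -- The unprojected point has height at most 2 at the cusp, so its neighbour has height at most 4
    -- and is lowered by at most `log 2`.
    have h1 := hz _ _ h𝔟 hτ
    have h2 := im_le_of_dist_le_log_two (hsm τ _ _ (by rwa [dist_comm] at h))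
    have h3 := hlow τ z' hz' (by linarith)
    linarith [dist_triangle p z' (τ • lower (τ⁻¹ • z'))]
  · refine ⟨1, ⟨𝔠, h𝔠, one_mem _⟩, ?_⟩
    rw [one_smul]
    have h1 := hz' _ _ h𝔞 hσ
    have h2 := im_le_of_dist_le_log_two (hsm σ _ _ h)
    have h3 := hlow σ z hz (by linarith)
    rw [dist_comm] at h3
    linarith [dist_triangle (σ • lower (σ⁻¹ • z)) z p']
  -- For distinct cusps `z` would have height above 2 at one and above 1 at the other.
  · have hab : 𝔞 = 𝔟 := by
      by_contra hne
      have h1 := hσ.im_mul_im_le_one hΓ hτ hne z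
      have h2 := im_le_of_dist_le_log_two (hsm τ _ _ (by rwa [dist_comm] at h))
      nlinarith
    subst hab
    obtain ⟨t, rfl⟩ := hσ.eq_mul_translation hτ
    set w := σ⁻¹ • z
    have hw' : (σ * translation t) • lower ((σ * translation t)⁻¹ • z') =
        σ • lower (σ⁻¹ • z') := by
      rw [_root_.mul_inv_rev, mul_smul, mul_smul _ _ z', ← translation_neg, translation_smul,
        translation_smul, lower_vadd, vadd_vadd, add_neg_cancel, zero_vadd]
    rw [hw']
    set w' := σ⁻¹ • z'
    -- The two lowered points lie on one horocycle, possibly far apart; the parabolic element with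
    -- shift `k` brings them to horizontal distance at most `1 / 2`.
    set k := round (w.re - w'.re) with hk
    have hτk := hσ.conj_translation_mem k
    refine ⟨⟨_, hτk.1⟩, ⟨𝔞, h𝔞, hτk.2⟩, ?_⟩
    have h4 : (⟨_, hτk.1⟩ : Γ) • σ • lower w' = σ • ((k : ℝ) +ᵥ lower w') := by
      change (σ * translation k * σ⁻¹) • σ • lower w' = _
      rw [mul_smul, inv_smul_smul, mul_smul, translation_smul]
    rw [h4, dist_smul, ← lower_vadd]
    refine (UpperHalfPlane.dist_le_dist_coe_div_sqrt _ _).trans ?_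
    have h5 : √((lower w).im * (lower ((k : ℝ) +ᵥ w')).im) = 2 := Real.sqrt_mul_self two_pos.le
    have h6 : dist ((lower w : ℍ) : ℂ) (lower ((k : ℝ) +ᵥ w')) = |w.re - w'.re - k| := by
      have him : ((lower w : ℍ) : ℂ).im = ((lower ((k : ℝ) +ᵥ w') : ℍ) : ℂ).im := rfl
      rw [Complex.dist_of_im_eq him, Real.dist_eq]
      change |w.re - ((k : ℝ) +ᵥ w').re| = _
      rw [UpperHalfPlane.vadd_re]
      congr 1
      ring
    rw [h5, h6]
    linarith [abs_sub_round (w.re - w'.re)]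

end TwistedEisenstein

/-! ## Growth of representations unitary at the cusps -/

namespace TwistedEisenstein

open Filter Topology

variable {Γ : Subgroup PSL(2, ℝ)} {V : Type*} [NormedAddCommGroup V] [InnerProductSpace ℂ V]

theorem norm_map_mul_le (χ : Γ →* (V →L[ℂ] V)ˣ) (γ δ : Γ) :
    ‖(χ (γ * δ) : V →L[ℂ] V)‖ ≤ ‖(χ γ : V →L[ℂ] V)‖ * ‖(χ δ : V →L[ℂ] V)‖ := by
  rw [map_mul, Units.val_mul]
  exact norm_mul_le _ _

theorem UnitaryAtCusps.norm_le_one {χ : Γ →* (V →L[ℂ] V)ˣ} (hχ : UnitaryAtCusps χ)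
    {𝔞 : OnePoint ℝ} (h𝔞 : IsCuspOf 𝔞 Γ) {τ : Γ} (hτ : τ ∈ cuspStabilizer Γ 𝔞) :
    ‖(χ τ : V →L[ℂ] V)‖ ≤ 1 := by
  refine ContinuousLinearMap.opNorm_le_bound _ zero_le_one fun v ↦ ?_
  have h := hχ 𝔞 h𝔞 τ hτ v v
  rw [inner_self_eq_norm_sq_to_K, inner_self_eq_norm_sq_to_K] at h
  have h2 : ‖(χ τ : V →L[ℂ] V) v‖ ^ 2 = ‖v‖ ^ 2 := by exact_mod_cast h
  rw [one_mul]
  exact (pow_le_pow_iff_left₀ (norm_nonneg _) (norm_nonneg _) two_ne_zero).mp h2.le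

/-- Left multiplication by elements fixing a cusp does not change the norm. -/
theorem UnitaryAtCusps.norm_mul_eq {χ : Γ →* (V →L[ℂ] V)ˣ} (hχ : UnitaryAtCusps χ)
    {𝔞 : OnePoint ℝ} (h𝔞 : IsCuspOf 𝔞 Γ) {τ : Γ} (hτ : τ ∈ cuspStabilizer Γ 𝔞) (γ : Γ) :
    ‖(χ (τ * γ) : V →L[ℂ] V)‖ = ‖(χ γ : V →L[ℂ] V)‖ := by
  have key : ∀ τ ∈ cuspStabilizer Γ 𝔞, ∀ γ : Γ,
      ‖(χ (τ * γ) : V →L[ℂ] V)‖ ≤ ‖(χ γ : V →L[ℂ] V)‖ := fun τ hτ γ ↦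
    (norm_map_mul_le χ τ γ).trans
      (mul_le_of_le_one_left (norm_nonneg _) (hχ.norm_le_one h𝔞 hτ))
  refine le_antisymm (key τ hτ γ) ?_
  have := key τ⁻¹ (inv_mem hτ) (τ * γ)
  rwa [inv_mul_cancel_left] at this

theorem UnitaryAtCusps.norm_mul_eq' {χ : Γ →* (V →L[ℂ] V)ˣ} (hχ : UnitaryAtCusps χ)
    {𝔞 : OnePoint ℝ} (h𝔞 : IsCuspOf 𝔞 Γ) {τ : Γ} (hτ : τ ∈ cuspStabilizer Γ 𝔞) (γ : Γ) :
    ‖(χ (γ * τ) : V →L[ℂ] V)‖ = ‖(χ γ : V →L[ℂ] V)‖ := by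
  have key : ∀ τ ∈ cuspStabilizer Γ 𝔞, ∀ γ : Γ,
      ‖(χ (γ * τ) : V →L[ℂ] V)‖ ≤ ‖(χ γ : V →L[ℂ] V)‖ := fun τ hτ γ ↦
    (norm_map_mul_le χ γ τ).trans
      (mul_le_of_le_one_right (norm_nonneg _) (hχ.norm_le_one h𝔞 hτ))
  refine le_antisymm (key τ hτ γ) ?_
  have := key τ⁻¹ (inv_mem hτ) (γ * τ)
  rwa [mul_inv_cancel_right] at this

/-- A representation which is unitary at the cusps has polynomial growth. -/
theorem UnitaryAtCusps.exists_norm_le_frobeniusSq_rpow (hΓ : ProperlyDiscontinuous Γ)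
    (htf : ∀ γ ∈ Γ, IsOfFinOrder γ → γ = 1) (hthick : ThickPartCompact Γ)
    (hcusp : ∃ 𝔞 : OnePoint ℝ, IsCuspOf 𝔞 Γ) {χ : Γ →* (V →L[ℂ] V)ˣ} (hχ : UnitaryAtCusps χ) :
    ∃ β C : ℝ, 0 < β ∧ 0 < C ∧ ∀ γ : Γ,
      ‖(χ γ : V →L[ℂ] V)‖ ≤ C * frobeniusSq (γ : PSL(2, ℝ)) ^ β := by
  obtain ⟨R, hR⟩ := hΓ.exists_thick_thin htf hthick
  have hred : ∀ z, ∃ (κ : Γ) (p : ℍ), IsThickProjection Γ z p ∧ dist I (κ⁻¹ • p) ≤ R := by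
    intro z
    obtain ⟨p, hp, hp2⟩ := exists_isThickProjection hΓ z
    rcases hR p with ⟨𝔞, σ, h𝔞, hσ, h2⟩ | ⟨γ, hγ⟩
    · exact absurd (hp2 𝔞 σ h𝔞 hσ) (not_le.mpr h2)
    · exact ⟨γ⁻¹, p, hp, by rwa [inv_inv]⟩
  obtain ⟨M, hM2, hM⟩ : ∃ M : ℝ, 2 ≤ M ∧ ∀ γ : Γ, dist I (γ • I) ≤ R + 2 + R →
      ‖(χ γ : V →L[ℂ] V)‖ ≤ M := by
    obtain ⟨M, hM⟩ := ((hΓ.finite_psl I I (R + 2 + R)).image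
      fun γ ↦ ‖(χ γ : V →L[ℂ] V)‖).bddAbove
    exact ⟨max 2 M, le_max_left _ _, fun γ hγ ↦ (hM ⟨γ, hγ, rfl⟩).trans (le_max_right _ _)⟩
  -- The bound is required for all projections and all reducing elements, so that steps can be
  -- composed through any intermediate choice.
  set Q : ℕ → ℍ → ℍ → Prop := fun n z w ↦ ∀ (κ κ' : Γ) (p p' : ℍ), IsThickProjection Γ z p →
    IsThickProjection Γ w p' → dist I (κ⁻¹ • p) ≤ R → dist I (κ'⁻¹ • p') ≤ R →
    ‖(χ (κ⁻¹ * κ') : V →L[ℂ] V)‖ ≤ M ^ n with hQ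
  have hstep : ∀ z w, dist z w ≤ Real.log 2 → Q 1 z w := by
    intro z w hzw κ κ' p p' hp hp' hκ hκ'
    obtain ⟨τ, ⟨𝔞, h𝔞, hτ⟩, hdist⟩ := hp.exists_dist_le hΓ hcusp hp' hzw
    -- The first factor fixes the cusp `κ⁻¹ 𝔞` and acts unitarily; the second moves `i` by at most
    -- `R + 2 + R`.
    have h1 : κ⁻¹ * κ' = (κ⁻¹ * τ⁻¹ * κ) * (κ⁻¹ * τ * κ') := by group
    have h2 : κ⁻¹ * τ⁻¹ * κ ∈ cuspStabilizer Γ (κ⁻¹ • 𝔞) := by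
      rw [MulAction.mem_stabilizer_iff, mul_smul, mul_smul, smul_inv_smul,
        inv_smul_eq_iff.mpr (MulAction.mem_stabilizer_iff.mp hτ).symm]
    have h3 : IsCuspOf (κ⁻¹ • 𝔞) Γ := h𝔞.smul (γ := ((κ⁻¹ : Γ) : PSL(2, ℝ))) (κ⁻¹).2
    rw [h1, hχ.norm_mul_eq h3 h2, pow_one]
    refine hM _ ?_
    calc dist I ((κ⁻¹ * τ * κ') • I) ≤ dist I (κ⁻¹ • p) + dist (κ⁻¹ • p) (κ⁻¹ • τ • p') +
          dist (κ⁻¹ • τ • p') ((κ⁻¹ * τ * κ') • I) := dist_triangle4 _ _ _ _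
      _ ≤ R + 2 + R := by
        rw [dist_smul, mul_smul, mul_smul, dist_smul, dist_smul, ← dist_smul κ'⁻¹ p', inv_smul_smul,
          dist_comm _ I]
        gcongr
  have htrans : ∀ m n z w v, Q m z w → Q n w v → Q (m + n) z v := by
    intro m n z w v h1 h2 κ κ' p p' hp hp' hκ hκ'
    obtain ⟨κ₁, p₁, hp₁, hκ₁⟩ := hred w
    have h3 : κ⁻¹ * κ' = (κ⁻¹ * κ₁) * (κ₁⁻¹ * κ') := by group
    rw [h3, pow_add]
    refine (norm_map_mul_le χ _ _).trans ?_
    exact mul_le_mul (h1 κ κ₁ p p₁ hp hp₁ hκ hκ₁) (h2 κ₁ κ' p₁ p' hp₁ hp' hκ₁ hκ')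
      (norm_nonneg _) (by positivity)
  obtain ⟨κ, p, hp, hκ⟩ := hred I
  set b := Real.logb 2 M with hb
  have hM0 : 0 < M := by linarith
  have hMb : M = 2 ^ b := (Real.rpow_logb two_pos (by norm_num) hM0).symm
  have hb0 : 0 < b := Real.logb_pos one_lt_two (by linarith)
  set K := (‖(χ κ : V →L[ℂ] V)‖ + 1) * (‖(χ κ⁻¹ : V →L[ℂ] V)‖ + 1) with hK
  have hK0 : 0 < K := by positivity
  refine ⟨5 * b, K * 256 ^ b, by positivity, by positivity, fun γ ↦ ?_⟩
  obtain ⟨N, hN, hN2⟩ := exists_chain_from_I Q hstep htrans ((γ : PSL(2, ℝ)) • I)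
  rw [← two_mul_cosh_dist_I, two_mul_cosh_dist] at hN2
  have h0 : 0 ≤ frobeniusSq (γ : PSL(2, ℝ)) := by
    rw [← two_mul_cosh_dist]
    positivity
  -- By equivariance `γ p` is a projection of `γ i`, reduced by `γ κ`; thus the chain bounds `χ` at
  -- `κ⁻¹ γ κ`.
  have h1 := hN κ (γ * κ) p ((γ : PSL(2, ℝ)) • p) hp (hp.smul γ.2) hκ (by
    have : (γ * κ)⁻¹ • (γ : PSL(2, ℝ)) • p = κ⁻¹ • p := by
      change (γ * κ)⁻¹ • γ • p = κ⁻¹ • p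
      rw [← mul_smul]
      congr 1
      group
    rwa [this])
  have h2 : γ = κ * (κ⁻¹ * (γ * κ)) * κ⁻¹ := by group
  have h3 : ‖(χ γ : V →L[ℂ] V)‖ ≤ ‖(χ κ : V →L[ℂ] V)‖ * M ^ N * ‖(χ κ⁻¹ : V →L[ℂ] V)‖ := by
    conv_lhs => rw [h2]
    refine (norm_map_mul_le χ _ _).trans ?_
    gcongr
    refine (norm_map_mul_le χ _ _).trans ?_
    gcongr
  have h4 : M ^ N ≤ 256 ^ b * frobeniusSq (γ : PSL(2, ℝ)) ^ (5 * b) := by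
    calc M ^ N = ((2 : ℝ) ^ N) ^ b := by
          rw [hMb, ← Real.rpow_natCast, ← Real.rpow_mul two_pos.le, ← Real.rpow_natCast,
            ← Real.rpow_mul two_pos.le, mul_comm]
      _ ≤ (256 * frobeniusSq (γ : PSL(2, ℝ)) ^ 5) ^ b := by gcongr
      _ = 256 ^ b * frobeniusSq (γ : PSL(2, ℝ)) ^ (5 * b) := by
        rw [Real.mul_rpow (by norm_num) (by positivity), ← Real.rpow_natCast _ 5,
          ← Real.rpow_mul h0]
        norm_num
  calc ‖(χ γ : V →L[ℂ] V)‖ ≤ ‖(χ κ : V →L[ℂ] V)‖ * M ^ N * ‖(χ κ⁻¹ : V →L[ℂ] V)‖ := h3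
    _ = ‖(χ κ : V →L[ℂ] V)‖ * ‖(χ κ⁻¹ : V →L[ℂ] V)‖ * M ^ N := by ring
    _ ≤ K * (256 ^ b * frobeniusSq (γ : PSL(2, ℝ)) ^ (5 * b)) := by
      rw [hK]
      gcongr <;> linarith
    _ = _ := by ring

/-! ### Comparison of `μ` with the point-pair invariant -/

theorem cosh_add_le (a : ℝ) {b : ℝ} (hb : 0 ≤ b) :
    Real.cosh (a + b) ≤ 2 * (Real.cosh a * Real.cosh b) := by
  rw [Real.cosh_add, two_mul]
  have h1 := (Real.sinh_lt_cosh a).le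
  have h2 := (Real.sinh_lt_cosh b).le
  have h3 := Real.sinh_nonneg_iff.mpr hb
  have h4 := Real.cosh_pos a
  gcongr

theorem frobeniusSq_nonneg (g : PSL(2, ℝ)) : 0 ≤ frobeniusSq g := by
  rw [← two_mul_cosh_dist]
  positivity

theorem pointPair_nonneg (z w : ℍ) : 0 ≤ pointPair z w := by
  have := z.im_pos
  have := w.im_pos
  unfold pointPair
  positivity

/-- The triangle inequality for `i, z, g w, g i`, exponentiated through `cosh (a + b) ≤ 2 cosh a
cosh b`. -/
theorem frobeniusSq_le_pointPair (g : PSL(2, ℝ)) (z w : ℍ) :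
    frobeniusSq g ≤ 8 * (Real.cosh (dist I z) * Real.cosh (dist w I)) *
      (pointPair z (g • w) + 1) := by
  have h1 : dist I (g • I) ≤ dist I z + (dist z (g • w) + dist w I) := by
    have := dist_triangle4 I z (g • w) (g • I)
    rw [dist_smul] at this
    linarith
  have h2 : Real.cosh (dist I (g • I)) ≤ Real.cosh (dist I z + (dist z (g • w) + dist w I)) :=
    Real.cosh_le_cosh.mpr (by
      rw [abs_of_nonneg dist_nonneg, abs_of_nonneg (by positivity)]
      exact h1)
  have h3 := cosh_add_le (dist I z) (b := dist z (g • w) + dist w I) (by positivity)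
  have h4 := cosh_add_le (dist z (g • w)) (b := dist w I) dist_nonneg
  have h5 : Real.cosh (dist z (g • w)) ≤ pointPair z (g • w) + 1 := by
    rw [cosh_dist_eq_pointPair]
    linarith [pointPair_nonneg z (g • w)]
  have h6 := Real.cosh_pos (dist I z)
  have h7 := Real.cosh_pos (dist w I)
  rw [← two_mul_cosh_dist]
  calc 2 * Real.cosh (dist I (g • I))
      ≤ 2 * (2 * (Real.cosh (dist I z) * Real.cosh (dist z (g • w) + dist w I))) := by linarith
    _ ≤ 2 * (2 * (Real.cosh (dist I z) *
        (2 * ((pointPair z (g • w) + 1) * Real.cosh (dist w I))))) := by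
      gcongr
      refine h4.trans ?_
      gcongr
    _ = _ := by ring

theorem UnitaryAtCusps.exists_isGrowthExponent (hΓ : ProperlyDiscontinuous Γ)
    (htf : ∀ γ ∈ Γ, IsOfFinOrder γ → γ = 1) (hthick : ThickPartCompact Γ)
    (hcusp : ∃ 𝔞 : OnePoint ℝ, IsCuspOf 𝔞 Γ) {χ : Γ →* (V →L[ℂ] V)ˣ} (hχ : UnitaryAtCusps χ) :
    ∃ σ₀ : ℝ, IsGrowthExponent χ σ₀ := by
  obtain ⟨β, C, hβ, hC, h⟩ := hχ.exists_norm_le_frobeniusSq_rpow hΓ htf hthick hcusp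
  refine ⟨β + 1, by linarith, ⟨C, hC, ?_⟩,
    fun p ↦ C * (8 * (Real.cosh (dist I p.1) * Real.cosh (dist p.2 I))) ^ β, ?_, ?_, ?_⟩
  · rwa [add_sub_cancel_right]
  · have h1 : Continuous fun p : ℍ × ℍ ↦
        8 * (Real.cosh (dist I p.1) * Real.cosh (dist p.2 I)) := by
      have := Real.continuous_cosh
      fun_prop
    exact continuous_const.mul (h1.rpow_const fun p ↦ Or.inr hβ.le)
  · intro p
    have := Real.cosh_pos (dist I p.1)
    have := Real.cosh_pos (dist p.2 I)
    positivity
  · intro z w γ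
    have h1 := Real.cosh_pos (dist I z)
    have h2 := Real.cosh_pos (dist w I)
    have h3 := pointPair_nonneg z ((γ : PSL(2, ℝ)) • w)
    rw [add_sub_cancel_right]
    refine (h γ).trans ?_
    rw [mul_assoc, ← Real.mul_rpow (by positivity) (by positivity)]
    have h4 := frobeniusSq_nonneg (γ : PSL(2, ℝ))
    gcongr
    exact frobeniusSq_le_pointPair _ z w

end TwistedEisenstein

/-! ## Bounds in terms of the imaginary part -/

namespace TwistedEisenstein

open Filter Topology

variable {Γ : Subgroup PSL(2, ℝ)} {V : Type*} [NormedAddCommGroup V] [InnerProductSpace ℂ V]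
  {𝔞 : OnePoint ℝ} {σ : PSL(2, ℝ)}

theorem frobeniusSq_inv (g : PSL(2, ℝ)) : frobeniusSq g⁻¹ = frobeniusSq g := by
  rw [← two_mul_cosh_dist, ← two_mul_cosh_dist, ← dist_smul g, smul_inv_smul, dist_comm]

theorem frobeniusSq_conj_le (σ g : PSL(2, ℝ)) :
    frobeniusSq (σ * g * σ⁻¹) ≤ 8 * (Real.cosh (dist I (σ • I)) * Real.cosh (dist (σ • I) I)) *
      frobeniusSq g := by
  have h1 := frobeniusSq_le_pointPair (σ * g * σ⁻¹) (σ • I) (σ • I)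
  refine h1.trans ?_
  have h2 : pointPair (σ • I) ((σ * g * σ⁻¹) • σ • I) + 1 ≤ frobeniusSq g := by
    have h3 := cosh_dist_eq_pointPair (σ • I) ((σ * g * σ⁻¹) • σ • I)
    rw [mul_smul, inv_smul_smul, mul_smul, dist_smul] at h3
    rw [← two_mul_cosh_dist, mul_smul, inv_smul_smul, mul_smul, h3]
    linarith
  have := Real.cosh_pos (dist I (σ • I))
  have := Real.cosh_pos (dist (σ • I) I)
  gcongr

theorem IsScaling.exists_eq_translation (hσ : IsScaling Γ 𝔞 σ) {γ : Γ}
    (hγ : γ ∈ cuspStabilizer Γ 𝔞) : ∃ k : ℤ, σ⁻¹ * γ * σ = translation k :=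
  (hσ.2 γ).mp ⟨γ.2, hγ⟩

/-- The element `σ (1 k; 0 1) σ⁻¹` of `Γ`. -/
noncomputable def IsScaling.shift (hσ : IsScaling Γ 𝔞 σ) (k : ℤ) : Γ :=
  ⟨σ * translation k * σ⁻¹, (hσ.conj_translation_mem k).1⟩

theorem IsScaling.shift_mem (hσ : IsScaling Γ 𝔞 σ) (k : ℤ) :
    hσ.shift k ∈ cuspStabilizer Γ 𝔞 := (hσ.conj_translation_mem k).2

theorem IsScaling.inv_smul_shift_mul_smul (hσ : IsScaling Γ 𝔞 σ) (k : ℤ) (γ : Γ) (z : ℍ) :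
    σ⁻¹ • ((hσ.shift k * γ : Γ) : PSL(2, ℝ)) • z =
      (k : ℝ) +ᵥ (σ⁻¹ • (γ : PSL(2, ℝ)) • z) := by
  rw [← translation_smul]
  simp only [IsScaling.shift, Subgroup.coe_mul, ← mul_smul]
  congr 1
  group

/-- Elements of `Γ` not fixing the cusp have lower left entry at least one, in the coordinates
given by a scaling element. -/
theorem IsScaling.one_le_abs_of_notMem (hΓ : ProperlyDiscontinuous Γ) (hσ : IsScaling Γ 𝔞 σ)
    {γ : Γ} (hγ : γ ∉ cuspStabilizer Γ 𝔞) {B : SL(2, ℝ)}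
    (hB : (QuotientGroup.mk B : PSL(2, ℝ)) = σ⁻¹ * γ * σ) : 1 ≤ |B 1 0| := by
  by_contra! hlt
  have hmem : (QuotientGroup.mk B : PSL(2, ℝ)) ∈ Γ.comap (MulAut.conj σ).toMonoidHom := by
    rw [mem_comap_conj, hB]
    have : σ * (σ⁻¹ * γ * σ) * σ⁻¹ = γ := by group
    rw [this]
    exact γ.2
  have h0 := (hΓ.comap_conj σ).shimizu hσ.translation_one_mem hmem hlt
  rw [← mk_smul_infty_iff, hB, mul_smul, mul_smul, hσ.1, inv_smul_eq_iff, hσ.1] at h0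
  exact hγ h0

/-- The heights of the points of an orbit are bounded. -/
theorem IsScaling.im_smul_le (hΓ : ProperlyDiscontinuous Γ) (hσ : IsScaling Γ 𝔞 σ) (z : ℍ)
    (γ : Γ) : (σ⁻¹ • (γ : PSL(2, ℝ)) • z).im ≤ (σ⁻¹ • z).im + ((σ⁻¹ • z).im)⁻¹ := by
  set w := σ⁻¹ • z with hw
  have hw0 := w.im_pos
  have hgw : σ⁻¹ • (γ : PSL(2, ℝ)) • z = (σ⁻¹ * γ * σ) • w := by
    rw [hw, ← mul_smul, ← mul_smul]
    congr 1
    group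
  rw [hgw]
  by_cases hγ : γ ∈ cuspStabilizer Γ 𝔞
  · obtain ⟨k, hk⟩ := hσ.exists_eq_translation hγ
    rw [hk, im_translation_smul]
    linarith [inv_pos.mpr hw0]
  · obtain ⟨B, hB⟩ := exists_lift (σ⁻¹ * γ * σ)
    have h1 := hσ.one_le_abs_of_notMem hΓ hγ hB
    rw [← hB, mk_smul_upperHalfPlane, im_sl_smul]
    have h2 : 1 ≤ B 1 0 ^ 2 := by
      rw [← sq_abs]
      exact one_le_pow₀ h1
    have h3 : w.im / ((B 1 0 * w.re + B 1 1) ^ 2 + (B 1 0 * w.im) ^ 2) ≤ w.im / w.im ^ 2 := by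
      gcongr
      nlinarith [sq_nonneg (B 1 0 * w.re + B 1 1), mul_le_mul_of_nonneg_right h2 (sq_nonneg w.im)]
    have h4 : w.im / w.im ^ 2 = w.im⁻¹ := by field_simp
    linarith

/-- `Im(B i) = 1 / (c² + d²)`, and heights at two points differ at most by the factor `exp d(z, i) ≤
2 cosh d(z, i)`. -/
theorem im_le_im_smul_I_mul (B : SL(2, ℝ)) (z : ℍ) :
    (B • z).im * (B 1 0 ^ 2 + B 1 1 ^ 2) ≤ (1 + ‖(z : ℂ)‖ ^ 2) / z.im := by
  have h1 := UpperHalfPlane.im_le_im_mul_exp_dist (B • z) (B • I)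
  rw [dist_smul, im_sl_smul B I] at h1
  have hpos : 0 < B 1 0 ^ 2 + B 1 1 ^ 2 := by
    have hdet := sl_det B
    by_contra! h
    have h1 : B 1 0 = 0 := by nlinarith [sq_nonneg (B 1 0), sq_nonneg (B 1 1)]
    have h2 : B 1 1 = 0 := by nlinarith [sq_nonneg (B 1 0), sq_nonneg (B 1 1)]
    simp [h1, h2] at hdet
  have h2 : Real.exp (dist z I) ≤ (1 + ‖(z : ℂ)‖ ^ 2) / z.im := by
    rw [← two_mul_cosh_dist_I, Real.cosh_eq, dist_comm]
    linarith [Real.exp_pos (-dist I z)]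
  refine le_trans ?_ h2
  have h3 : I.im / ((B 1 0 * I.re + B 1 1) ^ 2 + (B 1 0 * I.im) ^ 2) =
      (B 1 0 ^ 2 + B 1 1 ^ 2)⁻¹ := by
    simp [add_comm]
  rw [h3] at h1
  calc (B • z).im * (B 1 0 ^ 2 + B 1 1 ^ 2)
      ≤ (B 1 0 ^ 2 + B 1 1 ^ 2)⁻¹ * Real.exp (dist z I) * (B 1 0 ^ 2 + B 1 1 ^ 2) := by gcongr
    _ = Real.exp (dist z I) := by field_simp

/-- After a translation, the entries of an element of `Γ` not fixing the cusp are controlled by its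
lower row. -/
theorem IsScaling.exists_frobeniusSq_le (hΓ : ProperlyDiscontinuous Γ) (hσ : IsScaling Γ 𝔞 σ) :
    ∃ K : ℝ, 0 < K ∧ ∀ γ : Γ, γ ∉ cuspStabilizer Γ 𝔞 → ∃ τ ∈ cuspStabilizer Γ 𝔞, ∀ z : ℍ,
      frobeniusSq ((τ * γ : Γ) : PSL(2, ℝ)) ≤
        K * (((1 + ‖(z : ℂ)‖ ^ 2) / z.im) / (σ⁻¹ • (γ : PSL(2, ℝ)) • σ • z).im) := by
  set K₀ := 8 * (Real.cosh (dist I (σ • I)) * Real.cosh (dist (σ • I) I)) with hK₀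
  have hK₀pos : 0 < K₀ := by
    have := Real.cosh_pos (dist I (σ • I))
    have := Real.cosh_pos (dist (σ • I) I)
    positivity
  refine ⟨K₀ * 4, by positivity, fun γ hγ ↦ ?_⟩
  obtain ⟨B, hB⟩ := exists_lift (σ⁻¹ * γ * σ)
  have hc := hσ.one_le_abs_of_notMem hΓ hγ hB
  have hc0 : B 1 0 ≠ 0 := fun h ↦ by norm_num [h] at hc
  have hc2 : 1 ≤ B 1 0 ^ 2 := by
    rw [← sq_abs]
    exact one_le_pow₀ hc
  -- Rounding makes the new upper left entry at most `|c|` in absolute value, without changing the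
  -- lower row.
  set k : ℤ := -round (B 0 0 / B 1 0) with hk
  refine ⟨hσ.shift k, hσ.shift_mem k, fun z ↦ ?_⟩
  set B' := translationSL k * B with hB'
  have hconj : ((hσ.shift k * γ : Γ) : PSL(2, ℝ)) = σ * QuotientGroup.mk B' * σ⁻¹ := by
    have h1 : (QuotientGroup.mk B' : PSL(2, ℝ)) = translation k * (σ⁻¹ * γ * σ) := by
      rw [← hB]; rfl
    rw [h1]
    simp only [IsScaling.shift, Subgroup.coe_mul]
    group
  rw [hconj]
  refine (frobeniusSq_conj_le σ _).trans ?_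
  rw [mul_assoc K₀]
  refine mul_le_mul_of_nonneg_left ?_ hK₀pos.le
  have h10 : B' 1 0 = B 1 0 := by simp [hB', sl_mul_apply]
  have h11 : B' 1 1 = B 1 1 := by simp [hB', sl_mul_apply]
  have h00 : |B' 0 0| ≤ |B 1 0| := by
    have h1 : B' 0 0 = (B 0 0 / B 1 0 - round (B 0 0 / B 1 0)) * B 1 0 := by
      simp only [hB', hk, sl_mul_apply, translationSL_apply_zero_zero,
        translationSL_apply_zero_one]
      push_cast
      field_simp
      ring
    rw [h1, abs_mul]
    refine mul_le_of_le_one_left (abs_nonneg _) ?_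
    linarith [abs_sub_round (B 0 0 / B 1 0)]
  have h00' : B' 0 0 ^ 2 ≤ B 1 0 ^ 2 := sq_le_sq.mpr h00
  -- From `b c = a d - 1` with `|a| ≤ |c|` and `1 ≤ |c|`.
  have h01' : B' 0 1 ^ 2 ≤ 2 * B 1 0 ^ 2 + 2 * B 1 1 ^ 2 := by
    have hdet := sl_det B'
    rw [h10, h11] at hdet
    have h1 : (B' 0 1 * B 1 0) ^ 2 ≤ (2 * B 1 0 ^ 2 + 2 * B 1 1 ^ 2) * B 1 0 ^ 2 := by
      have h2 : B' 0 1 * B 1 0 = B' 0 0 * B 1 1 - 1 := by linarith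
      rw [h2]
      have h3 : (B' 0 0 * B 1 1 - 1) ^ 2 ≤ 2 * (B' 0 0 ^ 2 * B 1 1 ^ 2) + 2 := by
        nlinarith [sq_nonneg (B' 0 0 * B 1 1 + 1)]
      have h4 : B' 0 0 ^ 2 * B 1 1 ^ 2 ≤ B 1 0 ^ 2 * B 1 1 ^ 2 := by gcongr
      nlinarith
    rw [mul_pow] at h1
    exact le_of_mul_le_mul_right h1 (by positivity)
  have hz : σ⁻¹ • (γ : PSL(2, ℝ)) • σ • z = B • z := by
    rw [← mk_smul_upperHalfPlane, hB, ← mul_smul, ← mul_smul, mul_assoc]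
  rw [hz, frobeniusSq_mk, h10, h11]
  have h5 : B 1 0 ^ 2 + B 1 1 ^ 2 ≤ ((1 + ‖(z : ℂ)‖ ^ 2) / z.im) / (B • z).im := by
    rw [le_div_iff₀ (B • z).im_pos, mul_comm]
    exact im_le_im_smul_I_mul B z
  linarith [sq_nonneg (B 1 1)]

/-- Replacing `γ` by `τ γ` with `τ` fixing the cusp changes neither norm, as `τ⁻¹` is a unitary
right factor of the inverse, while a suitable `τ` makes `μ(τ γ)` comparable to the bound. -/
theorem IsGrowthExponent.exists_norm_le (hΓ : ProperlyDiscontinuous Γ)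
    {χ : Γ →* (V →L[ℂ] V)ˣ} (hχ : UnitaryAtCusps χ) {σ₀ : ℝ} (h : IsGrowthExponent χ σ₀)
    (h𝔞 : IsCuspOf 𝔞 Γ) (hσ : IsScaling Γ 𝔞 σ) :
    ∃ C : ℝ, 0 < C ∧ ∀ (z : ℍ) (γ : Γ),
      ‖(χ γ : V →L[ℂ] V)‖ ≤
        C * ((σ⁻¹ • (γ : PSL(2, ℝ)) • σ • z).im ^ (1 - σ₀) *
          ((1 + ‖(z : ℂ)‖ ^ 2) / z.im) ^ (σ₀ - 1)) ∧
      ‖(χ γ⁻¹ : V →L[ℂ] V)‖ ≤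
        C * ((σ⁻¹ • (γ : PSL(2, ℝ)) • σ • z).im ^ (1 - σ₀) *
          ((1 + ‖(z : ℂ)‖ ^ 2) / z.im) ^ (σ₀ - 1)) := by
  obtain ⟨hσ₀, ⟨C, hC, hbound⟩, -⟩ := h
  obtain ⟨K, hK, hfrob⟩ := hσ.exists_frobeniusSq_le hΓ
  have hβ : 0 ≤ σ₀ - 1 := by linarith
  have hKβ : 0 < K ^ (σ₀ - 1) := Real.rpow_pos_of_pos hK _
  -- The summand `1` serves the `γ` fixing the cusp, where `χ` has norm at most one and `X / Y ≥ 1`.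
  refine ⟨C * K ^ (σ₀ - 1) + 1, by positivity, fun z γ ↦ ?_⟩
  set Y := (σ⁻¹ • (γ : PSL(2, ℝ)) • σ • z).im with hY
  have hY0 : 0 < Y := UpperHalfPlane.im_pos _
  set X := (1 + ‖(z : ℂ)‖ ^ 2) / z.im with hX
  have hX0 : 0 < X := by
    have := z.im_pos
    positivity
  have hXY : Y ^ (1 - σ₀) * X ^ (σ₀ - 1) = (X / Y) ^ (σ₀ - 1) := by
    rw [Real.div_rpow hX0.le hY0.le, ← neg_sub σ₀ 1, Real.rpow_neg hY0.le]
    field_simp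
  rw [hXY]
  have hXYpos : 0 < (X / Y) ^ (σ₀ - 1) := Real.rpow_pos_of_pos (by positivity) _
  by_cases hγ : γ ∈ cuspStabilizer Γ 𝔞
  · have h1 : 1 ≤ (C * K ^ (σ₀ - 1) + 1) * (X / Y) ^ (σ₀ - 1) := by
      have hYz : Y = z.im := by
        obtain ⟨k, hk⟩ := hσ.exists_eq_translation hγ
        have : σ⁻¹ • (γ : PSL(2, ℝ)) • σ • z = (σ⁻¹ * γ * σ) • z := by
          rw [← mul_smul, ← mul_smul, mul_assoc]
        rw [hY, this, hk, im_translation_smul]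
      have h2 : 1 ≤ X / Y := by
        have hz := z.im_pos
        rw [hX, hYz, div_div, le_div_iff₀ (by positivity), one_mul, ← Complex.normSq_eq_norm_sq,
          Complex.normSq_apply, coe_im, coe_re]
        nlinarith [sq_nonneg z.re]
      have h3 := Real.one_le_rpow h2 hβ
      have h4 : 0 < C * K ^ (σ₀ - 1) := by positivity
      nlinarith
    exact ⟨(hχ.norm_le_one h𝔞 hγ).trans h1, (hχ.norm_le_one h𝔞 (inv_mem hγ)).trans h1⟩
  · obtain ⟨τ, hτ, hτγ⟩ := hfrob γ hγ
    have h1 : C * frobeniusSq ((τ * γ : Γ) : PSL(2, ℝ)) ^ (σ₀ - 1) ≤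
        (C * K ^ (σ₀ - 1) + 1) * (X / Y) ^ (σ₀ - 1) := by
      have h0 := frobeniusSq_nonneg ((τ * γ : Γ) : PSL(2, ℝ))
      calc C * frobeniusSq ((τ * γ : Γ) : PSL(2, ℝ)) ^ (σ₀ - 1)
          ≤ C * (K * (X / Y)) ^ (σ₀ - 1) := by
            gcongr
            exact hτγ z
        _ = C * K ^ (σ₀ - 1) * (X / Y) ^ (σ₀ - 1) := by
          rw [Real.mul_rpow hK.le (by positivity), mul_assoc]
        _ ≤ _ := by
          gcongr
          linarith
    constructor
    · rw [← hχ.norm_mul_eq h𝔞 hτ γ]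
      exact (hbound _).trans h1
    · rw [← hχ.norm_mul_eq' h𝔞 (inv_mem hτ) γ⁻¹, ← _root_.mul_inv_rev]
      refine (hbound _).trans ?_
      rw [Subgroup.coe_inv, frobeniusSq_inv]
      exact h1

end TwistedEisenstein

/-! ## Summability over uniformly discrete families -/

namespace TwistedEisenstein

open Filter Topology

/-- A box above height `m` whose Euclidean sides are proportional to `m` has hyperbolic size
independent of `m`. -/
theorem dist_lt_of_mem_box {w w' : ℍ} {m N l r : ℝ} (hm : 0 < m)
    (hw : m < w.im) (hw' : m < w'.im) (hl : w.im ≤ l * m) (hl' : w'.im ≤ l * m)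
    (hre : |w.re - w'.re| < N * m) (hr : N + (l - 1) ≤ r) : dist w w' < r := by
  have h1 : dist (w : ℂ) w' ≤ |w.re - w'.re| + |w.im - w'.im| := by
    rw [Complex.dist_eq]
    simpa using Complex.norm_le_abs_re_add_abs_im ((w : ℂ) - w')
  have h2 : |w.im - w'.im| ≤ (l - 1) * m := by
    rw [abs_le]; constructor <;> linarith
  have h3 : m ≤ √(w.im * w'.im) := by
    apply Real.le_sqrt_of_sq_le
    rw [sq]
    gcongr
  have h0 : dist (w : ℂ) w' < r * m := by
    have : (N + (l - 1)) * m ≤ r * m := by gcongr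
    linarith
  calc dist w w' ≤ dist (w : ℂ) w' / √(w.im * w'.im) := dist_le_dist_coe_div_sqrt w w'
    _ ≤ dist (w : ℂ) w' / m := by gcongr
    _ < r := by rwa [div_lt_iff₀ hm]

theorem summable_geometric_mul_rpow {c d : ℝ} (hc0 : 0 ≤ c) (hc : c < 1) (hd : 1 < d) :
    Summable fun p : ℕ × ℕ ↦ c ^ p.1 * ((p.2 : ℝ) + 1) ^ (-d) := by
  have h1 : Summable fun n : ℕ ↦ ((n : ℝ) + 1) ^ (-d) := by
    have := (Real.summable_nat_rpow (p := -d)).mpr (by linarith)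
    simpa using (summable_nat_add_iff 1).mpr this
  have h2 : (0 : ℕ → ℝ) ≤ fun n : ℕ ↦ c ^ n := fun n ↦ pow_nonneg hc0 n
  have h3 : (0 : ℕ → ℝ) ≤ fun n : ℕ ↦ ((n : ℝ) + 1) ^ (-d) := fun n ↦
    Real.rpow_nonneg (by positivity) _
  exact (summable_geometric_of_lt_one hc0 hc).mul_of_nonneg h1 h2 h3

/-- A uniformly discrete family of points in a half strip of bounded height has convergent
series of powers of the imaginary parts, for all exponents greater than one. -/
theorem summable_im_rpow {ι : Type*} {w : ι → ℍ} {Y r : ℝ} (hY : 0 < Y) (hr : 0 < r)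
    (h0 : ∀ i, 0 ≤ (w i).re) (h1 : ∀ i, (w i).re < 1) (hw : ∀ i, (w i).im ≤ Y)
    (hsep : ∀ i j, i ≠ j → r ≤ dist (w i) (w j)) {t : ℝ} (ht : 1 < t) :
    Summable fun i ↦ (w i).im ^ t := by
  set l : ℝ := 1 + r / 4 with hl
  have hl1 : 1 < l := by linarith
  have hl0 : 0 < l := by linarith
  set N : ℝ := 2 * l / (Y * r) with hN
  have hN0 : 0 < N := by positivity
  have hk : ∀ i, ∃ k : ℕ, l ^ k ≤ Y / (w i).im ∧ Y / (w i).im < l ^ (k + 1) := fun i ↦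
    exists_nat_pow_near ((one_le_div (w i).im_pos).mpr (hw i)) hl1
  choose k hk1 hk2 using hk
  -- The pair `(k, j)` names a box: heights between `Y / l ^ (k + 1)` and `Y / l ^ k`, and width `1
  -- / (N * l ^ k)`. Boxes have diameter below `r`, so each contains at most one point.
  set j : ι → ℕ := fun i ↦ ⌊(w i).re * (N * l ^ k i)⌋₊ with hj
  have hj1 : ∀ i, (j i : ℝ) ≤ (w i).re * (N * l ^ k i) := fun i ↦
    Nat.floor_le (by have := h0 i; positivity)
  have hj2 : ∀ i, (w i).re * (N * l ^ k i) < j i + 1 := fun i ↦ Nat.lt_floor_add_one _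
  have hupper : ∀ i, (w i).im ≤ Y / l ^ k i := fun i ↦ by
    have := hk1 i
    rw [le_div_iff₀ (w i).im_pos] at this
    rw [le_div_iff₀ (by positivity)]
    linarith
  have hlower : ∀ i, Y / l ^ (k i + 1) < (w i).im := fun i ↦ by
    have := hk2 i
    rw [div_lt_iff₀ (w i).im_pos] at this
    rw [div_lt_iff₀ (by positivity)]
    linarith
  have hinj : Function.Injective fun i ↦ (k i, j i) := by
    intro i i' h
    by_contra hne
    obtain ⟨hkk, hjj⟩ := Prod.mk.injEq .. ▸ h
    refine absurd (hsep i i' hne) (not_le.mpr ?_)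
    have hm : Y / l ^ k i = l * (Y / l ^ (k i + 1)) := by
      rw [pow_succ]; field_simp
    refine dist_lt_of_mem_box (m := Y / l ^ (k i + 1)) (N := r / 2) (l := l) (by positivity)
      (hlower i) (hkk ▸ hlower i') (hm ▸ hupper i) ?_ ?_ (by linarith)
    · rw [← hm, hkk]; exact hupper i'
    · have e : r / 2 * (Y / l ^ (k i + 1)) = 1 / (N * l ^ k i) := by
        rw [hN, pow_succ]; field_simp
      rw [e, lt_div_iff₀ (by positivity)]
      have hp : 0 < N * l ^ k i := by positivity
      have a1 := hj1 i; have a2 := hj2 i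
      have b1 := hj1 i'; have b2 := hj2 i'
      rw [← hkk, ← hjj] at b1 b2
      have e2 : |(w i).re - (w i').re| * (N * l ^ k i) =
          |(w i).re * (N * l ^ k i) - (w i').re * (N * l ^ k i)| := by
        rw [← sub_mul, abs_mul, abs_of_pos hp]
      rw [e2, abs_lt]
      constructor <;> linarith
  -- As `t = 1 + 2 * δ`, one `δ` gives geometric decay in `k`; the rest is `(l ^ k) ^ (-(1 + δ))`,
  -- and `j + 1 ≤ (N + 1) * l ^ k` turns it into a summable power of `j + 1`.
  set δ : ℝ := (t - 1) / 2 with hδ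
  have hδ0 : 0 < δ := by rw [hδ]; linarith
  have hsum := ((summable_geometric_mul_rpow (c := l ^ (-δ)) (d := 1 + δ) (by positivity)
    (Real.rpow_lt_one_of_one_lt_of_neg hl1 (by linarith)) (by linarith)).mul_left
      (Y ^ t * (N + 1) ^ (1 + δ))).comp_injective hinj
  refine Summable.of_nonneg_of_le (fun i ↦ by have := (w i).im_pos; positivity) (fun i ↦ ?_) hsum
  have ha : (1 : ℝ) ≤ l ^ k i := one_le_pow₀ hl1.le
  have hja : (j i : ℝ) + 1 ≤ (N + 1) * l ^ k i := by
    have : (w i).re * (N * l ^ k i) ≤ 1 * (N * l ^ k i) := by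
      have := (h1 i).le
      gcongr
    linarith [hj1 i]
  simp only [Function.comp]
  calc (w i).im ^ t ≤ (Y / l ^ k i) ^ t := by
        have := (w i).im_pos
        exact Real.rpow_le_rpow this.le (hupper i) (by linarith)
    _ = Y ^ t * ((l ^ (-δ)) ^ k i * (l ^ k i) ^ (-(1 + δ))) := by
        rw [Real.div_rpow hY.le (by positivity), div_eq_mul_inv,
          ← Real.rpow_neg (by positivity)]
        congr 1
        rw [← Real.rpow_natCast (l ^ (-δ)), ← Real.rpow_mul hl0.le, mul_comm (-δ),
          Real.rpow_mul hl0.le, Real.rpow_natCast, ← Real.rpow_add (by positivity)]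
        congr 1
        rw [hδ]; ring
    _ ≤ Y ^ t * ((l ^ (-δ)) ^ k i * ((N + 1) ^ (1 + δ) * ((j i : ℝ) + 1) ^ (-(1 + δ)))) := by
        gcongr
        rw [Real.rpow_neg (by positivity), Real.rpow_neg (by positivity), ← div_eq_mul_inv,
          inv_eq_one_div, div_le_div_iff₀ (by positivity) (by positivity), one_mul,
          ← Real.mul_rpow (by positivity) (by positivity)]
        gcongr
    _ = _ := by ring

theorem ProperlyDiscontinuous.exists_le_dist {Γ : Subgroup PSL(2, ℝ)}
    (hΓ : ProperlyDiscontinuous Γ) (htf : ∀ γ ∈ Γ, IsOfFinOrder γ → γ = 1) (z : ℍ) :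
    ∃ r : ℝ, 0 < r ∧ ∀ γ : Γ, γ ≠ 1 → r ≤ dist z ((γ : PSL(2, ℝ)) • z) := by
  have hfin : {γ : Γ | dist z ((γ : PSL(2, ℝ)) • z) ≤ 1}.Finite := hΓ.finite_psl z z 1
  have hfin' := (hfin.subset (Set.sep_subset _ fun γ ↦ γ ≠ 1)).image
    fun γ : Γ ↦ dist z ((γ : PSL(2, ℝ)) • z)
  obtain ⟨r, hr0, hr⟩ : ∃ r : ℝ, 0 < r ∧ ∀ x ∈ (fun γ : Γ ↦ dist z ((γ : PSL(2, ℝ)) • z)) ''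
      {γ ∈ {γ : Γ | dist z ((γ : PSL(2, ℝ)) • z) ≤ 1} | γ ≠ 1}, r ≤ x := by
    rcases Set.eq_empty_or_nonempty ((fun γ : Γ ↦ dist z ((γ : PSL(2, ℝ)) • z)) ''
      {γ ∈ {γ : Γ | dist z ((γ : PSL(2, ℝ)) • z) ≤ 1} | γ ≠ 1}) with h | h
    · exact ⟨1, one_pos, fun x hx ↦ by rw [h] at hx; exact hx.elim⟩
    · obtain ⟨x, hx, hmin⟩ := hfin'.exists_minimalFor id _ h
      refine ⟨x, ?_, fun y hy ↦ ?_⟩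
      · obtain ⟨γ, hγ, rfl⟩ := hx
        exact dist_pos.mpr fun he ↦ hΓ.smul_ne htf γ.2 (fun h1 ↦ hγ.2 (Subtype.ext h1)) z he.symm
      · rcases le_total x y with h | h
        · exact h
        · exact hmin hy h
  refine ⟨min r 1, by positivity, fun γ hγ ↦ ?_⟩
  by_cases h : dist z ((γ : PSL(2, ℝ)) • z) ≤ 1
  · exact (min_le_left _ _).trans (hr _ ⟨γ, ⟨h, hγ⟩, rfl⟩)
  · exact (min_le_right _ _).trans (not_le.mp h).le

end TwistedEisenstein

/-! ## Convergence of the Eisenstein series -/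

namespace TwistedEisenstein

open Filter Topology

variable {Γ : Subgroup PSL(2, ℝ)} {V : Type*} [NormedAddCommGroup V] [InnerProductSpace ℂ V]
  {𝔞 : OnePoint ℝ} {σ : PSL(2, ℝ)}

theorem IsScaling.exists_rep (hσ : IsScaling Γ 𝔞 σ) (z : ℍ) (q : CuspCosets Γ 𝔞) :
    ∃ γ : Γ, (Quotient.mk _ γ : CuspCosets Γ 𝔞) = q ∧
      0 ≤ (σ⁻¹ • (γ : PSL(2, ℝ)) • z).re ∧ (σ⁻¹ • (γ : PSL(2, ℝ)) • z).re < 1 := by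
  induction q using Quotient.inductionOn with
  | h γ =>
    set k : ℤ := -⌊(σ⁻¹ • (γ : PSL(2, ℝ)) • z).re⌋ with hk
    refine ⟨hσ.shift k * γ, Quotient.sound ?_, ?_⟩
    · refine QuotientGroup.rightRel_apply.mpr ?_
      have e : γ * (hσ.shift k * γ)⁻¹ = (hσ.shift k)⁻¹ := by group
      rw [e]
      exact inv_mem (hσ.shift_mem k)
    · rw [hσ.inv_smul_shift_mul_smul, UpperHalfPlane.vadd_re, hk]
      push_cast
      constructor
      · linarith [Int.floor_le (σ⁻¹ • (γ : PSL(2, ℝ)) • z).re]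
      · linarith [Int.lt_floor_add_one (σ⁻¹ • (γ : PSL(2, ℝ)) • z).re]

/-- A point of the orbit of `z` under `Γ`, in the coordinates of the scaling element, for each
coset. The imaginary parts of these points have convergent series of powers. -/
theorem IsScaling.exists_rep_summable (hΓ : ProperlyDiscontinuous Γ)
    (htf : ∀ γ ∈ Γ, IsOfFinOrder γ → γ = 1) (hσ : IsScaling Γ 𝔞 σ) (z : ℍ) :
    ∃ γ : CuspCosets Γ 𝔞 → Γ, (∀ q, (Quotient.mk _ (γ q) : CuspCosets Γ 𝔞) = q) ∧
      ∀ t : ℝ, 1 < t → Summable fun q ↦ (σ⁻¹ • (γ q : PSL(2, ℝ)) • z).im ^ t := by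
  choose γ hγ h0 h1 using hσ.exists_rep z
  obtain ⟨r, hr0, hr⟩ := hΓ.exists_le_dist htf z
  refine ⟨γ, hγ, fun t ht ↦ summable_im_rpow (Y := (σ⁻¹ • z).im + ((σ⁻¹ • z).im)⁻¹)
    (by have := (σ⁻¹ • z).im_pos; positivity) hr0 h0 h1
    (fun q ↦ hσ.im_smul_le hΓ z (γ q)) (fun q q' hne ↦ ?_) ht⟩
  -- The action is by isometries, so the injectivity radius at `z` separates the whole orbit.
  have h := hr ((γ q)⁻¹ * γ q') fun h ↦ hne (by
    rw [← hγ q, ← hγ q', inv_mul_eq_one.mp h])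
  rwa [Subgroup.coe_mul, Subgroup.coe_inv, mul_smul, ← dist_smul (γ q : PSL(2, ℝ)),
    smul_inv_smul, ← dist_smul σ⁻¹] at h

theorem isCompact_subset_bounds {x : ℝ} {K : Set (ℍ × ℂ)} (hK : IsCompact K)
    (hKx : K ⊆ {p : ℍ × ℂ | x < p.2.re}) (w : ℍ) :
    ∃ D t S : ℝ, 0 ≤ D ∧ x < t ∧ ∀ p ∈ K, dist p.1 w ≤ D ∧ t ≤ p.2.re ∧ p.2.re ≤ S := by
  have hre : Continuous fun p : ℍ × ℂ ↦ p.2.re := Complex.continuous_re.comp continuous_snd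
  have hd : Continuous fun p : ℍ × ℂ ↦ dist p.1 w := by fun_prop
  rcases K.eq_empty_or_nonempty with rfl | hne
  · exact ⟨0, x + 1, 0, le_rfl, by linarith, by simp⟩
  obtain ⟨p₁, -, h1⟩ := hK.exists_isMaxOn hne hd.continuousOn
  obtain ⟨p₂, hp₂, h2⟩ := hK.exists_isMinOn hne hre.continuousOn
  obtain ⟨p₃, -, h3⟩ := hK.exists_isMaxOn hne hre.continuousOn
  exact ⟨dist p₁.1 w, p₂.2.re, p₃.2.re, dist_nonneg, hKx hp₂, fun p hp ↦
    ⟨h1 hp, h2 hp, h3 hp⟩⟩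

/-- Heights may exceed one, so `y ^ s` need not decrease in `s`; boundedness of `y` gives a bound
uniform in `s` all the same. -/
theorem rpow_le_max_mul_rpow {y Y t s S : ℝ} (hy : 0 < y) (hyY : y ≤ Y) (hts : t ≤ s)
    (hsS : s ≤ S) : y ^ s ≤ max 1 Y ^ (S - t) * y ^ t := by
  have h1 : y ^ (s - t) ≤ max 1 Y ^ (S - t) := by
    calc y ^ (s - t) ≤ max 1 Y ^ (s - t) :=
          Real.rpow_le_rpow hy.le (hyY.trans (le_max_right _ _)) (by linarith)
      _ ≤ max 1 Y ^ (S - t) := Real.rpow_le_rpow_of_exponent_le (le_max_left _ _) (by linarith)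
  calc y ^ s = y ^ (s - t) * y ^ t := by rw [← Real.rpow_add hy]; congr 1; ring
    _ ≤ _ := by gcongr

variable [FiniteDimensional ℂ V]

theorem norm_cuspProjection_le_one (χ : Γ →* (V →L[ℂ] V)ˣ) (𝔞 : OnePoint ℝ) :
    ‖cuspProjection χ 𝔞‖ ≤ 1 :=
  Submodule.starProjection_norm_le _

theorem norm_eisensteinTerm_mk_le (χ : Γ →* (V →L[ℂ] V)ˣ) (hσ : IsScaling Γ 𝔞 σ) (γ : Γ)
    (p : ℍ × ℂ) : ‖eisensteinTerm χ hσ (Quotient.mk _ γ) p‖ ≤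
      (σ⁻¹ • (γ : PSL(2, ℝ)) • p.1).im ^ p.2.re * ‖(χ γ⁻¹ : V →L[ℂ] V)‖ := by
  have e : eisensteinTerm χ hσ (Quotient.mk _ γ) p =
      (((σ⁻¹ • (γ : PSL(2, ℝ)) • p.1).im : ℝ) : ℂ) ^ p.2 •
      ((χ γ⁻¹ : V →L[ℂ] V) ∘L cuspProjection χ 𝔞) := rfl
  rw [e, norm_smul, Complex.norm_cpow_eq_rpow_re_of_pos (UpperHalfPlane.im_pos _)]
  have h1 : ‖(χ γ⁻¹ : V →L[ℂ] V) ∘L cuspProjection χ 𝔞‖ ≤ ‖(χ γ⁻¹ : V →L[ℂ] V)‖ := by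
    refine (ContinuousLinearMap.opNorm_comp_le _ _).trans ?_
    exact mul_le_of_le_one_right (norm_nonneg _) (norm_cuspProjection_le_one χ 𝔞)
  have := (σ⁻¹ • (γ : PSL(2, ℝ)) • p.1).im_pos
  gcongr

/-- A bound at a single point `w` suffices: on a compact set heights change at most by a factor `exp
D`. The terms are dominated by multiples of `y ^ (t - β)` with `t - β > 1`, and the Weierstrass test
applies. -/
theorem eisensteinConverges_of_norm_le (hΓ : ProperlyDiscontinuous Γ)
    (htf : ∀ γ ∈ Γ, IsOfFinOrder γ → γ = 1) (χ : Γ →* (V →L[ℂ] V)ˣ) (hσ : IsScaling Γ 𝔞 σ)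
    {β C : ℝ} (w : ℍ)
    (h : ∀ γ : Γ, ‖(χ γ⁻¹ : V →L[ℂ] V)‖ ≤ C * (σ⁻¹ • (γ : PSL(2, ℝ)) • w).im ^ (-β))
    (hβ : 0 ≤ β) :
    EisensteinConverges χ hσ (1 + β) := by
  have hopen : IsOpen {p : ℍ × ℂ | 1 + β < p.2.re} :=
    isOpen_lt continuous_const (Complex.continuous_re.comp continuous_snd)
  have key : ∀ K ⊆ {p : ℍ × ℂ | 1 + β < p.2.re}, IsCompact K →
      ∃ u : CuspCosets Γ 𝔞 → ℝ, Summable u ∧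
        ∀ q, ∀ p ∈ K, ‖eisensteinTerm χ hσ q p‖ ≤ u q := by
    intro K hKs hK
    obtain ⟨D, t, S, hD, ht, hb⟩ := isCompact_subset_bounds hK hKs w
    obtain ⟨γ, hγ, hsum⟩ := hσ.exists_rep_summable hΓ htf w
    set Y := (σ⁻¹ • w).im + ((σ⁻¹ • w).im)⁻¹ with hY
    refine ⟨fun q ↦ max 1 (Y * Real.exp D) ^ (S - t) * Real.exp D ^ t * C *
      (σ⁻¹ • (γ q : PSL(2, ℝ)) • w).im ^ (t - β), (hsum _ (by linarith)).mul_left _,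
      fun q p hp ↦ ?_⟩
    obtain ⟨hd, hts, hsS⟩ := hb p hp
    set y := (σ⁻¹ • (γ q : PSL(2, ℝ)) • w).im with hy
    have hy0 : 0 < y := UpperHalfPlane.im_pos _
    have h1 : (σ⁻¹ • (γ q : PSL(2, ℝ)) • p.1).im ≤ y * Real.exp D := by
      refine (UpperHalfPlane.im_le_im_mul_exp_dist _ (σ⁻¹ • (γ q : PSL(2, ℝ)) • w)).trans ?_
      rw [dist_smul, dist_smul]
      gcongr
    have h2 : y * Real.exp D ≤ Y * Real.exp D := by
      have := hσ.im_smul_le hΓ w (γ q)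
      gcongr
    have h3 : (σ⁻¹ • (γ q : PSL(2, ℝ)) • p.1).im ^ p.2.re ≤
        max 1 (Y * Real.exp D) ^ (S - t) * (y * Real.exp D) ^ t := by
      refine (Real.rpow_le_rpow (UpperHalfPlane.im_pos _).le h1 (by linarith)).trans ?_
      exact rpow_le_max_mul_rpow (by positivity) h2 hts hsS
    have h4 := norm_eisensteinTerm_mk_le χ hσ (γ q) p
    rw [hγ q] at h4
    refine h4.trans ?_
    calc _ ≤ (max 1 (Y * Real.exp D) ^ (S - t) * (y * Real.exp D) ^ t) * (C * y ^ (-β)) :=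
          mul_le_mul h3 (h _) (norm_nonneg _) (by positivity)
      _ = max 1 (Y * Real.exp D) ^ (S - t) * Real.exp D ^ t * C * y ^ (t - β) := by
          rw [Real.mul_rpow hy0.le (Real.exp_pos D).le, sub_eq_add_neg t β, Real.rpow_add hy0]
          ring
  refine ⟨SummableLocallyUniformlyOn_of_locally_bounded hopen fun K hKs hK ↦ ?_,
    hasSumLocallyUniformlyOn_of_forall_compact hopen fun K hKs hK ↦ ?_⟩
  · obtain ⟨u, hu, hb⟩ := key K hKs hK
    exact ⟨u, hu, fun q p hp ↦ by simpa using hb q p hp⟩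
  · obtain ⟨u, hu, hb⟩ := key K hKs hK
    exact HasSumUniformlyOn.of_norm_le_summable hu hb

theorem IsGrowthExponent.eisensteinConverges (hΓ : ProperlyDiscontinuous Γ)
    (htf : ∀ γ ∈ Γ, IsOfFinOrder γ → γ = 1) {χ : Γ →* (V →L[ℂ] V)ˣ} (hχ : UnitaryAtCusps χ)
    {σ₀ : ℝ} (h : IsGrowthExponent χ σ₀) (h𝔞 : IsCuspOf 𝔞 Γ) (hσ : IsScaling Γ 𝔞 σ) :
    EisensteinConverges χ hσ σ₀ := by
  obtain ⟨C, -, hC⟩ := h.exists_norm_le hΓ hχ h𝔞 hσ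
  have h1 := eisensteinConverges_of_norm_le hΓ htf χ hσ (β := σ₀ - 1)
    (C := C * ((1 + ‖((I : ℍ) : ℂ)‖ ^ 2) / (I : ℍ).im) ^ (σ₀ - 1)) (σ • I) (fun γ ↦ by
      refine (hC I γ).2.trans_eq ?_
      rw [neg_sub]
      ring) (by linarith [h.1])
  rwa [add_sub_cancel] at h1

end TwistedEisenstein


theorem proposition3p3 (Γ : Subgroup PSL(2, ℝ)) (hΓ : TwistedEisenstein.IsLattice Γ)
    (htf : ∀ γ ∈ Γ, IsOfFinOrder γ → γ = 1)
    (hcusp : ∃ 𝔞 : OnePoint ℝ, TwistedEisenstein.IsCuspOf 𝔞 Γ)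
    {V : Type*} [NormedAddCommGroup V] [InnerProductSpace ℂ V] [FiniteDimensional ℂ V]
    (χ : Γ →* (V →L[ℂ] V)ˣ) (hχ : TwistedEisenstein.UnitaryAtCusps χ) :
    (∃ σ₀ : ℝ, TwistedEisenstein.IsGrowthExponent χ σ₀) ∧
    (∀ 𝔞 : OnePoint ℝ, TwistedEisenstein.IsCuspOf 𝔞 Γ →
      ∃ σ : PSL(2, ℝ), TwistedEisenstein.IsScaling Γ 𝔞 σ) ∧
    (∀ σ₀ : ℝ, TwistedEisenstein.IsGrowthExponent χ σ₀ →
      ∀ 𝔞 : OnePoint ℝ, TwistedEisenstein.IsCuspOf 𝔞 Γ →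
      ∀ (σ : PSL(2, ℝ)) (hσ : TwistedEisenstein.IsScaling Γ 𝔞 σ),
        TwistedEisenstein.EisensteinConverges χ hσ σ₀ ∧
        ∃ C : ℝ, 0 < C ∧ ∀ (z : ℍ) (γ : Γ),
          ‖(χ γ : V →L[ℂ] V)‖ ≤
            C * ((σ⁻¹ • (γ : PSL(2, ℝ)) • σ • z).im ^ (1 - σ₀) *
              ((1 + ‖(z : ℂ)‖ ^ 2) / z.im) ^ (σ₀ - 1)) ∧
          ‖(χ γ⁻¹ : V →L[ℂ] V)‖ ≤
            C * ((σ⁻¹ • (γ : PSL(2, ℝ)) • σ • z).im ^ (1 - σ₀) *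
              ((1 + ‖(z : ℂ)‖ ^ 2) / z.im) ^ (σ₀ - 1))) ∧
    (∃ α : ℝ, 0 < α ∧
      ∀ 𝔞 : OnePoint ℝ, TwistedEisenstein.IsCuspOf 𝔞 Γ →
      ∀ (σ : PSL(2, ℝ)) (hσ : TwistedEisenstein.IsScaling Γ 𝔞 σ),
        (∃ C : ℍ → ℝ, Continuous C ∧ (∀ z, 0 < C z) ∧ ∀ (z : ℍ) (γ : Γ),
          ‖(χ γ : V →L[ℂ] V)‖ ≤ C z * (σ⁻¹ • (γ : PSL(2, ℝ)) • z).im ^ (-α)) ∧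
        TwistedEisenstein.EisensteinConverges χ hσ (1 + α)) := by
  have := hΓ.1
  have hΓ' := TwistedEisenstein.properlyDiscontinuous_of_discrete Γ
  obtain ⟨σ₁, hσ₁⟩ := hχ.exists_isGrowthExponent hΓ' htf hΓ.thickPartCompact hcusp
  refine ⟨⟨σ₁, hσ₁⟩, fun 𝔞 h𝔞 ↦ hΓ'.exists_isScaling h𝔞, fun σ₀ hσ₀ 𝔞 h𝔞 σ hσ ↦
    ⟨hσ₀.eisensteinConverges hΓ' htf hχ h𝔞 hσ, hσ₀.exists_norm_le hΓ' hχ h𝔞 hσ⟩,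
    σ₁ - 1, by linarith [hσ₁.1], fun 𝔞 h𝔞 σ hσ ↦ ⟨?_, ?_⟩⟩
  -- With `α = σ₁ - 1`, the bound already proved is used at the point `σ⁻¹ z`; the remaining factor
  -- depends continuously on `z`.
  · obtain ⟨C, hC0, hC⟩ := hσ₁.exists_norm_le hΓ' hχ h𝔞 hσ
    have hpos : ∀ z : ℍ, 0 < (1 + ‖((σ⁻¹ • z : ℍ) : ℂ)‖ ^ 2) / (σ⁻¹ • z).im := fun z ↦ by
      have := (σ⁻¹ • z).im_pos
      positivity
    refine ⟨fun z ↦ C * ((1 + ‖((σ⁻¹ • z : ℍ) : ℂ)‖ ^ 2) / (σ⁻¹ • z).im) ^ (σ₁ - 1), ?_,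
      fun z ↦ mul_pos hC0 (Real.rpow_pos_of_pos (hpos z) _), fun z γ ↦ ?_⟩
    · have hs : Continuous fun z : ℍ ↦ σ⁻¹ • z := (isometry_smul ℍ σ⁻¹).continuous
      have h1 : Continuous fun z : ℍ ↦ ((σ⁻¹ • z : ℍ) : ℂ) := UpperHalfPlane.continuous_coe.comp hs
      have h2 : Continuous fun z : ℍ ↦ (σ⁻¹ • z : ℍ).im := UpperHalfPlane.continuous_im.comp hs
      exact continuous_const.mul (((continuous_const.add (h1.norm.pow 2)).div h2
        fun z ↦ (UpperHalfPlane.im_pos _).ne').rpow_const fun z ↦ Or.inl (hpos z).ne')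
    · have := (hC (σ⁻¹ • z) γ).1
      rw [smul_inv_smul] at this
      refine this.trans_eq ?_
      rw [neg_sub]
      ring
  · rw [add_sub_cancel]
    exact hσ₁.eisensteinConverges hΓ' htf hχ h𝔞 hσ
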